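/- Let $M$ be a smooth Riemannian manifold (finite-dimensional, Hausdorff, without boundary, not necessarily complete) with Levi-Civita connection $\nabla$. Let $R$ be its curvature tensor, with the sign convention $R(X,Y)Z=\nabla_Y\nabla_XZ-\nabla_X\nabla_YZ+\nabla_{[X,Y]}Z$. For a path $y:[0,1]\to M$ and a vector field $V(\varepsilon)\in T_{y(\varepsilon)}M$ along $y$, let $\frac{\nabla}{\partial\varepsilon}$ denote the covariant derivative along $y$, and put $$\zeta(\varepsilon)=\exp_{y(0)}^{-1}\bigl(\exp_{y(\varepsilon)}V(\varepsilon)\bigr)\in T_{y(0)}M .$$ Here $\exp_x^{-1}(q)$ is the unique shortest $v\in T_xM$ with $\exp_xv=q$. Let $K\subset M$ be compact and $A\in\mathbb R$. Then there are constants $\gamma_0>0$ and $C$, depending only on $M$, $K$ and $A$, such that the following holds for all $0<\gamma\le\gamma_0$ and all $y,V$ as above with $y(0)\in K$ and $$\|y'\|\le A\gamma,\qquad \|V\|\le A\gamma,\qquad \Bigl\|\tfrac{\nabla V}{\partial\varepsilon}\Bigr\|\le A\gamma\qquad\text{at }\varepsilon=0.$$ All right-hand sides below are evaluated at $\varepsilon=0$,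 and $O(\gamma^4)$ denotes a vector of norm at most $C\gamma^4$. (i) If $y$ and $V$ are of class $C^1$, then for all $\varepsilon\in[0,1]$ near $0$ the point $\exp_{y(\varepsilon)}V(\varepsilon)$ and the vector $\zeta(\varepsilon)$ are well defined, $\zeta$ is $C^1$ near $0$, and $$\zeta'(0)=y'+\frac{\nabla V}{\partial\varepsilon}-\frac13R(V,y')V+O(\gamma^4).$$ (ii) If $y$ and $V$ are of class $C^2$ and $\bigl\|\frac{\nabla y'}{\partial\varepsilon}(0)\bigr\|\le A\gamma$, then $\zeta$ is $C^2$ near $0$ and $$\zeta''(0)=\frac{\nabla y'}{\partial\varepsilon}+\frac{\nabla^2V}{\partial\varepsilon^2}-\frac13R\Bigl(V,\frac{\nabla y'}{\partial\varepsilon}\Bigr)V-\frac23R\Bigl(\frac{\nabla V}{\partial\varepsilon},y'\Bigr)V+\frac13R(y',V)\Bigl(y'+2\frac{\nabla V}{\partial\varepsilon}\Bigr)+O(\gamma^4).$$ (iii) If $y$ and $V$ are of class $C^3$ and $\frac{\nabla y'}{\partial\varepsilon}(0)$, $\frac{\nabla^2y'}{\partial\varepsilon^2}(0)$, $\frac{\nabla^2V}{\partial\varepsilon^2}(0)$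 have norm at most $A\gamma$, then $\zeta$ is $C^3$ near $0$ and $$\begin{aligned}\zeta^{(3)}(0)={}&\frac{\nabla^2y'}{\partial\varepsilon^2}+\frac{\nabla^3V}{\partial\varepsilon^3}+R\Bigl(y',\frac{\nabla V}{\partial\varepsilon}\Bigr)\Bigl(y'+2\frac{\nabla V}{\partial\varepsilon}\Bigr)+R(y',V)\Bigl(\frac{\nabla y'}{\partial\varepsilon}+2\frac{\nabla^2V}{\partial\varepsilon^2}\Bigr)\\&+R\Bigl(V,\frac{\nabla^2V}{\partial\varepsilon^2}\Bigr)y'+R\Bigl(V,\frac{\nabla V}{\partial\varepsilon}\Bigr)\frac{\nabla y'}{\partial\varepsilon}+2R\Bigl(\frac{\nabla y'}{\partial\varepsilon},V\Bigr)\frac{\nabla V}{\partial\varepsilon}-\frac13R\Bigl(V,\frac{\nabla^2y'}{\partial\varepsilon^2}\Bigr)V+O(\gamma^4).\end{aligned}$$ -/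

import Mathlib

open Bundle Set Filter
open scoped Manifold ContDiff Topology

noncomputable section

namespace RiemGeom

/-! Basic Riemannian geometry of a smooth manifold `M` without boundary, modelled on a finite
dimensional space `E`, whose tangent bundle carries a Riemannian metric. Local coordinates are
Mathlib's charts `extChartAt 𝓘(ℝ, E) p`. The tangent space at `x` is the type `E`, a tangent vector
being identified with its coordinates in the preferred chart at `x`. -/

variable {E : Type*} [NormedAddCommGroup E] [NormedSpace ℝ E]
  {M : Type*} [TopologicalSpace M] [ChartedSpace E M]

/-- The velocity `y'(ε)`, an element of the tangent space at `y(ε)`, of a path `y` on `[0, 1]`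
(one-sided at the end points). -/
def velocity (E : Type*) [NormedAddCommGroup E] [NormedSpace ℝ E] {M : Type*} [TopologicalSpace M]
    [ChartedSpace E M] (y : ℝ → M) (ε : ℝ) : TangentSpace 𝓘(ℝ, E) (y ε) :=
  mfderivWithin 𝓘(ℝ, ℝ) 𝓘(ℝ, E) y (Icc 0 1) ε (1 : ℝ)

/-- `V` is a vector field of class `C^k` along the path `y` on `[0, 1]`; in particular `y` is of
class `C^k` on `[0, 1]`. -/
def IsFieldAlong [IsManifold 𝓘(ℝ, E) 1 M] (k : ℕ) (y : ℝ → M)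
    (V : ∀ ε, TangentSpace 𝓘(ℝ, E) (y ε)) : Prop :=
  ContMDiffOn 𝓘(ℝ, ℝ) 𝓘(ℝ, E).tangent k
    (fun ε ↦ (⟨y ε, V ε⟩ : TangentBundle 𝓘(ℝ, E) M)) (Icc 0 1)

variable [RiemannianBundle (fun x : M ↦ TangentSpace 𝓘(ℝ, E) x)]

/-- The matrix `g_{ij}` of the metric, as a bilinear form, in the chart centred at `p`, at the point
with coordinates `z`: the pullback of the metric under the inverse of the chart. -/
def metricCoord (p : M) (z : E) : E →L[ℝ] E →L[ℝ] ℝ :=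
  let A : E →L[ℝ] TangentSpace 𝓘(ℝ, E) ((extChartAt 𝓘(ℝ, E) p).symm z) :=
    mfderiv 𝓘(ℝ, E) 𝓘(ℝ, E) (extChartAt 𝓘(ℝ, E) p).symm z
  (innerSL ℝ (E := TangentSpace 𝓘(ℝ, E) ((extChartAt 𝓘(ℝ, E) p).symm z))).bilinearComp A A

/-- The local connector (Christoffel symbols) `Γ(z)(u ⊗ v)` of the Levi-Civita connection in the
chart centred at `p`. It is determined by the formula
`2 g(Γ(u ⊗ v), w) = Dg(u)(v, w) + Dg(v)(u, w) - Dg(w)(u, v)` for all `w`. -/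
def christoffel (p : M) (z u v : E) : E :=
  (1 / 2 : ℝ) • (metricCoord p z).inverse
    (fderiv ℝ (metricCoord p) z u v + fderiv ℝ (metricCoord p) z v u
      - ((fderiv ℝ (metricCoord p) z).flip u).flip v)

/-- The curvature tensor
`R(u, v)w = DΓ(v)(w ⊗ u) - DΓ(u)(w ⊗ v) + Γ(Γ(w ⊗ u) ⊗ v) - Γ(Γ(w ⊗ v) ⊗ u)`
at `x`, that is, with the sign convention `R(X, Y)Z = ∇_Y ∇_X Z - ∇_X ∇_Y Z + ∇_[X,Y] Z`. -/
def curvature (x : M) (u v w : TangentSpace 𝓘(ℝ, E) x) : TangentSpace 𝓘(ℝ, E) x :=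
  let Γ : E → E → E → E := christoffel x
  let z : E := extChartAt 𝓘(ℝ, E) x x
  fderiv ℝ (fun z' ↦ Γ z' w u) z v - fderiv ℝ (fun z' ↦ Γ z' w v) z u
    + Γ z (Γ z w u) v - Γ z (Γ z w v) u

/-- The covariant derivative `∇V/∂ε = V' + Γ(y)(V ⊗ y')` at `ε` of a vector field `V` along a path
`y` on `[0, 1]`, computed in the chart centred at `y(ε)`; there `V'` is the derivative of the
coordinates of `V` in that fixed chart. -/
def covDeriv (y : ℝ → M) (V : ∀ ε, TangentSpace 𝓘(ℝ, E) (y ε)) (ε : ℝ) :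
    TangentSpace 𝓘(ℝ, E) (y ε) :=
  let coordV : ℝ → E := fun s ↦ mfderiv 𝓘(ℝ, E) 𝓘(ℝ, E) (extChartAt 𝓘(ℝ, E) (y ε)) (y s) (V s)
  derivWithin coordV (Icc 0 1) ε
    + christoffel (y ε) (extChartAt 𝓘(ℝ, E) (y ε) (y ε)) (V ε) (velocity E y ε)

/-- `c` is, on `[0, 1]`, a geodesic with initial point and initial velocity given by the tangent
vector `P`. -/
def IsGeodesicFrom (P : TangentBundle 𝓘(ℝ, E) M) (c : ℝ → M) : Prop :=
  ContMDiffOn 𝓘(ℝ, ℝ) 𝓘(ℝ, E) 2 c (Icc 0 1) ∧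
    (∀ t ∈ Icc (0 : ℝ) 1, covDeriv c (velocity E c) t = 0) ∧
    (⟨c 0, velocity E c 0⟩ : TangentBundle 𝓘(ℝ, E) M) = P

/-- The domain of the exponential map: the tangent vectors `P` whose geodesic lives up to time `1`.
(It is everything when `M` is complete.) -/
def expDomain (E : Type*) [NormedAddCommGroup E] [NormedSpace ℝ E] (M : Type*) [TopologicalSpace M]
    [ChartedSpace E M] [RiemannianBundle (fun x : M ↦ TangentSpace 𝓘(ℝ, E) x)] :
    Set (TangentBundle 𝓘(ℝ, E) M) :=
  {P | ∃ c : ℝ → M, IsGeodesicFrom P c}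

open Classical in
/-- The exponential map `exp_x v`: the point at time `1` of the geodesic starting from `x` with
velocity `v` (by convention `x` outside of its domain). -/
def riemExp (x : M) (v : TangentSpace 𝓘(ℝ, E) x) : M :=
  if h : ∃ c : ℝ → M, IsGeodesicFrom (⟨x, v⟩ : TangentBundle 𝓘(ℝ, E) M) c then h.choose 1 else x

/-- `v` is the unique shortest tangent vector at `x` that the exponential map sends to `q`. -/
def IsExpInv (x q : M) (v : TangentSpace 𝓘(ℝ, E) x) : Prop :=
  (⟨x, v⟩ : TangentBundle 𝓘(ℝ, E) M) ∈ expDomain E M ∧ riemExp x v = q ∧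
    ∀ w : TangentSpace 𝓘(ℝ, E) x, (⟨x, w⟩ : TangentBundle 𝓘(ℝ, E) M) ∈ expDomain E M →
      riemExp x w = q → w ≠ v → ‖v‖ < ‖w‖

open Classical in
/-- The inverse exponential map `exp_x⁻¹(q)`: the unique shortest tangent vector at `x` that the
exponential map sends to `q` (by convention `0` if there is none). Within the injectivity radius
this is the inverse of the diffeomorphism `exp_x`. -/
def riemExpInv (x q : M) : TangentSpace 𝓘(ℝ, E) x :=
  if h : ∃ v : TangentSpace 𝓘(ℝ, E) x, IsExpInv x q v then h.choose else 0

/-- `ζ(ε) = exp_{y(0)}⁻¹(exp_{y(ε)} V(ε))`. -/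
def zeta (y : ℝ → M) (V : ∀ ε, TangentSpace 𝓘(ℝ, E) (y ε)) (ε : ℝ) :
    TangentSpace 𝓘(ℝ, E) (y 0) :=
  riemExpInv (y 0) (riemExp (y ε) (V ε))

end RiemGeom

end

/-! The three expansions follow from one computation in normal coordinates around `y(0)`.

Let `G(h, v) = exp_h v` be the exponential map in normal coordinates around `x = y(0)`, and let `Γ`
be the local connector in these coordinates. There `exp_x` is the identity, so
`ζ(ε) = G(h(ε), v(ε))` with `h` and `v` the coordinates of `y` and `V`, and `h(0) = 0`. The
derivatives of `ζ` at `0` are those of `G` at `(0, v(0))`, evaluated at the coordinate derivatives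
of `h` and `v`. Since
`G(h, 0) = h`, `G(0, v) = v` and `Γ(0) = 0`, the second derivative of `G` vanishes at the origin,
and its third derivative there is the symmetrization of `-DΓ(0)` (`IsNormalExp.third_apply`); the
Taylor formula for `DG`, `D²G` and `D³G` leaves errors of order `γ⁴`, because the derivatives of `h`
and `v` that enter the errors are of order `γ`; the highest derivative of `v` is not bounded, but it
does not enter them, since `G(0, ·)` is the identity. Coordinate derivatives differ from covariant
ones by terms in `Γ`, which at `h = 0` involve only `DΓ(0)` up to order `γ⁴`. The cyclic identity
`DΓ(0)(u)(v, w) + DΓ(0)(v)(w, u) + DΓ(0)(w)(u, v) = 0` of normal coordinates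
(`IsNormalExp.conn_cyclic`) turns the resulting expressions into curvature terms. This gives
`IsNormalExp.first_order`, `second_order` and `third_order`.

The constants have to be uniform in `x`. Around each point `p`, the connector of the chart at `p` is
extended to the whole model space. The implicit function theorem in a space of continuous paths
gives an exponential map depending smoothly on its base point (`exists_localExp`), the inverse
function theorem gives normal coordinates around all points close to `p`, and the bounds on the
derivatives hold by continuity (`exists_isNormalFamily`). Connectors are compared through their
transformation rule `IsConnectionMap`; it holds for the changes of charts, since Koszul's formula is
natural (`isConnectionMap_leviCivita`), and for the passage to normal coordinates, by
differentiating the identity which says that geodesics correspond (`isConnectionMap_of_intertwine`).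
The curvature and the covariant derivatives therefore have the same expression in all charts. On the
manifold, geodesics are unique (`IsGeodesicFrom.eq_of_mem_Icc`), so that the exponential map is the
one of the chart (`IsNormalChart.riemExp_eq`). A competing preimage that is not longer than the one
given by the normal coordinates stays in the domain of these coordinates, hence is the same vector
(`IsNormalChart.isExpInv`); so `ζ` is what it is in the chart (`IsNormalChart.eventually_zeta`).
Compactness of `K` makes the constants global. -/

set_option autoImplicit false
set_option maxSynthPendingDepth 3

namespace RiemGeom

section Coordinates

-- The two instances removed here apply to every type by higher order unification, and slow down
-- instance search in the part of the file that deals with normed spaces only.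
attribute [-instance]
  Bundle.instNormedAddCommGroupOfRiemannianBundleOfIsTopologicalAddGroupOfContinuousConstSMulReal
  Bundle.instInnerProductSpaceReal

/-! ### Superposition operators on spaces of continuous functions -/

section Superposition

variable {X : Type*} [TopologicalSpace X] [CompactSpace X]
  {F G : Type*} [NormedAddCommGroup F] [NormedSpace ℝ F] [NormedAddCommGroup G] [NormedSpace ℝ G]

/-- Pointwise application of a continuous family of linear maps, as a continuous linear map. -/
noncomputable def pointwiseApply (X F G : Type*) [TopologicalSpace X] [CompactSpace X]
    [NormedAddCommGroup F] [NormedSpace ℝ F] [NormedAddCommGroup G] [NormedSpace ℝ G] :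
    C(X, F →L[ℝ] G) →L[ℝ] C(X, F) →L[ℝ] C(X, G) :=
  LinearMap.mkContinuous₂
    (LinearMap.mk₂ ℝ
      (fun (A : C(X, F →L[ℝ] G)) (h : C(X, F)) ↦
        (⟨fun t ↦ A t (h t), A.continuous.clm_apply h.continuous⟩ : C(X, G)))
      (fun _ _ _ ↦ by ext; simp) (fun _ _ _ ↦ by ext; simp)
      (fun _ _ _ ↦ by ext; simp) (fun _ _ _ ↦ by ext; simp)) 1 (by
    intro A h
    rw [ContinuousMap.norm_le _ (by positivity)]
    intro t
    calc ‖A t (h t)‖ ≤ ‖A t‖ * ‖h t‖ := (A t).le_opNorm _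
      _ ≤ 1 * ‖A‖ * ‖h‖ := by
        rw [one_mul]
        exact mul_le_mul (A.norm_coe_le_norm t) (h.norm_coe_le_norm t) (norm_nonneg _)
          (norm_nonneg _))

@[simp] lemma pointwiseApply_apply (A : C(X, F →L[ℝ] G)) (h : C(X, F)) (t : X) :
    pointwiseApply X F G A h t = A t (h t) := rfl

lemma hasFDerivAt_superposition (f : C(F, G)) (f' : C(F, F →L[ℝ] G))
    (hf : ∀ x, HasFDerivAt f (f' x) x) (u : C(X, F)) :
    HasFDerivAt (fun u : C(X, F) ↦ f.comp u) (pointwiseApply X F G (f'.comp u)) u := by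
  rw [hasFDerivAt_iff_isLittleO_nhds_zero, Asymptotics.isLittleO_iff]
  intro c hc
  have hK : IsCompact (range u) := isCompact_range u.continuous
  have h1 := hK.uniformContinuousAt_of_continuousAt f' (fun a _ ↦ f'.continuous.continuousAt)
    (Metric.dist_mem_uniformity hc)
  obtain ⟨δ, hδ, h2⟩ := Metric.mem_uniformity_dist.1 h1
  filter_upwards [Metric.ball_mem_nhds (0 : C(X, F)) hδ] with h hh
  rw [ContinuousMap.norm_le _ (by positivity)]
  intro t
  have hht : ‖h t‖ ≤ ‖h‖ := h.norm_coe_le_norm t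
  have hhδ : ‖h‖ < δ := by simpa using hh
  have key := (convex_ball (u t) δ).norm_image_sub_le_of_norm_hasFDerivWithin_le'
    (f := f) (f' := fun x ↦ f' x) (φ := f' (u t)) (C := c) (x := u t) (y := u t + h t)
    (fun x _ ↦ (hf x).hasFDerivWithinAt) (fun x hx ↦ by
      have := @h2 (u t) x (by rw [dist_comm]; exact hx) ⟨t, rfl⟩
      have h3 : dist (f' (u t)) (f' x) < c := this
      rw [dist_comm, dist_eq_norm] at h3
      exact h3.le) (Metric.mem_ball_self hδ) (by simpa using hht.trans_lt hhδ)
  simp only [add_sub_cancel_left] at key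
  refine le_trans ?_ (key.trans (mul_le_mul_of_nonneg_left hht hc.le))
  simp

/-- The superposition operator `u ↦ f ∘ u` of a smooth function is smooth: its derivative is the
pointwise multiplication by the superposition operator of the derivative of `f`. -/
lemma contDiff_superposition.{u} {F : Type u} [NormedAddCommGroup F] [NormedSpace ℝ F]
    (n : ℕ) {G : Type u} [NormedAddCommGroup G] [NormedSpace ℝ G]
    (f : C(F, G)) (hf : ContDiff ℝ n f) :
    ContDiff ℝ n (fun u : C(X, F) ↦ f.comp u) := by
  induction n generalizing G with
  | zero => exact contDiff_zero.2 (ContinuousMap.continuous_postcomp f)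
  | succ n ih =>
    obtain ⟨f', hf', hff'⟩ := contDiff_succ_iff_hasFDerivAt.1 (by exact_mod_cast hf)
    have := ih (⟨f', hf'.continuous⟩ : C(F, F →L[ℝ] G)) hf'
    exact_mod_cast contDiff_succ_iff_hasFDerivAt.2
      ⟨fun u ↦ pointwiseApply X F G ((⟨f', hf'.continuous⟩ : C(F, F →L[ℝ] G)).comp u),
        (pointwiseApply X F G).contDiff.comp this,
        fun u ↦ hasFDerivAt_superposition f ⟨f', hf'.continuous⟩ hff' u⟩

end Superposition

/-! ### Geodesics in coordinates -/

section Geodesics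

variable {E : Type*} [NormedAddCommGroup E] [NormedSpace ℝ E]

/-- The pair `(c, c')` solves the geodesic equation `c'' = -Γ(c)(c' ⊗ c')` on `[a, b]`, and `c'` is
the derivative of `c`. -/
def IsGeodesicPair (Γ : E → E →L[ℝ] E →L[ℝ] E) (c c' : ℝ → E) (a b : ℝ) : Prop :=
  ∀ t ∈ Icc a b, HasDerivWithinAt c (c' t) (Icc a b) t ∧
    HasDerivWithinAt c' (-Γ (c t) (c' t) (c' t)) (Icc a b) t

lemma IsGeodesicPair.unique [FiniteDimensional ℝ E] {Γ : E → E →L[ℝ] E →L[ℝ] E}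
    (hΓ : ContDiff ℝ 1 Γ) {c₁ c₁' c₂ c₂' : ℝ → E} {a b : ℝ} (h₁ : IsGeodesicPair Γ c₁ c₁' a b)
    (h₂ : IsGeodesicPair Γ c₂ c₂' a b) (h : c₁ a = c₂ a) (h' : c₁' a = c₂' a) :
    ∀ t ∈ Icc a b, c₁ t = c₂ t ∧ c₁' t = c₂' t := by
  let f : E × E → E × E := fun P ↦ (P.2, -Γ P.1 P.2 P.2)
  have hf : ContDiff ℝ 1 f := by fun_prop
  have k₁ : ContinuousOn (fun t ↦ (c₁ t, c₁' t)) (Icc a b) := fun t ht ↦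
    ((h₁ t ht).1.continuousWithinAt).prodMk ((h₁ t ht).2.continuousWithinAt)
  have k₂ : ContinuousOn (fun t ↦ (c₂ t, c₂' t)) (Icc a b) := fun t ht ↦
    ((h₂ t ht).1.continuousWithinAt).prodMk ((h₂ t ht).2.continuousWithinAt)
  obtain ⟨r, hr⟩ := ((isCompact_Icc.image_of_continuousOn k₁).union
    (isCompact_Icc.image_of_continuousOn k₂)).isBounded.subset_closedBall (0 : E × E)
  obtain ⟨K, hK⟩ := (isCompact_closedBall (0 : E × E) r).exists_bound_of_continuousOn
    (hf.continuous_fderiv one_ne_zero).continuousOn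
  have hL : LipschitzOnWith K.toNNReal f (Metric.closedBall 0 r) :=
    (convex_closedBall _ _).lipschitzOnWith_of_nnnorm_fderiv_le
      (fun x _ ↦ (hf.differentiable one_ne_zero) x)
      (fun x hx ↦ by
        rw [← norm_toNNReal]
        exact Real.toNNReal_le_toNNReal (hK x hx))
  have hnhds : ∀ t ∈ Ico a b, Icc a b ∈ 𝓝[Ici t] t := fun t ht ↦
    mem_of_superset (Icc_mem_nhdsGE ht.2) (Icc_subset_Icc_left ht.1)
  have := ODE_solution_unique_of_mem_Icc_right (v := fun _ ↦ f)
    (s := fun _ ↦ Metric.closedBall 0 r) (fun _ _ ↦ hL) k₁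
    (fun t ht ↦ ((h₁ t (Ico_subset_Icc_self ht)).1.prodMk
      (h₁ t (Ico_subset_Icc_self ht)).2).mono_of_mem_nhdsWithin (hnhds t ht))
    (fun t ht ↦ hr (Or.inl ⟨t, Ico_subset_Icc_self ht, rfl⟩)) k₂
    (fun t ht ↦ ((h₂ t (Ico_subset_Icc_self ht)).1.prodMk
      (h₂ t (Ico_subset_Icc_self ht)).2).mono_of_mem_nhdsWithin (hnhds t ht))
    (fun t ht ↦ hr (Or.inr ⟨t, Ico_subset_Icc_self ht, rfl⟩)) (by simp [h, h'])
  intro t ht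
  exact Prod.mk.inj (this ht)

/-- The primitive `t ↦ ∫₀ᵗ w` of a continuous function on `[0, 1]`. -/
noncomputable def primitive (E : Type*) [NormedAddCommGroup E] [NormedSpace ℝ E] :
    C(Icc (0 : ℝ) 1, E) →L[ℝ] C(Icc (0 : ℝ) 1, E) :=
  LinearMap.mkContinuous
    { toFun := fun w ↦ ⟨fun t ↦ ∫ s in (0 : ℝ)..t, w (projIcc 0 1 zero_le_one s), by
        have : Continuous fun s ↦ w (projIcc 0 1 zero_le_one s) :=
          w.continuous.comp continuous_projIcc
        exact (intervalIntegral.continuous_primitive (fun _ _ ↦ this.intervalIntegrable _ _)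
          0).comp continuous_subtype_val⟩
      map_add' := fun w₁ w₂ ↦ by
        ext t
        simp only [ContinuousMap.coe_mk, ContinuousMap.add_apply]
        exact intervalIntegral.integral_add
          ((w₁.continuous.comp continuous_projIcc).intervalIntegrable _ _)
          ((w₂.continuous.comp continuous_projIcc).intervalIntegrable _ _)
      map_smul' := fun r w ↦ by ext t; simp } 1 (by
    intro w
    rw [ContinuousMap.norm_le _ (by positivity)]
    intro t
    refine (intervalIntegral.norm_integral_le_of_norm_le_const (C := ‖w‖)
      (fun x _ ↦ w.norm_coe_le_norm _)).trans ?_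
    rw [sub_zero, abs_of_nonneg t.2.1, one_mul]
    exact mul_le_of_le_one_right (norm_nonneg _) t.2.2)

lemma primitive_apply (w : C(Icc (0 : ℝ) 1, E)) (t : Icc (0 : ℝ) 1) :
    primitive E w t = ∫ s in (0 : ℝ)..t, w (projIcc 0 1 zero_le_one s) := rfl

lemma hasDerivWithinAt_primitive [CompleteSpace E] (w : C(Icc (0 : ℝ) 1, E)) {t : ℝ}
    (ht : t ∈ Icc (0 : ℝ) 1) :
    HasDerivWithinAt (fun s ↦ primitive E w (projIcc 0 1 zero_le_one s)) (w ⟨t, ht⟩)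
      (Icc 0 1) t := by
  have h : Continuous fun s ↦ w (projIcc 0 1 zero_le_one s) := w.continuous.comp continuous_projIcc
  have h1 := (h.integral_hasStrictDerivAt 0 t).hasDerivAt.hasDerivWithinAt (s := Icc (0 : ℝ) 1)
  rw [projIcc_of_mem _ ht] at h1
  refine h1.congr (fun s hs ↦ ?_) ?_
  · rw [projIcc_of_mem _ hs, primitive_apply]
  · rw [projIcc_of_mem _ ht, primitive_apply]

/-- The constant path, as a continuous linear map. -/
noncomputable def constPath (E : Type*) [NormedAddCommGroup E] [NormedSpace ℝ E] :
    E →L[ℝ] C(Icc (0 : ℝ) 1, E) :=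
  LinearMap.mkContinuous
    { toFun := ContinuousMap.const _
      map_add' := fun _ _ ↦ rfl
      map_smul' := fun _ _ ↦ rfl } 1 (fun x ↦ by
    rw [ContinuousMap.norm_le _ (by positivity)]
    intro t
    rw [one_mul]
    exact le_rfl)

@[simp] lemma constPath_apply (x : E) (t : Icc (0 : ℝ) 1) : constPath E x t = x := rfl

/-- The velocity `v + ∫₀ᵗ w`, as a linear function of the initial data `(x, v)` and of the
acceleration `w`. -/
noncomputable def velocityPath (E : Type*) [NormedAddCommGroup E] [NormedSpace ℝ E] :
    (E × E) × C(Icc (0 : ℝ) 1, E) →L[ℝ] C(Icc (0 : ℝ) 1, E) :=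
  constPath E ∘L .snd ℝ E E ∘L .fst ℝ _ _ + primitive E ∘L .snd ℝ _ _

/-- The position `x + ∫₀ᵗ (v + ∫₀ˢ w)`, as a linear function of the initial data `(x, v)` and of the
acceleration `w`. -/
noncomputable def positionPath (E : Type*) [NormedAddCommGroup E] [NormedSpace ℝ E] :
    (E × E) × C(Icc (0 : ℝ) 1, E) →L[ℝ] C(Icc (0 : ℝ) 1, E) :=
  constPath E ∘L .fst ℝ E E ∘L .fst ℝ _ _ + primitive E ∘L velocityPath E

lemma velocityPath_apply (q : (E × E) × C(Icc (0 : ℝ) 1, E)) (t : Icc (0 : ℝ) 1) :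
    velocityPath E q t = q.1.2 + primitive E q.2 t := rfl

lemma positionPath_apply (q : (E × E) × C(Icc (0 : ℝ) 1, E)) (t : Icc (0 : ℝ) 1) :
    positionPath E q t = q.1.1 + primitive E (velocityPath E q) t := rfl

/-- The paths of positions and velocities, in the product space. -/
noncomputable def phasePath (E : Type*) [NormedAddCommGroup E] [NormedSpace ℝ E] :
    (E × E) × C(Icc (0 : ℝ) 1, E) →L[ℝ] C(Icc (0 : ℝ) 1, E × E) :=
  ContinuousLinearMap.compLeftContinuous ℝ (Icc (0 : ℝ) 1) (.inl ℝ E E) ∘L positionPath E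
    + ContinuousLinearMap.compLeftContinuous ℝ (Icc (0 : ℝ) 1) (.inr ℝ E E) ∘L velocityPath E

lemma phasePath_apply (q : (E × E) × C(Icc (0 : ℝ) 1, E)) (t : Icc (0 : ℝ) 1) :
    phasePath E q t = (positionPath E q t, velocityPath E q t) := by
  simp [phasePath]

lemma primitive_zero_apply (w : C(Icc (0 : ℝ) 1, E)) :
    primitive E w ⟨0, by simp⟩ = 0 := by
  simp [primitive_apply]

/-- The spray of `Γ` on `E × E`. -/
noncomputable def sprayMap (Γ : E → E →L[ℝ] E →L[ℝ] E) (P : E × E) : E := Γ P.1 P.2 P.2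

lemma hasFDerivAt_sprayMap {Γ : E → E →L[ℝ] E →L[ℝ] E} (hΓ : ContDiff ℝ 1 Γ) (p : E) :
    HasFDerivAt (sprayMap Γ) (0 : E × E →L[ℝ] E) (p, 0) := by
  have h1 : HasFDerivAt (fun P : E × E ↦ Γ P.1) (fderiv ℝ Γ p ∘L .fst ℝ E E) (p, (0 : E)) :=
    HasFDerivAt.comp (p, (0 : E)) ((hΓ.differentiable one_ne_zero) p).hasFDerivAt hasFDerivAt_fst
  have h2 := (h1.clm_apply (hasFDerivAt_snd (p := (p, (0 : E))))).clm_apply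
    (hasFDerivAt_snd (p := (p, (0 : E))))
  refine h2.congr_fderiv ?_
  ext <;> simp

/-- Short geodesics exist on `[0, 1]` and depend smoothly on the initial position `x` and the
initial velocity `v`. The implicit function theorem, applied to the geodesic equation
`w + Γ(c)(c' ⊗ c') = 0` for the acceleration `w ∈ C([0, 1], E)`, gives `w` as a function of
`(x, v)`. -/
lemma exists_geodesicPair_contDiffAt.{u} {E : Type u} [NormedAddCommGroup E] [NormedSpace ℝ E]
    [CompleteSpace E] {Γ : E → E →L[ℝ] E →L[ℝ] E} (hΓ : ContDiff ℝ ∞ Γ) (p : E) (n : ℕ)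
    (hn : n ≠ 0) :
    ∃ W : E × E → C(Icc (0 : ℝ) 1, E), ContDiffAt ℝ n W (p, 0) ∧ ∀ᶠ P in 𝓝 (p, (0 : E)),
      IsGeodesicPair Γ
        (fun t ↦ positionPath E (P, W P) (projIcc 0 1 zero_le_one t))
        (fun t ↦ velocityPath E (P, W P) (projIcc 0 1 zero_le_one t)) 0 1 := by
  have hS : ContDiff ℝ n (sprayMap Γ) := by
    have : ContDiff ℝ n Γ := hΓ.of_le (by exact_mod_cast le_top)
    unfold sprayMap
    fun_prop
  have hS' : ContDiff ℝ 1 (sprayMap Γ) := hS.of_le (by exact_mod_cast Nat.one_le_iff_ne_zero.2 hn)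
  let S : C(E × E, E) := ⟨sprayMap Γ, hS.continuous⟩
  let S' : C(E × E, E × E →L[ℝ] E) := ⟨fderiv ℝ (sprayMap Γ), hS'.continuous_fderiv one_ne_zero⟩
  let f : (E × E) × C(Icc (0 : ℝ) 1, E) → C(Icc (0 : ℝ) 1, E) :=
    fun q ↦ q.2 + S.comp (phasePath E q)
  have hf : ContDiff ℝ n f := contDiff_snd.add
    ((contDiff_superposition n S hS).comp (phasePath E).contDiff)
  set u : (E × E) × C(Icc (0 : ℝ) 1, E) := ((p, 0), 0) with hu
  have hpos : positionPath E u = constPath E p := by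
    ext t
    simp [hu, positionPath, velocityPath]
  have hvel : velocityPath E u = 0 := by
    ext t
    simp [hu, velocityPath]
  have hfu : f u = 0 := by
    ext t
    simp [f, S, phasePath_apply, hvel, sprayMap, show u.2 = 0 from rfl]
  have hf' : HasFDerivAt f (.snd ℝ _ _) u := by
    have h1 := (hasFDerivAt_superposition S S'
      (fun x ↦ (hS'.differentiable one_ne_zero x).hasFDerivAt) (phasePath E u)).comp u
      (phasePath E).hasFDerivAt
    refine (hasFDerivAt_snd.add h1).congr_fderiv ?_
    have : S'.comp (phasePath E u) = 0 := by
      ext1 t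
      simp only [ContinuousMap.comp_apply, phasePath_apply, hpos, hvel]
      exact (hasFDerivAt_sprayMap (hΓ.of_le (by exact_mod_cast le_top)) p).fderiv
    rw [this]
    simp
  have hinv : (fderiv ℝ f u ∘L .inr ℝ (E × E) C(Icc (0 : ℝ) 1, E)).IsInvertible := by
    rw [hf'.fderiv]
    exact ⟨.refl ℝ _, by ext; simp⟩
  have hn' : (n : WithTop ℕ∞) ≠ 0 := by exact_mod_cast hn
  refine ⟨hf.contDiffAt.implicitFunction hn' hinv,
    hf.contDiffAt.contDiffAt_implicitFunction hn' hinv, ?_⟩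
  filter_upwards [hf.contDiffAt.eventually_apply_implicitFunction hn' hinv] with P hP
  set w := hf.contDiffAt.implicitFunction hn' hinv P
  rw [hfu] at hP
  intro t ht
  refine ⟨?_, ?_⟩
  · have := (hasDerivWithinAt_primitive (velocityPath E (P, w)) ht).const_add P.1
    simp only [projIcc_of_mem _ ht]
    exact this
  · have := (hasDerivWithinAt_primitive w ht).const_add P.2
    have hw : w ⟨t, ht⟩ = -Γ (positionPath E (P, w) ⟨t, ht⟩) (velocityPath E (P, w) ⟨t, ht⟩)
        (velocityPath E (P, w) ⟨t, ht⟩) := by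
      have h2 := DFunLike.congr_fun hP ⟨t, ht⟩
      simp only [f, S, ContinuousMap.add_apply, ContinuousMap.comp_apply, phasePath_apply] at h2
      exact eq_neg_of_add_eq_zero_left h2
    simp only [projIcc_of_mem _ ht]
    rw [← hw]
    exact this

/-- The local exponential map: for small `v`, `t ↦ Exp (x, t v)` is the geodesic with initial
position `x` and initial velocity `v`, and `Exp` is smooth. -/
theorem exists_localExp.{u} {E : Type u} [NormedAddCommGroup E] [NormedSpace ℝ E]
    [FiniteDimensional ℝ E] {Γ : E → E →L[ℝ] E →L[ℝ] E} (hΓ : ContDiff ℝ ∞ Γ) (p : E) (n : ℕ)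
    (hn : n ≠ 0) :
    ∃ Exp : E × E → E, ContDiffAt ℝ n Exp (p, 0) ∧ ∀ᶠ P in 𝓝 (p, (0 : E)),
      ∃ c' : ℝ → E, IsGeodesicPair Γ (fun t ↦ Exp (P.1, t • P.2)) c' 0 1 ∧
        Exp (P.1, 0) = P.1 ∧ c' 0 = P.2 := by
  obtain ⟨W, hW, h⟩ := exists_geodesicPair_contDiffAt hΓ p n hn
  let ev : C(Icc (0 : ℝ) 1, E) →L[ℝ] E := ContinuousMap.evalCLM ℝ ⟨1, by simp⟩
  let Exp : E × E → E := fun P ↦ ev (positionPath E (P, W P))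
  refine ⟨Exp, ?_, ?_⟩
  · exact ev.contDiff.contDiffAt.comp _
      ((positionPath E).contDiff.contDiffAt.comp _ (contDiffAt_id.prodMk hW))
  · obtain ⟨r, hr, hball⟩ := Metric.eventually_nhds_iff_ball.1 h
    have h0 : ∀ P, positionPath E (P, W P) ⟨0, by simp⟩ = P.1 := fun P ↦ by
      rw [positionPath_apply, primitive_zero_apply, add_zero]
    have h0' : ∀ P, velocityPath E (P, W P) ⟨0, by simp⟩ = P.2 := fun P ↦ by
      rw [velocityPath_apply, primitive_zero_apply, add_zero]
    filter_upwards [Metric.ball_mem_nhds _ hr] with P hP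
    have hmem : ∀ t ∈ Icc (0 : ℝ) 1, (P.1, t • P.2) ∈ Metric.ball (p, (0 : E)) r := by
      intro t ht
      rw [← ball_prod_same] at hP ⊢
      refine ⟨hP.1, ?_⟩
      have := hP.2
      simp only [mem_ball_zero_iff] at this ⊢
      rw [norm_smul, Real.norm_eq_abs, abs_of_nonneg ht.1]
      exact (mul_le_of_le_one_left (norm_nonneg _) ht.2).trans_lt this
    have key : ∀ t ∈ Icc (0 : ℝ) 1, Exp (P.1, t • P.2)
        = positionPath E (P, W P) (projIcc 0 1 zero_le_one t) := by
      intro t ht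
      have g1 := hball _ (hmem t ht)
      have g2 : IsGeodesicPair Γ
          (fun s ↦ positionPath E (P, W P) (projIcc 0 1 zero_le_one (t * s)))
          (fun s ↦ t • velocityPath E (P, W P) (projIcc 0 1 zero_le_one (t * s))) 0 1 := by
        intro s hs
        have hts : t * s ∈ Icc (0 : ℝ) 1 :=
          ⟨mul_nonneg ht.1 hs.1, mul_le_one₀ ht.2 hs.1 hs.2⟩
        have hmaps : MapsTo (fun s ↦ t * s) (Icc 0 1) (Icc (0 : ℝ) 1) := fun s hs ↦
          ⟨mul_nonneg ht.1 hs.1, mul_le_one₀ ht.2 hs.1 hs.2⟩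
        have hd : HasDerivWithinAt (fun s ↦ t * s) t (Icc 0 1) s := by
          simpa using ((hasDerivAt_id s).const_mul t).hasDerivWithinAt
        obtain ⟨k1, k2⟩ := hball P hP (t * s) hts
        refine ⟨HasDerivWithinAt.scomp s k1 hd hmaps, ?_⟩
        convert (HasDerivWithinAt.scomp s k2 hd hmaps).const_smul t using 1
        · rfl
        · simp only [map_smul, smul_neg, smul_apply]
      have := (g1.unique (hΓ.of_le (by exact_mod_cast le_top)) g2
        (by simp only [mul_zero, projIcc_left]; exact (h0 _).trans (h0 P).symm)
        (by simp only [mul_zero, projIcc_left]; exact (h0' _).trans (congrArg (t • ·) (h0' P).symm))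
        1 (by simp)).1
      simp only [mul_one] at this
      rw [projIcc_right] at this
      exact this
    refine ⟨fun t ↦ velocityPath E (P, W P) (projIcc 0 1 zero_le_one t), ?_, ?_, ?_⟩
    · intro t ht
      have := hball P hP t ht
      refine ⟨this.1.congr (fun s hs ↦ key s hs) (key t ht), ?_⟩
      simp only [key t ht]
      exact this.2
    · have := key 0 (by simp)
      rw [projIcc_left, h0, zero_smul] at this
      exact this
    · simp only [projIcc_left]
      exact h0' P

end Geodesics

/-! ### Changes of coordinates for connections -/

section ConnectionMaps

variable {E : Type*} [NormedAddCommGroup E] [NormedSpace ℝ E]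

lemma fderiv_fderiv_symm {F G : Type*} [NormedAddCommGroup F] [NormedSpace ℝ F]
    [NormedAddCommGroup G] [NormedSpace ℝ G] {φ : F → G} {z : F} (h : ContDiffAt ℝ 2 φ z)
    (u v : F) :
    fderiv ℝ (fderiv ℝ φ) z u v = fderiv ℝ (fderiv ℝ φ) z v u :=
  (h.isSymmSndFDerivAt (by simp)).eq u v

/-- The transformation rule of the local connectors under the change of coordinates `φ` at the point
`z`: `Γ₁` is the pullback of `Γ₂` by `φ`. -/
def IsConnectionMap (φ : E → E) (Γ₁ Γ₂ : E → E →L[ℝ] E →L[ℝ] E) (z : E) : Prop :=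
  ∀ u v, fderiv ℝ φ z (Γ₁ z u v) =
    fderiv ℝ (fderiv ℝ φ) z u v + Γ₂ (φ z) (fderiv ℝ φ z u) (fderiv ℝ φ z v)

/-- The covariant derivative along a curve is compatible with a change of coordinates. -/
lemma IsConnectionMap.hasDerivWithinAt {φ : E → E} {Γ₁ Γ₂ : E → E →L[ℝ] E →L[ℝ] E}
    {Y W : ℝ → E} {Y' W' : E} {s : Set ℝ} {ε : ℝ} (h : IsConnectionMap φ Γ₁ Γ₂ (Y ε))
    (hφ : ContDiffAt ℝ 2 φ (Y ε)) (hY : HasDerivWithinAt Y Y' s ε)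
    (hW : HasDerivWithinAt W W' s ε) :
    HasDerivWithinAt (fun t ↦ fderiv ℝ φ (Y t) (W t))
      (fderiv ℝ φ (Y ε) (W' + Γ₁ (Y ε) (W ε) Y')
        - Γ₂ (φ (Y ε)) (fderiv ℝ φ (Y ε) (W ε)) (fderiv ℝ φ (Y ε) Y')) s ε := by
  have h1 : HasFDerivAt (fderiv ℝ φ) (fderiv ℝ (fderiv ℝ φ) (Y ε)) (Y ε) :=
    ((hφ.fderiv_right (m := 1) (by norm_num)).differentiableAt one_ne_zero).hasFDerivAt
  have h2 := (h1.comp_hasDerivWithinAt ε hY).clm_apply hW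
  refine h2.congr_deriv ?_
  rw [map_add, h, fderiv_fderiv_symm hφ (W ε) Y']
  abel

/-- The curvature in coordinates, with the sign convention
`R(X, Y)Z = ∇_Y ∇_X Z - ∇_X ∇_Y Z + ∇_[X,Y] Z`. -/
noncomputable def curvatureCoord (Γ : E → E →L[ℝ] E →L[ℝ] E) (z u v w : E) : E :=
  fderiv ℝ Γ z v w u - fderiv ℝ Γ z u w v + Γ z (Γ z w u) v - Γ z (Γ z w v) u

lemma fderiv_fderiv_fderiv_symm {F G : Type*} [NormedAddCommGroup F] [NormedSpace ℝ F]
    [NormedAddCommGroup G] [NormedSpace ℝ G] {φ : F → G} {z : F} (h : ContDiffAt ℝ 3 φ z)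
    (u v w : F) :
    fderiv ℝ (fderiv ℝ (fderiv ℝ φ)) z u v w = fderiv ℝ (fderiv ℝ (fderiv ℝ φ)) z u w v := by
  have h2 : ContDiffAt ℝ 1 (fderiv ℝ (fderiv ℝ φ)) z :=
    (h.fderiv_right (m := 2) (by norm_num)).fderiv_right (by norm_num)
  have hd := (h2.differentiableAt one_ne_zero).hasFDerivAt
  have hev : ∀ᶠ z' in 𝓝 z, fderiv ℝ (fderiv ℝ φ) z' v w = fderiv ℝ (fderiv ℝ φ) z' w v := by
    filter_upwards [(h.of_le (m := 2) (by norm_num)).eventually (by simp)] with z' hz'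
    exact fderiv_fderiv_symm hz' v w
  have e1 : HasFDerivAt (fun z' ↦ fderiv ℝ (fderiv ℝ φ) z' v w)
      (((fderiv ℝ (fderiv ℝ (fderiv ℝ φ)) z).flip v).flip w) z := by
    have := (hd.clm_apply (hasFDerivAt_const v z)).clm_apply (hasFDerivAt_const w z)
    refine this.congr_fderiv ?_
    ext x; simp
  have e2 : HasFDerivAt (fun z' ↦ fderiv ℝ (fderiv ℝ φ) z' w v)
      (((fderiv ℝ (fderiv ℝ (fderiv ℝ φ)) z).flip w).flip v) z := by
    have := (hd.clm_apply (hasFDerivAt_const w z)).clm_apply (hasFDerivAt_const v z)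
    refine this.congr_fderiv ?_
    ext x; simp
  have := (e1.congr_of_eventuallyEq (f₁ := fun z' ↦ fderiv ℝ (fderiv ℝ φ) z' w v) (by
    filter_upwards [hev] with z' hz' using hz'.symm)).unique e2
  exact DFunLike.congr_fun this u

/-- The curvature is compatible with a change of coordinates. -/
lemma fderiv_curvatureCoord {φ : E → E} {Γ₁ Γ₂ : E → E →L[ℝ] E →L[ℝ] E} {z : E}
    (h : ∀ᶠ z' in 𝓝 z, IsConnectionMap φ Γ₁ Γ₂ z') (hφ : ContDiffAt ℝ 3 φ z)
    (h₁ : DifferentiableAt ℝ Γ₁ z) (h₂ : DifferentiableAt ℝ Γ₂ (φ z)) (u v w : E) :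
    fderiv ℝ φ z (curvatureCoord Γ₁ z u v w) =
      curvatureCoord Γ₂ (φ z) (fderiv ℝ φ z u) (fderiv ℝ φ z v) (fderiv ℝ φ z w) := by
  have hφ2 : ContDiffAt ℝ 2 φ z := hφ.of_le (by norm_num)
  have d0 : HasFDerivAt φ (fderiv ℝ φ z) z := (hφ.differentiableAt (by simp)).hasFDerivAt
  have d1 : HasFDerivAt (fderiv ℝ φ) (fderiv ℝ (fderiv ℝ φ) z) z :=
    ((hφ.fderiv_right (m := 2) (by norm_num)).differentiableAt (by simp)).hasFDerivAt
  have d2 : HasFDerivAt (fderiv ℝ (fderiv ℝ φ)) (fderiv ℝ (fderiv ℝ (fderiv ℝ φ)) z) z :=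
    (((hφ.fderiv_right (m := 2) (by norm_num)).fderiv_right (m := 1)
      (by norm_num)).differentiableAt (by simp)).hasFDerivAt
  have g2 : HasFDerivAt (fun z' ↦ Γ₂ (φ z')) (fderiv ℝ Γ₂ (φ z) ∘L fderiv ℝ φ z) z :=
    h₂.hasFDerivAt.comp z d0
  -- the derivative of the transformation rule in the direction `x`
  have key : ∀ a b x : E, fderiv ℝ φ z (fderiv ℝ Γ₁ z x a b) =
      fderiv ℝ (fderiv ℝ (fderiv ℝ φ)) z x a b
      + fderiv ℝ Γ₂ (φ z) (fderiv ℝ φ z x) (fderiv ℝ φ z a) (fderiv ℝ φ z b)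
      + Γ₂ (φ z) (fderiv ℝ (fderiv ℝ φ) z x a) (fderiv ℝ φ z b)
      + Γ₂ (φ z) (fderiv ℝ φ z a) (fderiv ℝ (fderiv ℝ φ) z x b)
      - fderiv ℝ (fderiv ℝ φ) z x (Γ₁ z a b) := by
    intro a b x
    have l := d1.clm_apply ((h₁.hasFDerivAt.clm_apply (hasFDerivAt_const a z)).clm_apply
      (hasFDerivAt_const b z))
    have r := ((d2.clm_apply (hasFDerivAt_const a z)).clm_apply (hasFDerivAt_const b z)).add
      ((g2.clm_apply (d1.clm_apply (hasFDerivAt_const a z))).clm_apply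
        (d1.clm_apply (hasFDerivAt_const b z)))
    have e := DFunLike.congr_fun (l.unique (r.congr_of_eventuallyEq
      (by filter_upwards [h] with z' hz' using hz' a b))) x
    simp only [add_apply, ContinuousLinearMap.comp_apply,
      ContinuousLinearMap.flip_apply, ContinuousLinearMap.comp_zero, zero_add] at e
    rw [eq_sub_iff_add_eq, e]
    abel
  have hz := h.self_of_nhds
  have s2 := fderiv_fderiv_symm hφ2
  have t3 : fderiv ℝ (fderiv ℝ (fderiv ℝ φ)) z v w u =
      fderiv ℝ (fderiv ℝ (fderiv ℝ φ)) z u w v := by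
    rw [fderiv_fderiv_symm (hφ.fderiv_right (m := 2) (by norm_num)) v w,
      fderiv_fderiv_fderiv_symm hφ w v u,
      fderiv_fderiv_symm (hφ.fderiv_right (m := 2) (by norm_num)) w u]
  simp only [curvatureCoord, map_add, map_sub, key, hz (Γ₁ z w u) v, hz (Γ₁ z w v) u, hz w u,
    hz w v, add_apply]
  rw [t3, s2 v w, s2 u w, s2 v (Γ₁ z w u), s2 u (Γ₁ z w v), s2 v u]
  abel

/-- The operator `(u, v) ↦ Dg(u)(v, ·) + Dg(v)(u, ·) - Dg(·)(u, v)`. -/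
noncomputable def koszulForm (g : E → E →L[ℝ] E →L[ℝ] ℝ) (z : E) :
    E →L[ℝ] E →L[ℝ] E →L[ℝ] ℝ :=
  fderiv ℝ g z + (fderiv ℝ g z).flip
    - (ContinuousLinearMap.flipₗᵢ ℝ E E ℝ).toContinuousLinearEquiv.toContinuousLinearMap ∘L
      (fderiv ℝ g z).flip

/-- The local connector of the Levi-Civita connection of the metric `g` on an open subset of `E`. -/
noncomputable def leviCivita (g : E → E →L[ℝ] E →L[ℝ] ℝ) (z : E) : E →L[ℝ] E →L[ℝ] E :=
  (1 / 2 : ℝ) • (ContinuousLinearMap.compL ℝ E (E →L[ℝ] ℝ) E (g z).inverse) ∘L koszulForm g z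

lemma leviCivita_apply (g : E → E →L[ℝ] E →L[ℝ] ℝ) (z u v : E) :
    leviCivita g z u v = (1 / 2 : ℝ) • (g z).inverse
      (fderiv ℝ g z u v + fderiv ℝ g z v u - ((fderiv ℝ g z).flip u).flip v) := rfl

lemma contDiffAt_leviCivita [CompleteSpace E] {g : E → E →L[ℝ] E →L[ℝ] ℝ} {z : E} {n : WithTop ℕ∞}
    (hg : ContDiffAt ℝ (n + 1) g z) (hi : (g z).IsInvertible) :
    ContDiffAt ℝ n (leviCivita g) z := by
  obtain ⟨e, he⟩ := hi
  have hg0 : ContDiffAt ℝ n g z := hg.of_le le_self_add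
  have h1 : ContDiffAt ℝ n (fderiv ℝ g) z := hg.fderiv_right le_rfl
  have h2 : ContDiffAt ℝ n (fun z ↦ (g z).inverse) z := by
    have h : ContDiffAt ℝ n ContinuousLinearMap.inverse (g z) := he ▸ contDiffAt_map_inverse e
    exact h.comp z hg0
  have h3 : ContDiffAt ℝ n (fun z ↦ (fderiv ℝ g z).flip) z :=
    (ContinuousLinearMap.flipₗᵢ ℝ E E (E →L[ℝ] ℝ)).contDiff.contDiffAt.comp z h1
  have h4 : ContDiffAt ℝ n (koszulForm g) z :=
    (h1.add h3).sub (contDiffAt_const.clm_comp h3)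
  exact ((((ContinuousLinearMap.compL ℝ E (E →L[ℝ] ℝ) E).contDiff.contDiffAt.comp z h2).clm_comp
    h4).const_smul (1 / 2 : ℝ))

lemma leviCivita_symm {g : E → E →L[ℝ] E →L[ℝ] ℝ} {z : E} (hg : DifferentiableAt ℝ g z)
    (hs : ∀ᶠ z' in 𝓝 z, ∀ u v, g z' u v = g z' v u) (u v : E) :
    leviCivita g z u v = leviCivita g z v u := by
  have : ∀ x a b, fderiv ℝ g z x a b = fderiv ℝ g z x b a := by
    intro x a b
    have e1 := (hg.hasFDerivAt.clm_apply (hasFDerivAt_const a z)).clm_apply (hasFDerivAt_const b z)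
    have e2 := (hg.hasFDerivAt.clm_apply (hasFDerivAt_const b z)).clm_apply (hasFDerivAt_const a z)
    have := DFunLike.congr_fun (e1.unique (e2.congr_of_eventuallyEq
      (by filter_upwards [hs] with z' hz' using hz' a b))) x
    simpa using this
  rw [leviCivita_apply, leviCivita_apply]
  congr 2
  ext x
  simp only [add_apply, sub_apply, ContinuousLinearMap.flip_apply]
  rw [this x u v]
  ring

/-- Koszul's formula determines the connection, so isometries of metrics are compatible with their
Levi-Civita connections. -/
lemma isConnectionMap_leviCivita {g₁ g₂ : E → E →L[ℝ] E →L[ℝ] ℝ} {φ : E → E} {z : E}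
    (hφ : ContDiffAt ℝ 2 φ z) (hφ' : (fderiv ℝ φ z).IsInvertible)
    (h : ∀ᶠ z' in 𝓝 z, ∀ u v, g₁ z' u v = g₂ (φ z') (fderiv ℝ φ z' u) (fderiv ℝ φ z' v))
    (h₁ : DifferentiableAt ℝ g₁ z) (h₂ : DifferentiableAt ℝ g₂ (φ z))
    (hi₁ : (g₁ z).IsInvertible) (hi₂ : (g₂ (φ z)).IsInvertible)
    (hs : ∀ u v, g₂ (φ z) u v = g₂ (φ z) v u) :
    IsConnectionMap φ (leviCivita g₁) (leviCivita g₂) z := by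
  have d0 : HasFDerivAt φ (fderiv ℝ φ z) z := (hφ.differentiableAt (by simp)).hasFDerivAt
  have d1 : HasFDerivAt (fderiv ℝ φ) (fderiv ℝ (fderiv ℝ φ) z) z :=
    ((hφ.fderiv_right (m := 1) (by norm_num)).differentiableAt (by simp)).hasFDerivAt
  have g2 : HasFDerivAt (fun z' ↦ g₂ (φ z')) (fderiv ℝ g₂ (φ z) ∘L fderiv ℝ φ z) z :=
    h₂.hasFDerivAt.comp z d0
  have key : ∀ x a b : E, fderiv ℝ g₁ z x a b =
      fderiv ℝ g₂ (φ z) (fderiv ℝ φ z x) (fderiv ℝ φ z a) (fderiv ℝ φ z b)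
      + g₂ (φ z) (fderiv ℝ (fderiv ℝ φ) z x a) (fderiv ℝ φ z b)
      + g₂ (φ z) (fderiv ℝ φ z a) (fderiv ℝ (fderiv ℝ φ) z x b) := by
    intro x a b
    have l := (h₁.hasFDerivAt.clm_apply (hasFDerivAt_const a z)).clm_apply
      (hasFDerivAt_const b z)
    have r := (g2.clm_apply (d1.clm_apply (hasFDerivAt_const a z))).clm_apply
        (d1.clm_apply (hasFDerivAt_const b z))
    have e := DFunLike.congr_fun (l.unique (r.congr_of_eventuallyEq
      (by filter_upwards [h] with z' hz' using hz' a b))) x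
    simp only [add_apply, ContinuousLinearMap.comp_apply,
      ContinuousLinearMap.flip_apply, ContinuousLinearMap.comp_zero, zero_add] at e
    rw [e]
    abel
  have s2 := fderiv_fderiv_symm hφ
  -- Koszul's formula for both metrics; the derivatives of `g₁` are expressed by `key`
  have k1 : ∀ u v w, 2 * g₁ z (leviCivita g₁ z u v) w =
      fderiv ℝ g₁ z u v w + fderiv ℝ g₁ z v u w - fderiv ℝ g₁ z w u v := by
    intro u v w
    obtain ⟨e, he⟩ := hi₁
    rw [leviCivita_apply, ← he, ContinuousLinearMap.inverse_equiv, map_smul]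
    simp
  have k2 : ∀ u v w, 2 * g₂ (φ z) (leviCivita g₂ (φ z) u v) w =
      fderiv ℝ g₂ (φ z) u v w + fderiv ℝ g₂ (φ z) v u w - fderiv ℝ g₂ (φ z) w u v := by
    intro u v w
    obtain ⟨e, he⟩ := hi₂
    rw [leviCivita_apply, ← he, ContinuousLinearMap.inverse_equiv, map_smul]
    simp
  intro u v
  obtain ⟨e, he⟩ := hi₂
  apply e.injective
  ext w'
  obtain ⟨f, hf⟩ := hφ'
  obtain ⟨w, rfl⟩ : ∃ w, w' = fderiv ℝ φ z w := ⟨f.symm w', by rw [← hf]; simp⟩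
  have hz := h.self_of_nhds
  change (e : E →L[ℝ] E →L[ℝ] ℝ) _ _ = (e : E →L[ℝ] E →L[ℝ] ℝ) _ _
  rw [he, ← hz, map_add, add_apply]
  have a1 := k1 u v w
  have a2 := k2 (fderiv ℝ φ z u) (fderiv ℝ φ z v) (fderiv ℝ φ z w)
  rw [key, key, key] at a1
  rw [s2 v u, s2 w u, s2 w v, hs (fderiv ℝ (fderiv ℝ φ) z u w)] at a1
  linarith

end ConnectionMaps

/-! ### Higher derivatives of a composition with a curve -/

section Chain

variable {F G : Type*} [NormedAddCommGroup F] [NormedSpace ℝ F]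
  [NormedAddCommGroup G] [NormedSpace ℝ G]

lemma iteratedDerivWithin_one_eq {f : ℝ → F} {f1 : F} {s : Set ℝ} {t : ℝ} (hs : UniqueDiffOn ℝ s)
    (ht : t ∈ s) (h : HasDerivWithinAt f f1 s t) : iteratedDerivWithin 1 f s t = f1 := by
  rw [iteratedDerivWithin_one]
  exact h.derivWithin (hs t ht)

lemma iteratedDerivWithin_two_eq {f f1 : ℝ → F} {f2 : F} {s : Set ℝ} {t : ℝ}
    (hs : UniqueDiffOn ℝ s) (ht : t ∈ s) (h : ∀ᶠ x in 𝓝[s] t, HasDerivWithinAt f (f1 x) s x)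
    (h1 : HasDerivWithinAt f1 f2 s t) : iteratedDerivWithin 2 f s t = f2 := by
  rw [iteratedDerivWithin_succ]
  have : iteratedDerivWithin 1 f s =ᶠ[𝓝[s] t] f1 := by
    filter_upwards [h, self_mem_nhdsWithin] with x hx hxs using iteratedDerivWithin_one_eq hs hxs hx
  rw [this.derivWithin_eq_of_mem ht]
  exact h1.derivWithin (hs t ht)

lemma iteratedDerivWithin_three_eq {f f1 f2 : ℝ → F} {f3 : F} {s : Set ℝ} {t : ℝ}
    (hs : UniqueDiffOn ℝ s) (ht : t ∈ s) (h : ∀ᶠ x in 𝓝[s] t, HasDerivWithinAt f (f1 x) s x)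
    (h1 : ∀ᶠ x in 𝓝[s] t, HasDerivWithinAt f1 (f2 x) s x)
    (h2 : HasDerivWithinAt f2 f3 s t) : iteratedDerivWithin 3 f s t = f3 := by
  rw [iteratedDerivWithin_succ]
  have : iteratedDerivWithin 2 f s =ᶠ[𝓝[s] t] f2 := by
    filter_upwards [eventually_eventually_nhdsWithin.2 h, h1, self_mem_nhdsWithin] with x hx hx1 hxs
    exact iteratedDerivWithin_two_eq hs hxs hx hx1
  rw [this.derivWithin_eq_of_mem ht]
  exact h2.derivWithin (hs t ht)

lemma hasDerivWithinAt_comp_curve {f : F → G} {z : ℝ → F} {z1 : F} {s : Set ℝ} {t : ℝ}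
    (hf : ContDiffAt ℝ 1 f (z t)) (h : HasDerivWithinAt z z1 s t) :
    HasDerivWithinAt (fun x ↦ f (z x)) (fderiv ℝ f (z t) z1) s t :=
  (hf.differentiableAt one_ne_zero).hasFDerivAt.comp_hasDerivWithinAt t h

lemma iteratedDerivWithin_one_comp {f : F → G} {z : ℝ → F} {z1 : F} {s : Set ℝ} {t : ℝ}
    (hs : UniqueDiffOn ℝ s) (ht : t ∈ s) (hf : ContDiffAt ℝ 1 f (z t))
    (h : HasDerivWithinAt z z1 s t) :
    iteratedDerivWithin 1 (fun x ↦ f (z x)) s t = fderiv ℝ f (z t) z1 :=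
  iteratedDerivWithin_one_eq hs ht (hasDerivWithinAt_comp_curve hf h)

lemma iteratedDerivWithin_two_comp {f : F → G} {z z1 : ℝ → F} {z2 : F} {s : Set ℝ} {t : ℝ}
    (hs : UniqueDiffOn ℝ s) (ht : t ∈ s) (hf : ContDiffAt ℝ 2 f (z t))
    (h : ∀ᶠ x in 𝓝[s] t, HasDerivWithinAt z (z1 x) s x)
    (h1 : HasDerivWithinAt z1 z2 s t) :
    iteratedDerivWithin 2 (fun x ↦ f (z x)) s t =
      fderiv ℝ (fderiv ℝ f) (z t) (z1 t) (z1 t) + fderiv ℝ f (z t) z2 := by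
  have ht' : HasDerivWithinAt z (z1 t) s t := h.self_of_nhdsWithin ht
  have hc : ∀ᶠ x in 𝓝[s] t, ContDiffAt ℝ 2 f (z x) :=
    ht'.continuousWithinAt.tendsto.eventually (hf.eventually (by simp))
  refine iteratedDerivWithin_two_eq hs ht (f1 := fun x ↦ fderiv ℝ f (z x) (z1 x)) ?_ ?_
  · filter_upwards [h, hc] with x hx hcx
    exact hasDerivWithinAt_comp_curve (hcx.of_le (by norm_num)) hx
  · exact (hasDerivWithinAt_comp_curve (hf.fderiv_right (m := 1) (by norm_num)) ht').clm_apply h1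

lemma iteratedDerivWithin_three_comp {f : F → G} {z z1 z2 : ℝ → F} {z3 : F} {s : Set ℝ} {t : ℝ}
    (hs : UniqueDiffOn ℝ s) (ht : t ∈ s) (hf : ContDiffAt ℝ 3 f (z t))
    (h : ∀ᶠ x in 𝓝[s] t, HasDerivWithinAt z (z1 x) s x)
    (h1 : ∀ᶠ x in 𝓝[s] t, HasDerivWithinAt z1 (z2 x) s x)
    (h2 : HasDerivWithinAt z2 z3 s t) :
    iteratedDerivWithin 3 (fun x ↦ f (z x)) s t =
      fderiv ℝ (fderiv ℝ (fderiv ℝ f)) (z t) (z1 t) (z1 t) (z1 t)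
        + (3 : ℝ) • fderiv ℝ (fderiv ℝ f) (z t) (z1 t) (z2 t) + fderiv ℝ f (z t) z3 := by
  have ht' : HasDerivWithinAt z (z1 t) s t := h.self_of_nhdsWithin ht
  have ht1 : HasDerivWithinAt z1 (z2 t) s t := h1.self_of_nhdsWithin ht
  have hc : ∀ᶠ x in 𝓝[s] t, ContDiffAt ℝ 3 f (z x) :=
    ht'.continuousWithinAt.tendsto.eventually (hf.eventually (by simp))
  have hf1 : ContDiffAt ℝ 2 (fderiv ℝ f) (z t) := hf.fderiv_right (by norm_num)
  have hf2 : ContDiffAt ℝ 1 (fderiv ℝ (fderiv ℝ f)) (z t) := hf1.fderiv_right (by norm_num)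
  refine iteratedDerivWithin_three_eq hs ht (f1 := fun x ↦ fderiv ℝ f (z x) (z1 x))
    (f2 := fun x ↦ fderiv ℝ (fderiv ℝ f) (z x) (z1 x) (z1 x) + fderiv ℝ f (z x) (z2 x)) ?_ ?_ ?_
  · filter_upwards [h, hc] with x hx hcx
    exact hasDerivWithinAt_comp_curve (hcx.of_le (by norm_num)) hx
  · filter_upwards [h, h1, hc] with x hx hx1 hcx
    exact (hasDerivWithinAt_comp_curve (hcx.fderiv_right (m := 1) (by norm_num)) hx).clm_apply hx1
  · have := (((hasDerivWithinAt_comp_curve hf2 ht').clm_apply ht1).clm_apply ht1).add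
      ((hasDerivWithinAt_comp_curve (hf1.of_le (by norm_num)) ht').clm_apply h2)
    refine this.congr_deriv ?_
    simp only [add_apply]
    rw [fderiv_fderiv_symm (hf.of_le (by norm_num)) (z2 t) (z1 t)]
    module

end Chain

/-! ### The exponential map in normal coordinates, to fourth order -/

section NormalExp

variable {E : Type*} [NormedAddCommGroup E] [NormedSpace ℝ E]

/-- The properties of the exponential map `G (h, v) = exp_h v` in normal coordinates around the
point `0`, with its local connector `Γ`, on the ball of radius `r`. The constant `B` bounds the
derivatives that enter the error terms. -/
structure IsNormalExp (G : E × E → E) (Γ : E → E →L[ℝ] E →L[ℝ] E) (r B : ℝ) : Prop where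
  pos : 0 < r
  one_le : 1 ≤ B
  contDiffAt : ∀ z : E × E, ‖z‖ < r → ContDiffAt ℝ 5 G z
  apply_fst : ∀ h : E, ‖h‖ < r → G (h, 0) = h
  apply_snd : ∀ v : E, ‖v‖ < r → G (0, v) = v
  fderiv_snd : ∀ h : E, ‖h‖ < r → ∀ w, fderiv ℝ G (h, 0) (0, w) = w
  fderiv_fderiv_snd : ∀ h : E, ‖h‖ < r → ∀ u w,
    fderiv ℝ (fderiv ℝ G) (h, 0) (0, u) (0, w) = -Γ h u w
  conn_contDiffAt : ContDiffAt ℝ 2 Γ 0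
  conn_zero : Γ 0 = 0
  conn_diag : ∀ v, fderiv ℝ Γ 0 v v v = 0
  bound : ∀ z : E × E, ‖z‖ < r → ‖fderiv ℝ (fderiv ℝ (fderiv ℝ (fderiv ℝ G))) z‖ ≤ B
  bound_conn : ‖fderiv ℝ Γ 0‖ ≤ B
  bound_conn' : ‖fderiv ℝ (fderiv ℝ Γ) 0‖ ≤ B

namespace IsNormalExp

variable {G : E × E → E} {Γ : E → E →L[ℝ] E →L[ℝ] E} {r B : ℝ}

lemma contDiffAt₁ (H : IsNormalExp G Γ r B) {z : E × E} (hz : ‖z‖ < r) :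
    ContDiffAt ℝ 4 (fderiv ℝ G) z := (H.contDiffAt z hz).fderiv_right (by norm_num)

lemma contDiffAt₂ (H : IsNormalExp G Γ r B) {z : E × E} (hz : ‖z‖ < r) :
    ContDiffAt ℝ 3 (fderiv ℝ (fderiv ℝ G)) z := (H.contDiffAt₁ hz).fderiv_right (by norm_num)

lemma contDiffAt₃ (H : IsNormalExp G Γ r B) {z : E × E} (hz : ‖z‖ < r) :
    ContDiffAt ℝ 2 (fderiv ℝ (fderiv ℝ (fderiv ℝ G))) z :=
  (H.contDiffAt₂ hz).fderiv_right (by norm_num)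

lemma norm_zero_lt (H : IsNormalExp G Γ r B) : ‖(0 : E × E)‖ < r := by simpa using H.pos

lemma norm_inl_lt {E : Type*} [NormedAddCommGroup E] {r : ℝ} {h : E} (hh : ‖h‖ < r) :
    ‖((h, 0) : E × E)‖ < r := by
  simpa [Prod.norm_def] using hh

lemma norm_inr_lt {E : Type*} [NormedAddCommGroup E] {r : ℝ} {h : E} (hh : ‖h‖ < r) :
    ‖((0, h) : E × E)‖ < r := by
  simpa [Prod.norm_def] using hh

/-- The derivative of `f` along the first factor, from the values of `f` on it. -/
lemma fderiv_inl {X : Type*} [NormedAddCommGroup X] [NormedSpace ℝ X] {f : E × E → X} {g : E → X}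
    {g' : E →L[ℝ] X} {h : E} (hf : DifferentiableAt ℝ f (h, 0))
    (hfg : ∀ᶠ k in 𝓝 h, f (k, 0) = g k) (hg : HasFDerivAt g g' h) (k : E) :
    fderiv ℝ f (h, 0) (k, 0) = g' k := by
  have h1 : HasFDerivAt (fun k : E ↦ f (k, 0)) (fderiv ℝ f (h, 0) ∘L .inl ℝ E E) h :=
    HasFDerivAt.comp h hf.hasFDerivAt (hasFDerivAt_prodMk_left h 0)
  exact DFunLike.congr_fun (h1.unique (hg.congr_of_eventuallyEq hfg)) k

lemma fderiv_inr {X : Type*} [NormedAddCommGroup X] [NormedSpace ℝ X] {f : E × E → X} {g : E → X}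
    {g' : E →L[ℝ] X} {h : E} (hf : DifferentiableAt ℝ f (0, h))
    (hfg : ∀ᶠ k in 𝓝 h, f (0, k) = g k) (hg : HasFDerivAt g g' h) (k : E) :
    fderiv ℝ f (0, h) (0, k) = g' k := by
  have h1 : HasFDerivAt (fun k : E ↦ f (0, k)) (fderiv ℝ f (0, h) ∘L .inr ℝ E E) h :=
    HasFDerivAt.comp h hf.hasFDerivAt (hasFDerivAt_prodMk_right 0 h)
  exact DFunLike.congr_fun (h1.unique (hg.congr_of_eventuallyEq hfg)) k

lemma eventually_lt {E : Type*} [NormedAddCommGroup E] {r : ℝ} {h : E} (hh : ‖h‖ < r) :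
    ∀ᶠ k in 𝓝 h, ‖k‖ < r :=
  continuous_norm.continuousAt.eventually_lt continuousAt_const hh

lemma fderiv_inl_apply (H : IsNormalExp G Γ r B) {h : E} (hh : ‖h‖ < r) (k : E) :
    fderiv ℝ G (h, 0) (k, 0) = k :=
  fderiv_inl ((H.contDiffAt _ (norm_inl_lt hh)).differentiableAt (by simp))
    ((eventually_lt hh).mono H.apply_fst) (hasFDerivAt_id h) k

lemma fderiv_inr_apply (H : IsNormalExp G Γ r B) {v : E} (hv : ‖v‖ < r) (k : E) :
    fderiv ℝ G (0, v) (0, k) = k :=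
  fderiv_inr ((H.contDiffAt _ (norm_inr_lt hv)).differentiableAt (by simp))
    ((eventually_lt hv).mono H.apply_snd) (hasFDerivAt_id v) k

lemma fderiv_fderiv_inl_inl (H : IsNormalExp G Γ r B) {h : E} (hh : ‖h‖ < r) (k l : E) :
    fderiv ℝ (fderiv ℝ G) (h, 0) (k, 0) (l, 0) = 0 := by
  have h1 := (H.contDiffAt₁ (norm_inl_lt hh)).differentiableAt (by simp)
  have h2 : HasFDerivAt (fun z ↦ fderiv ℝ G z (l, 0))
      ((fderiv ℝ (fderiv ℝ G) (h, 0)).flip (l, 0)) (h, 0) :=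
    (h1.hasFDerivAt.clm_apply (hasFDerivAt_const ((l, 0) : E × E) _)).congr_fderiv (by simp)
  have h3 := fderiv_inl h2.differentiableAt
    ((eventually_lt hh).mono fun k hk ↦ H.fderiv_inl_apply hk l) (hasFDerivAt_const l h) k
  rwa [h2.fderiv] at h3

lemma fderiv_fderiv_inl_inr (H : IsNormalExp G Γ r B) {h : E} (hh : ‖h‖ < r) (k l : E) :
    fderiv ℝ (fderiv ℝ G) (h, 0) (k, 0) (0, l) = 0 := by
  have h1 := (H.contDiffAt₁ (norm_inl_lt hh)).differentiableAt (by simp)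
  have h2 : HasFDerivAt (fun z ↦ fderiv ℝ G z (0, l))
      ((fderiv ℝ (fderiv ℝ G) (h, 0)).flip (0, l)) (h, 0) :=
    (h1.hasFDerivAt.clm_apply (hasFDerivAt_const ((0, l) : E × E) _)).congr_fderiv (by simp)
  have h3 := fderiv_inl h2.differentiableAt
    ((eventually_lt hh).mono fun k hk ↦ H.fderiv_snd k hk l) (hasFDerivAt_const l h) k
  rwa [h2.fderiv] at h3

lemma fderiv_fderiv_inr_inr (H : IsNormalExp G Γ r B) {v : E} (hv : ‖v‖ < r) (k l : E) :
    fderiv ℝ (fderiv ℝ G) (0, v) (0, k) (0, l) = 0 := by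
  have h1 := (H.contDiffAt₁ (norm_inr_lt hv)).differentiableAt (by simp)
  have h2 : HasFDerivAt (fun z ↦ fderiv ℝ G z (0, l))
      ((fderiv ℝ (fderiv ℝ G) (0, v)).flip (0, l)) (0, v) :=
    (h1.hasFDerivAt.clm_apply (hasFDerivAt_const ((0, l) : E × E) _)).congr_fderiv (by simp)
  have h3 := fderiv_inr h2.differentiableAt
    ((eventually_lt hv).mono fun k hk ↦ H.fderiv_inr_apply hk l) (hasFDerivAt_const l v) k
  rwa [h2.fderiv] at h3

lemma fderiv_fderiv_zero (H : IsNormalExp G Γ r B) : fderiv ℝ (fderiv ℝ G) 0 = 0 := by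
  have h0 : ‖(0 : E)‖ < r := by simpa using H.pos
  have hs := fderiv_fderiv_symm ((H.contDiffAt 0 H.norm_zero_lt).of_le
    (by norm_num : (2 : WithTop ℕ∞) ≤ 5))
  have e1 := H.fderiv_fderiv_inl_inl h0
  have e2 := H.fderiv_fderiv_inl_inr h0
  have e3 := H.fderiv_fderiv_inr_inr h0
  have e4 : ∀ k l, fderiv ℝ (fderiv ℝ G) 0 ((0, k) : E × E) (l, 0) = 0 := fun k l ↦ by
    rw [hs]; exact e2 l k
  refine ContinuousLinearMap.ext fun a ↦ ContinuousLinearMap.ext fun b ↦ ?_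
  obtain ⟨a1, a2⟩ := a
  obtain ⟨b1, b2⟩ := b
  rw [show ((a1, a2) : E × E) = (a1, 0) + (0, a2) by simp,
    show ((b1, b2) : E × E) = (b1, 0) + (0, b2) by simp]
  simp only [map_add, add_apply]
  have e1' := e1 a1 b1
  have e2' := e2 a1 b2
  have e3' := e3 a2 b2
  simp only [Prod.mk_zero_zero] at e1' e2' e3'
  rw [e1', e2', e3', e4]
  simp

lemma third_inl_inl (H : IsNormalExp G Γ r B) (j k : E) (c : E × E) :
    fderiv ℝ (fderiv ℝ (fderiv ℝ G)) 0 (j, 0) (k, 0) c = 0 := by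
  have h0 : ‖(0 : E)‖ < r := by simpa using H.pos
  have h1 := (H.contDiffAt₂ (norm_inl_lt h0)).differentiableAt (by simp)
  have h2 : HasFDerivAt (fun z ↦ fderiv ℝ (fderiv ℝ G) z (k, 0) c)
      (((fderiv ℝ (fderiv ℝ (fderiv ℝ G)) (0, 0)).flip (k, 0)).flip c) (0, 0) :=
    ((h1.hasFDerivAt.clm_apply (hasFDerivAt_const ((k, 0) : E × E) _)).clm_apply
      (hasFDerivAt_const c _)).congr_fderiv (by ext <;> simp)
  have h3 := fderiv_inl h2.differentiableAt (g := fun _ ↦ (0 : E))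
    ((eventually_lt h0).mono fun l hl ↦ by
      rw [show c = (c.1, 0) + (0, c.2) by simp, map_add, H.fderiv_fderiv_inl_inl hl,
        H.fderiv_fderiv_inl_inr hl, add_zero]) (hasFDerivAt_const 0 0) j
  rw [h2.fderiv] at h3
  exact h3

lemma third_inr_inr_inr (H : IsNormalExp G Γ r B) (j k l : E) :
    fderiv ℝ (fderiv ℝ (fderiv ℝ G)) 0 (0, j) (0, k) (0, l) = 0 := by
  have h0 : ‖(0 : E)‖ < r := by simpa using H.pos
  have h1 := (H.contDiffAt₂ (norm_inl_lt h0)).differentiableAt (by simp)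
  have h2 : HasFDerivAt (fun z ↦ fderiv ℝ (fderiv ℝ G) z (0, k) (0, l))
      (((fderiv ℝ (fderiv ℝ (fderiv ℝ G)) (0, 0)).flip (0, k)).flip (0, l)) (0, 0) :=
    ((h1.hasFDerivAt.clm_apply (hasFDerivAt_const ((0, k) : E × E) _)).clm_apply
      (hasFDerivAt_const ((0, l) : E × E) _)).congr_fderiv (by ext <;> simp)
  have h3 := fderiv_inr h2.differentiableAt (g := fun _ ↦ (0 : E))
    ((eventually_lt h0).mono fun v hv ↦ H.fderiv_fderiv_inr_inr hv k l) (hasFDerivAt_const 0 0) j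
  rw [h2.fderiv] at h3
  exact h3

lemma third_inl_inr_inr (H : IsNormalExp G Γ r B) (j k l : E) :
    fderiv ℝ (fderiv ℝ (fderiv ℝ G)) 0 (j, 0) (0, k) (0, l) = -fderiv ℝ Γ 0 j k l := by
  have h0 : ‖(0 : E)‖ < r := by simpa using H.pos
  have h1 := (H.contDiffAt₂ (norm_inl_lt h0)).differentiableAt (by simp)
  have h2 : HasFDerivAt (fun z ↦ fderiv ℝ (fderiv ℝ G) z (0, k) (0, l))
      (((fderiv ℝ (fderiv ℝ (fderiv ℝ G)) (0, 0)).flip (0, k)).flip (0, l)) (0, 0) :=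
    ((h1.hasFDerivAt.clm_apply (hasFDerivAt_const ((0, k) : E × E) _)).clm_apply
      (hasFDerivAt_const ((0, l) : E × E) _)).congr_fderiv (by ext <;> simp)
  have h4 : HasFDerivAt (fun h ↦ -Γ h k l) (-((fderiv ℝ Γ 0).flip k).flip l) 0 :=
    ((((H.conn_contDiffAt.differentiableAt (by simp)).hasFDerivAt.clm_apply
      (hasFDerivAt_const k _)).clm_apply (hasFDerivAt_const l _)).congr_fderiv
        (by ext; simp)).neg
  have h3 := fderiv_inl h2.differentiableAt
    ((eventually_lt h0).mono fun h hh ↦ H.fderiv_fderiv_snd h hh k l) h4 j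
  rw [h2.fderiv] at h3
  exact h3

lemma third_symm₁ (H : IsNormalExp G Γ r B) (a b : E × E) :
    fderiv ℝ (fderiv ℝ (fderiv ℝ G)) 0 a b = fderiv ℝ (fderiv ℝ (fderiv ℝ G)) 0 b a :=
  fderiv_fderiv_symm ((H.contDiffAt₁ H.norm_zero_lt).of_le (by norm_num)) a b

lemma third_symm₂ (H : IsNormalExp G Γ r B) (a b c : E × E) :
    fderiv ℝ (fderiv ℝ (fderiv ℝ G)) 0 a b c = fderiv ℝ (fderiv ℝ (fderiv ℝ G)) 0 a c b :=
  fderiv_fderiv_fderiv_symm ((H.contDiffAt 0 H.norm_zero_lt).of_le (by norm_num)) a b c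

/-- The third derivative of `G` at the origin is the symmetrization of `-DΓ(0)`. -/
lemma third_apply (H : IsNormalExp G Γ r B) (a b c : E × E) :
    fderiv ℝ (fderiv ℝ (fderiv ℝ G)) 0 a b c =
      -(fderiv ℝ Γ 0 a.1 b.2 c.2 + fderiv ℝ Γ 0 b.1 a.2 c.2 + fderiv ℝ Γ 0 c.1 a.2 b.2) := by
  set T := fderiv ℝ (fderiv ℝ (fderiv ℝ G)) 0 with hT
  have s1 : ∀ a b, T a b = T b a := H.third_symm₁
  have s2 : ∀ a b c, T a b c = T a c b := H.third_symm₂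
  have t1 : ∀ j k c, T (j, 0) (k, 0) c = 0 := H.third_inl_inl
  have t2 : ∀ j k l, T (0, j) (0, k) (0, l) = 0 := H.third_inr_inr_inr
  have t3 : ∀ j k l, T (j, 0) (0, k) (0, l) = -fderiv ℝ Γ 0 j k l := H.third_inl_inr_inr
  obtain ⟨a1, a2⟩ := a
  obtain ⟨b1, b2⟩ := b
  obtain ⟨c1, c2⟩ := c
  change T (a1, a2) (b1, b2) (c1, c2) =
    -(fderiv ℝ Γ 0 a1 b2 c2 + fderiv ℝ Γ 0 b1 a2 c2 + fderiv ℝ Γ 0 c1 a2 b2)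
  rw [show ((a1, a2) : E × E) = (a1, 0) + (0, a2) by simp,
    show ((b1, b2) : E × E) = (b1, 0) + (0, b2) by simp,
    show ((c1, c2) : E × E) = (c1, 0) + (0, c2) by simp]
  simp only [map_add, add_apply]
  rw [t1, t1, s2 (a1, 0) (0, b2) (c1, 0), t1, t3, s1 (0, a2) (b1, 0), s2 (b1, 0) (0, a2) (c1, 0),
    t1, t3, s2 (0, a2) (0, b2) (c1, 0), s1 (0, a2) (c1, 0), t3, t2]
  simp only [zero_add, add_zero]
  abel

lemma conn_symm (H : IsNormalExp G Γ r B) (x u w : E) :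
    fderiv ℝ Γ 0 x u w = fderiv ℝ Γ 0 x w u := by
  have e1 := H.third_inl_inr_inr x u w
  have e2 := H.third_inl_inr_inr x w u
  rw [H.third_symm₂] at e1
  exact neg_injective (e1.symm.trans e2)

/-- The cyclic identity of normal coordinates: the polarization of `DΓ(0)(v)(v ⊗ v) = 0`, the
connector being symmetric in its last two arguments. -/
lemma conn_cyclic (H : IsNormalExp G Γ r B) (u v w : E) :
    fderiv ℝ Γ 0 u v w + fderiv ℝ Γ 0 v w u + fderiv ℝ Γ 0 w u v = 0 := by
  set D := fderiv ℝ Γ 0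
  have hs : ∀ x u w, D x u w = D x w u := H.conn_symm
  have hd : ∀ x, D x x x = 0 := H.conn_diag
  have q : ∀ x y, D x y y + (2 : ℝ) • D y x y = 0 := by
    intro x y
    have e1 := hd (x + y)
    have e2 := hd (x - y)
    simp only [map_add, map_sub, add_apply, sub_apply, hd] at e1 e2
    rw [hs y y x] at e1 e2
    rw [hs x y x] at e1 e2
    have : (2 : ℝ) • (D x y y + (2 : ℝ) • D y x y) = 0 := by
      linear_combination (norm := module) e1 + e2
    exact (smul_eq_zero.1 this).resolve_left two_ne_zero
  have e := q u (v + w)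
  simp only [map_add, add_apply] at e
  have e1 := q u v
  have e2 := q u w
  rw [hs u w v, hs w u w] at e
  rw [hs w u w] at e2
  rw [hs v w u]
  have : (2 : ℝ) • (D u v w + D v u w + D w u v) = 0 := by
    linear_combination (norm := module) e - e1 - e2
  exact (smul_eq_zero.1 this).resolve_left two_ne_zero

/-! ### Taylor estimates for the derivatives of the exponential map

The second derivative of `G` vanishes at the origin and the third is given by `DΓ(0)`; the
remainders are bounded by the fourth derivative. The first derivative of `G` at `(0, v)` in the
direction `(a, b)` has an error that does not depend on `b`, since `G(0, v) = v`. -/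

lemma norm_third_sub_le (H : IsNormalExp G Γ r B) {z : E × E} (hz : ‖z‖ < r) :
    ‖fderiv ℝ (fderiv ℝ (fderiv ℝ G)) z - fderiv ℝ (fderiv ℝ (fderiv ℝ G)) 0‖ ≤ B * ‖z‖ := by
  have := (convex_ball (0 : E × E) r).norm_image_sub_le_of_norm_hasFDerivWithin_le
    (f := fderiv ℝ (fderiv ℝ (fderiv ℝ G)))
    (f' := fderiv ℝ (fderiv ℝ (fderiv ℝ (fderiv ℝ G)))) (C := B) (x := 0) (y := z)
    (fun x hx ↦ ((H.contDiffAt₃ (mem_ball_zero_iff.1 hx)).differentiableAt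
      (by simp)).hasFDerivAt.hasFDerivWithinAt)
    (fun x hx ↦ H.bound x (mem_ball_zero_iff.1 hx))
    (Metric.mem_ball_self H.pos) (mem_ball_zero_iff.2 hz)
  simpa using this

lemma norm_second_sub_le (H : IsNormalExp G Γ r B) {z : E × E} (hz : ‖z‖ < r) :
    ‖fderiv ℝ (fderiv ℝ G) z - fderiv ℝ (fderiv ℝ (fderiv ℝ G)) 0 z‖ ≤ B * ‖z‖ ^ 2 := by
  have hB : 0 ≤ B := zero_le_one.trans H.one_le
  have hlt : ∀ x ∈ Metric.closedBall (0 : E × E) ‖z‖, ‖x‖ < r := fun x hx ↦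
    (mem_closedBall_zero_iff.1 hx).trans_lt hz
  have := (convex_closedBall (0 : E × E) ‖z‖).norm_image_sub_le_of_norm_hasFDerivWithin_le'
    (f := fderiv ℝ (fderiv ℝ G)) (f' := fderiv ℝ (fderiv ℝ (fderiv ℝ G)))
    (φ := fderiv ℝ (fderiv ℝ (fderiv ℝ G)) 0) (C := B * ‖z‖) (x := 0) (y := z)
    (fun x hx ↦
      ((H.contDiffAt₂ (hlt x hx)).differentiableAt (by simp)).hasFDerivAt.hasFDerivWithinAt)
    (fun x hx ↦ (H.norm_third_sub_le (hlt x hx)).trans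
      (mul_le_mul_of_nonneg_left (mem_closedBall_zero_iff.1 hx) hB))
    (Metric.mem_closedBall_self (norm_nonneg _)) (mem_closedBall_zero_iff.2 le_rfl)
  rw [H.fderiv_fderiv_zero, sub_zero, sub_zero] at this
  linarith

lemma norm_first_sub_le (H : IsNormalExp G Γ r B) {z : E × E} (hz : ‖z‖ < r) :
    ‖fderiv ℝ G z - fderiv ℝ G 0 - (1 / 2 : ℝ) • fderiv ℝ (fderiv ℝ (fderiv ℝ G)) 0 z z‖
      ≤ B * ‖z‖ ^ 3 := by
  set T := fderiv ℝ (fderiv ℝ (fderiv ℝ G)) 0 with hT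
  have hB : 0 ≤ B := zero_le_one.trans H.one_le
  have hlt : ∀ x ∈ Metric.closedBall (0 : E × E) ‖z‖, ‖x‖ < r := fun x hx ↦
    (mem_closedBall_zero_iff.1 hx).trans_lt hz
  have hd : ∀ x : E × E, ‖x‖ < r → HasFDerivAt (fun x ↦ fderiv ℝ G x - (1 / 2 : ℝ) • T x x)
      (fderiv ℝ (fderiv ℝ G) x - T x) x := by
    intro x hx
    have h1 := ((H.contDiffAt₁ hx).differentiableAt (by simp)).hasFDerivAt
    have h2 := (T.hasFDerivAt (x := x)).clm_apply (hasFDerivAt_id x)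
    refine (h1.sub (h2.const_smul (1 / 2 : ℝ))).congr_fderiv ?_
    refine ContinuousLinearMap.ext fun y ↦ ?_
    simp only [sub_apply, smul_apply, add_apply, ContinuousLinearMap.comp_apply,
      ContinuousLinearMap.flip_apply, ContinuousLinearMap.id_apply, id]
    rw [hT, H.third_symm₁ y x, ← hT]
    module
  have := (convex_closedBall (0 : E × E) ‖z‖).norm_image_sub_le_of_norm_hasFDerivWithin_le
    (f := fun x ↦ fderiv ℝ G x - (1 / 2 : ℝ) • T x x)
    (f' := fun x ↦ fderiv ℝ (fderiv ℝ G) x - T x)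
    (C := B * ‖z‖ ^ 2) (x := 0) (y := z)
    (fun x hx ↦ (hd x (hlt x hx)).hasFDerivWithinAt)
    (fun x hx ↦ (H.norm_second_sub_le (hlt x hx)).trans
      (mul_le_mul_of_nonneg_left (pow_le_pow_left₀ (norm_nonneg _)
        (mem_closedBall_zero_iff.1 hx) 2) hB))
    (Metric.mem_closedBall_self (norm_nonneg _)) (mem_closedBall_zero_iff.2 le_rfl)
  simp only [map_zero, smul_zero, sub_zero] at this
  rw [sub_right_comm]
  refine this.trans (le_of_eq ?_)
  ring

/-- The first derivative of the exponential map, in the direction of the base point. -/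
lemma norm_fderiv_sub_le (H : IsNormalExp G Γ r B) {v : E} (hv : ‖v‖ < r) (a b : E) :
    ‖fderiv ℝ G (0, v) (a, b) - (a + b - (1 / 2 : ℝ) • fderiv ℝ Γ 0 a v v)‖
      ≤ B * ‖v‖ ^ 3 * ‖a‖ := by
  have h0 : ‖(0 : E)‖ < r := by simpa using H.pos
  have h1 := (ContinuousLinearMap.le_of_opNorm_le _
    (H.norm_first_sub_le (norm_inr_lt hv)) ((a, 0) : E × E))
  have e0 : fderiv ℝ G 0 ((a, 0) : E × E) = a := H.fderiv_inl_apply h0 a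
  have eb : fderiv ℝ G (0, v) ((a, b) : E × E) = fderiv ℝ G (0, v) (a, 0) + b := by
    rw [show ((a, b) : E × E) = (a, 0) + (0, b) by simp, map_add, H.fderiv_inr_apply hv]
  simp only [sub_apply, smul_apply, e0, H.third_apply] at h1
  rw [show ‖((a, 0) : E × E)‖ = ‖a‖ by simp [Prod.norm_def],
    show ‖((0, v) : E × E)‖ = ‖v‖ by simp [Prod.norm_def]] at h1
  rw [eb]
  refine (le_of_eq (congrArg norm ?_)).trans h1
  simp only [map_zero, zero_apply, zero_add]
  module

lemma norm_fderiv_fderiv_sub_le (H : IsNormalExp G Γ r B) {v : E} (hv : ‖v‖ < r) (a b a' b' : E) :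
    ‖fderiv ℝ (fderiv ℝ G) (0, v) (a, b) (a', b')
        + (fderiv ℝ Γ 0 a v b' + fderiv ℝ Γ 0 a' v b)‖
      ≤ B * ‖v‖ ^ 2 * ‖(a, b)‖ * ‖(a', b')‖ := by
  have h1 := ContinuousLinearMap.le_of_opNorm_le _ (ContinuousLinearMap.le_of_opNorm_le _
    (H.norm_second_sub_le (norm_inr_lt hv)) ((a, b) : E × E)) ((a', b') : E × E)
  simp only [sub_apply, H.third_apply] at h1
  rw [show ‖((0, v) : E × E)‖ = ‖v‖ by simp [Prod.norm_def]] at h1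
  refine (le_of_eq (congrArg norm ?_)).trans h1
  simp only [map_zero, zero_apply, zero_add]
  module

lemma norm_fderiv_fderiv_fderiv_sub_le (H : IsNormalExp G Γ r B) {v : E} (hv : ‖v‖ < r) (a b : E) :
    ‖fderiv ℝ (fderiv ℝ (fderiv ℝ G)) (0, v) (a, b) (a, b) (a, b)
        + (3 : ℝ) • fderiv ℝ Γ 0 a b b‖
      ≤ B * ‖v‖ * ‖(a, b)‖ ^ 3 := by
  have h1 := ContinuousLinearMap.le_of_opNorm_le _ (ContinuousLinearMap.le_of_opNorm_le _
    (ContinuousLinearMap.le_of_opNorm_le _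
    (H.norm_third_sub_le (norm_inr_lt hv)) ((a, b) : E × E)) ((a, b) : E × E)) ((a, b) : E × E)
  simp only [sub_apply, H.third_apply] at h1
  rw [show ‖((0, v) : E × E)‖ = ‖v‖ by simp [Prod.norm_def]] at h1
  refine (le_of_eq (congrArg norm ?_)).trans (h1.trans (le_of_eq ?_))
  · module
  · ring

/-! ### The expansions, in terms of the covariant derivatives -/

lemma curvatureCoord_eq (H : IsNormalExp G Γ r B) (u v w : E) :
    curvatureCoord Γ 0 u v w = fderiv ℝ Γ 0 v w u - fderiv ℝ Γ 0 u w v := by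
  simp [curvatureCoord, H.conn_zero]

/-- The curvature term of the first order expansion, in terms of `DΓ(0)`; by the cyclic identity. -/
lemma curvature_first_order (H : IsNormalExp G Γ r B) (a v : E) :
    (1 / 3 : ℝ) • curvatureCoord Γ 0 v a v = (1 / 2 : ℝ) • fderiv ℝ Γ 0 a v v := by
  rw [H.curvatureCoord_eq]
  have := H.conn_cyclic a v v
  rw [H.conn_symm v a] at this
  linear_combination (norm := module) (-1 / 6 : ℝ) • this

/-- The curvature terms of the second order expansion, in terms of `DΓ(0)`. -/
lemma curvature_second_order (H : IsNormalExp G Γ r B) (a a1 v v1 : E) :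
    - (1 / 3 : ℝ) • curvatureCoord Γ 0 v a1 v - (2 / 3 : ℝ) • curvatureCoord Γ 0 v1 a v
        + (1 / 3 : ℝ) • curvatureCoord Γ 0 a v (a + (2 : ℝ) • v1)
      = - (1 / 2 : ℝ) • fderiv ℝ Γ 0 a1 v v - (2 : ℝ) • fderiv ℝ Γ 0 a v v1
        - fderiv ℝ Γ 0 a v a := by
  have s := H.conn_symm
  have c1 := H.conn_cyclic a1 v v
  have c2 := H.conn_cyclic a v v1
  have c3 := H.conn_cyclic a a v
  simp only [H.curvatureCoord_eq, map_add, map_smul, add_apply, smul_apply]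
  simp only [s _ v a, s _ v1 a, s _ v1 v, s _ a1 v] at c1 c2 c3 ⊢
  linear_combination (norm := module) (1 / 6 : ℝ) • c1 + (2 / 3 : ℝ) • c2 + (1 / 3 : ℝ) • c3

/-- The curvature terms of the third order expansion, in terms of `DΓ(0)`. -/
lemma curvature_third_order (H : IsNormalExp G Γ r B) (a a1 a2 v v1 v2 : E) :
    curvatureCoord Γ 0 a v1 (a + (2 : ℝ) • v1) + curvatureCoord Γ 0 a v (a1 + (2 : ℝ) • v2)
        + curvatureCoord Γ 0 v v2 a + curvatureCoord Γ 0 v v1 a1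
        + (2 : ℝ) • curvatureCoord Γ 0 a1 v v1 - (1 / 3 : ℝ) • curvatureCoord Γ 0 v a2 v
      = - (3 : ℝ) • fderiv ℝ Γ 0 a v1 a - fderiv ℝ Γ 0 a1 v a - (2 : ℝ) • fderiv ℝ Γ 0 a v a1
        - (1 / 2 : ℝ) • fderiv ℝ Γ 0 a2 v v - (3 : ℝ) • fderiv ℝ Γ 0 a1 v v1
        - (3 : ℝ) • fderiv ℝ Γ 0 a v1 v1 - (3 : ℝ) • fderiv ℝ Γ 0 a v v2 := by
  have s := H.conn_symm
  have e1 := H.curvature_first_order a2 v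
  have c1 := H.conn_cyclic a a v1
  have c2 := H.conn_cyclic a v1 v1
  have c3 := H.conn_cyclic a a1 v
  have c4 := H.conn_cyclic a1 v v1
  have c5 := H.conn_cyclic a v v2
  simp only [H.curvatureCoord_eq, map_add, map_smul, add_apply, smul_apply] at e1 ⊢
  simp only [s _ v a, s _ v1 a, s _ v2 a, s _ v1 v, s _ v2 v, s _ a1 a, s _ a1 v, s _ a1 v1]
    at c1 c2 c3 c4 c5 ⊢
  linear_combination (norm := module) c1 + c2 + c3 + c4 + c5 - e1

/-- If the connector vanishes at `h t`, the derivative of `Γ(h)(x ⊗ y)` at `t` only involves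
`DΓ`. -/
lemma hasDerivWithinAt_conn {Γ : E → E →L[ℝ] E →L[ℝ] E} {h x y : ℝ → E} {h' x' y' : E} {s : Set ℝ}
    {t : ℝ} (hΓ : DifferentiableAt ℝ Γ (h t)) (hh : HasDerivWithinAt h h' s t)
    (hx : HasDerivWithinAt x x' s t) (hy : HasDerivWithinAt y y' s t) :
    HasDerivWithinAt (fun ε ↦ Γ (h ε) (x ε) (y ε))
      (fderiv ℝ Γ (h t) h' (x t) (y t) + Γ (h t) x' (y t) + Γ (h t) (x t) y') s t := by
  refine (((hΓ.hasFDerivAt.comp_hasDerivWithinAt t hh).clm_apply hx).clm_apply hy).congr_deriv ?_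
  simp only [add_apply, Function.comp_apply]

variable {h v a a₁ v₁ v₂ : ℝ → E} {a2 v1 v2 v3 : E} {s : Set ℝ} {κ : ℝ}

/-- First order expansion: `v1` is the covariant derivative at `0` of the field `v` along `h`. -/
theorem first_order (H : IsNormalExp G Γ r B) (hs : UniqueDiffOn ℝ s) (h0s : (0 : ℝ) ∈ s)
    (hκ : κ < r) (h0 : h 0 = 0) {a : E} (hh : HasDerivWithinAt h a s 0)
    (hv : HasDerivWithinAt v (v1 - Γ (h 0) (v 0) a) s 0)
    (ba : ‖a‖ ≤ κ) (bv : ‖v 0‖ ≤ κ) :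
    ‖iteratedDerivWithin 1 (fun ε ↦ G (h ε, v ε)) s 0
      - (a + v1 - (1 / 3 : ℝ) • curvatureCoord Γ 0 (v 0) a (v 0))‖ ≤ B * κ ^ 4 := by
  have hvr : ‖v 0‖ < r := bv.trans_lt hκ
  have hB : 0 ≤ B := zero_le_one.trans H.one_le
  have hκ0 : 0 ≤ κ := (norm_nonneg _).trans ba
  rw [h0, H.conn_zero] at hv
  simp only [zero_apply, sub_zero] at hv
  rw [iteratedDerivWithin_one_comp (f := G) (z := fun ε ↦ (h ε, v ε)) hs h0s
    (by rw [h0]; exact (H.contDiffAt _ (norm_inr_lt hvr)).of_le (by norm_num)) (hh.prodMk hv), h0]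
  rw [H.curvature_first_order]
  refine (H.norm_fderiv_sub_le hvr a v1).trans ?_
  calc B * ‖v 0‖ ^ 3 * ‖a‖ ≤ B * κ ^ 3 * κ := by gcongr
    _ = B * κ ^ 4 := by ring

lemma norm_pair_le {E : Type*} [NormedAddCommGroup E] {κ : ℝ} {x y : E} (hx : ‖x‖ ≤ κ)
    (hy : ‖y‖ ≤ κ) : ‖(x, y)‖ ≤ κ :=
  max_le hx hy

/-- Second order expansion: `a` is the velocity of the curve `h`, and `a1`, `v₁`, `v2` are covariant
derivatives of `a`, `v` and `v₁`. -/
theorem second_order (H : IsNormalExp G Γ r B) (hs : UniqueDiffOn ℝ s) (h0s : (0 : ℝ) ∈ s)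
    (hκ : κ < r) (h0 : h 0 = 0) {a1 : E}
    (hh : ∀ᶠ ε in 𝓝[s] 0, HasDerivWithinAt h (a ε) s ε)
    (ha : HasDerivWithinAt a (a1 - Γ (h 0) (a 0) (a 0)) s 0)
    (hv : ∀ᶠ ε in 𝓝[s] 0, HasDerivWithinAt v (v₁ ε - Γ (h ε) (v ε) (a ε)) s ε)
    (hv1 : HasDerivWithinAt v₁ (v2 - Γ (h 0) (v₁ 0) (a 0)) s 0)
    (ba : ‖a 0‖ ≤ κ) (bv : ‖v 0‖ ≤ κ) (bv1 : ‖v₁ 0‖ ≤ κ) (ba1 : ‖a1‖ ≤ κ) :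
    ‖iteratedDerivWithin 2 (fun ε ↦ G (h ε, v ε)) s 0
      - (a1 + v2 - (1 / 3 : ℝ) • curvatureCoord Γ 0 (v 0) a1 (v 0)
        - (2 / 3 : ℝ) • curvatureCoord Γ 0 (v₁ 0) (a 0) (v 0)
        + (1 / 3 : ℝ) • curvatureCoord Γ 0 (a 0) (v 0) (a 0 + (2 : ℝ) • v₁ 0))‖
      ≤ 2 * B * κ ^ 4 := by
  have hvr : ‖v 0‖ < r := bv.trans_lt hκ
  have hB : 0 ≤ B := zero_le_one.trans H.one_le
  have hκ0 : 0 ≤ κ := (norm_nonneg _).trans ba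
  have hh0 := hh.self_of_nhdsWithin h0s
  have hv0 := hv.self_of_nhdsWithin h0s
  have hΓ0 : DifferentiableAt ℝ Γ (h 0) := by
    rw [h0]; exact H.conn_contDiffAt.differentiableAt (by simp)
  have hv' := hv1.sub (hasDerivWithinAt_conn hΓ0 hh0 hv0 ha)
  have hz : HasDerivWithinAt (fun ε ↦ (a ε, v₁ ε - Γ (h ε) (v ε) (a ε)))
      (a1, v2 - fderiv ℝ Γ 0 (a 0) (v 0) (a 0)) s 0 := by
    refine (ha.prodMk hv').congr_deriv ?_
    simp [h0, H.conn_zero]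
  rw [iteratedDerivWithin_two_comp (f := G) (z := fun ε ↦ (h ε, v ε)) hs h0s
    (by rw [h0]; exact (H.contDiffAt _ (norm_inr_lt hvr)).of_le (by norm_num))
    (by filter_upwards [hh, hv] with ε h1 h2 using h1.prodMk h2) hz, h0, H.conn_zero]
  simp only [zero_apply, sub_zero]
  have k1 := H.norm_fderiv_sub_le hvr a1 (v2 - fderiv ℝ Γ 0 (a 0) (v 0) (a 0))
  have k2 := H.norm_fderiv_fderiv_sub_le hvr (a 0) (v₁ 0) (a 0) (v₁ 0)
  have b1 : B * ‖v 0‖ ^ 3 * ‖a1‖ ≤ B * κ ^ 4 := by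
    calc B * ‖v 0‖ ^ 3 * ‖a1‖ ≤ B * κ ^ 3 * κ := by gcongr
      _ = B * κ ^ 4 := by ring
  have b2 : B * ‖v 0‖ ^ 2 * ‖(a 0, v₁ 0)‖ * ‖(a 0, v₁ 0)‖ ≤ B * κ ^ 4 := by
    have := norm_pair_le ba bv1
    calc B * ‖v 0‖ ^ 2 * ‖(a 0, v₁ 0)‖ * ‖(a 0, v₁ 0)‖ ≤ B * κ ^ 2 * κ * κ := by gcongr
      _ = B * κ ^ 4 := by ring
  have hsum := (norm_add_le _ _).trans (add_le_add (k2.trans b2) (k1.trans b1))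
  refine (le_of_eq (congrArg norm ?_)).trans (hsum.trans (by linarith))
  linear_combination (norm := module) -H.curvature_second_order (a 0) a1 (v 0) (v₁ 0)

/-- Third order expansion: `a` is the velocity of the curve `h`, and `a₁`, `a2` and `v₁`, `v₂`, `v3`
are the successive covariant derivatives of `a` and of `v`. The terms that involve `D²Γ(0)` or that
are quadratic in `DΓ(0)` are part of the error. -/
theorem third_order (H : IsNormalExp G Γ r B) (hs : UniqueDiffOn ℝ s) (h0s : (0 : ℝ) ∈ s)
    (hκ : κ < r) (hBκ : B * κ ≤ 1) (h0 : h 0 = 0)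
    (hh : ∀ᶠ ε in 𝓝[s] 0, HasDerivWithinAt h (a ε) s ε)
    (ha : ∀ᶠ ε in 𝓝[s] 0, HasDerivWithinAt a (a₁ ε - Γ (h ε) (a ε) (a ε)) s ε)
    (ha1 : HasDerivWithinAt a₁ (a2 - Γ (h 0) (a₁ 0) (a 0)) s 0)
    (hv : ∀ᶠ ε in 𝓝[s] 0, HasDerivWithinAt v (v₁ ε - Γ (h ε) (v ε) (a ε)) s ε)
    (hv1 : ∀ᶠ ε in 𝓝[s] 0, HasDerivWithinAt v₁ (v₂ ε - Γ (h ε) (v₁ ε) (a ε)) s ε)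
    (hv2 : HasDerivWithinAt v₂ (v3 - Γ (h 0) (v₂ 0) (a 0)) s 0)
    (ba : ‖a 0‖ ≤ κ) (bv : ‖v 0‖ ≤ κ) (bv1 : ‖v₁ 0‖ ≤ κ) (ba1 : ‖a₁ 0‖ ≤ κ)
    (ba2 : ‖a2‖ ≤ κ) (bv2 : ‖v₂ 0‖ ≤ κ) :
    ‖iteratedDerivWithin 3 (fun ε ↦ G (h ε, v ε)) s 0
      - (a2 + v3 + curvatureCoord Γ 0 (a 0) (v₁ 0) (a 0 + (2 : ℝ) • v₁ 0)
        + curvatureCoord Γ 0 (a 0) (v 0) (a₁ 0 + (2 : ℝ) • v₂ 0)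
        + curvatureCoord Γ 0 (v 0) (v₂ 0) (a 0) + curvatureCoord Γ 0 (v 0) (v₁ 0) (a₁ 0)
        + (2 : ℝ) • curvatureCoord Γ 0 (a₁ 0) (v 0) (v₁ 0)
        - (1 / 3 : ℝ) • curvatureCoord Γ 0 (v 0) a2 (v 0))‖
      ≤ 12 * B * κ ^ 4 := by
  have hvr : ‖v 0‖ < r := bv.trans_lt hκ
  have hB1 := H.one_le
  have hB : 0 ≤ B := zero_le_one.trans H.one_le
  have hκ0 : 0 ≤ κ := (norm_nonneg _).trans ba
  have hh0 := hh.self_of_nhdsWithin h0s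
  have ha0 := ha.self_of_nhdsWithin h0s
  have hv0 := hv.self_of_nhdsWithin h0s
  have hv10 := hv1.self_of_nhdsWithin h0s
  have hΓc : ∀ᶠ ε in 𝓝[s] 0, ContDiffAt ℝ 2 Γ (h ε) :=
    hh0.continuousWithinAt.tendsto.eventually
      (by rw [h0]; exact H.conn_contDiffAt.eventually (by simp))
  have hΓ2 : ContDiffAt ℝ 2 Γ (h 0) := hΓc.self_of_nhdsWithin h0s
  have hΓ0 : DifferentiableAt ℝ Γ (h 0) := hΓ2.differentiableAt (by simp)
  have hΓ1 : DifferentiableAt ℝ (fderiv ℝ Γ) (h 0) :=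
    (hΓ2.fderiv_right (m := 1) (by norm_num)).differentiableAt (by simp)
  -- the coordinate derivatives of `a` and of `v`
  have hD : fderiv ℝ Γ 0 (a 0) (a 0) (a 0) = 0 := H.conn_diag _
  have hz1 : ∀ᶠ ε in 𝓝[s] 0, HasDerivWithinAt (fun ε ↦ (a ε, v₁ ε - Γ (h ε) (v ε) (a ε)))
      (a₁ ε - Γ (h ε) (a ε) (a ε),
        v₂ ε - Γ (h ε) (v₁ ε) (a ε) - (fderiv ℝ Γ (h ε) (a ε) (v ε) (a ε)
          + Γ (h ε) (v₁ ε - Γ (h ε) (v ε) (a ε)) (a ε)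
          + Γ (h ε) (v ε) (a₁ ε - Γ (h ε) (a ε) (a ε)))) s ε := by
    filter_upwards [hh, ha, hv, hv1, hΓc] with ε e1 e2 e3 e4 e5
    exact e2.prodMk (e4.sub (hasDerivWithinAt_conn (e5.differentiableAt (by simp)) e1 e3 e2))
  set D2 := fderiv ℝ (fderiv ℝ Γ) 0 (a 0) (a 0) (v 0) (a 0) with hD2
  set v'' := v₂ 0 - fderiv ℝ Γ 0 (a 0) (v 0) (a 0) with hv''
  set v''' := v3 - (3 : ℝ) • fderiv ℝ Γ 0 (a 0) (v₁ 0) (a 0) - fderiv ℝ Γ 0 (a₁ 0) (v 0) (a 0)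
    - (2 : ℝ) • fderiv ℝ Γ 0 (a 0) (v 0) (a₁ 0) - D2 with hv'''
  have hz2 : HasDerivWithinAt (fun ε ↦ (a₁ ε - Γ (h ε) (a ε) (a ε),
        v₂ ε - Γ (h ε) (v₁ ε) (a ε) - (fderiv ℝ Γ (h ε) (a ε) (v ε) (a ε)
          + Γ (h ε) (v₁ ε - Γ (h ε) (v ε) (a ε)) (a ε)
          + Γ (h ε) (v ε) (a₁ ε - Γ (h ε) (a ε) (a ε))))) (a2, v''') s 0 := by
    have f1 := ha1.sub (hasDerivWithinAt_conn hΓ0 hh0 ha0 ha0)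
    have f2 := hv2.sub (hasDerivWithinAt_conn hΓ0 hh0 hv10 ha0)
    have f3 := (((hΓ1.hasFDerivAt.comp_hasDerivWithinAt 0 hh0).clm_apply ha0).clm_apply
      hv0).clm_apply ha0
    have f4 := hv10.sub (hasDerivWithinAt_conn hΓ0 hh0 hv0 ha0)
    have f5 := hasDerivWithinAt_conn hΓ0 hh0 f4 ha0
    have f6 := hasDerivWithinAt_conn hΓ0 hh0 hv0 f1
    refine (f1.prodMk (f2.sub ((f3.add f5).add f6))).congr_deriv ?_
    simp only [h0, H.conn_zero, zero_apply, sub_zero, add_zero, add_apply, Function.comp_apply,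
      Pi.sub_apply, hD, hv''', hD2, Prod.mk.injEq, true_and]
    module
  rw [iteratedDerivWithin_three_comp (f := G) (z := fun ε ↦ (h ε, v ε)) hs h0s
    (by rw [h0]; exact (H.contDiffAt _ (norm_inr_lt hvr)).of_le (by norm_num))
    (by filter_upwards [hh, hv] with ε h1 h2 using h1.prodMk h2) hz1 hz2, h0, H.conn_zero]
  simp only [zero_apply, sub_zero, add_zero]
  rw [← hv'']
  have k1 := H.norm_fderiv_sub_le hvr a2 v'''
  have k2 := H.norm_fderiv_fderiv_sub_le hvr (a 0) (v₁ 0) (a₁ 0) v''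
  have k3 := H.norm_fderiv_fderiv_fderiv_sub_le hvr (a 0) (v₁ 0)
  have bD : ∀ x y z : E, ‖fderiv ℝ Γ 0 x y z‖ ≤ B * ‖x‖ * ‖y‖ * ‖z‖ := fun x y z ↦
    ContinuousLinearMap.le_of_opNorm_le _ (ContinuousLinearMap.le_of_opNorm_le _
      (ContinuousLinearMap.le_of_opNorm_le _ H.bound_conn x) y) z
  have bDv : ‖fderiv ℝ Γ 0 (a 0) (v 0) (a 0)‖ ≤ B * κ ^ 3 := by
    refine (bD _ _ _).trans ?_
    calc B * ‖a 0‖ * ‖v 0‖ * ‖a 0‖ ≤ B * κ * κ * κ := by gcongr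
      _ = B * κ ^ 3 := by ring
  have hκ1 : κ ≤ 1 := le_trans (by nlinarith) hBκ
  have hBκ3 : B * κ ^ 3 ≤ κ * κ := by
    calc B * κ ^ 3 = (B * κ) * (κ * κ) := by ring
      _ ≤ 1 * (κ * κ) := by gcongr
      _ = κ * κ := by ring
  have hκκ : κ * κ ≤ κ := mul_le_of_le_one_left hκ0 hκ1
  have bv'' : ‖v''‖ ≤ 2 * κ := (norm_sub_le _ _).trans (by linarith)
  have bD2 : ‖D2‖ ≤ B * κ ^ 4 := by
    have := ContinuousLinearMap.le_of_opNorm_le _ (ContinuousLinearMap.le_of_opNorm_le _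
      (ContinuousLinearMap.le_of_opNorm_le _ (ContinuousLinearMap.le_of_opNorm_le _
        H.bound_conn' (a 0)) (a 0)) (v 0)) (a 0)
    refine this.trans ?_
    calc B * ‖a 0‖ * ‖a 0‖ * ‖v 0‖ * ‖a 0‖ ≤ B * κ * κ * κ * κ := by gcongr
      _ = B * κ ^ 4 := by ring
  have bE : ‖(3 : ℝ) • fderiv ℝ Γ 0 (a 0) (v 0) (fderiv ℝ Γ 0 (a 0) (v 0) (a 0))‖
      ≤ 3 * (B * κ ^ 4) := by
    rw [norm_smul, Real.norm_eq_abs, abs_of_pos (by norm_num : (0 : ℝ) < 3)]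
    refine mul_le_mul_of_nonneg_left ((bD _ _ _).trans ?_) (by norm_num)
    calc B * ‖a 0‖ * ‖v 0‖ * ‖fderiv ℝ Γ 0 (a 0) (v 0) (a 0)‖ ≤ B * κ * κ * (B * κ ^ 3) := by gcongr
      _ ≤ B * κ * κ * (κ * κ) := by gcongr
      _ = B * κ ^ 4 := by ring
  have b1 : B * ‖v 0‖ ^ 3 * ‖a2‖ ≤ B * κ ^ 4 := by
    calc B * ‖v 0‖ ^ 3 * ‖a2‖ ≤ B * κ ^ 3 * κ := by gcongr
      _ = B * κ ^ 4 := by ring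
  have b2 : B * ‖v 0‖ ^ 2 * ‖(a 0, v₁ 0)‖ * ‖(a₁ 0, v'')‖ ≤ 2 * (B * κ ^ 4) := by
    have e1 := norm_pair_le ba bv1
    have e2 := norm_pair_le (ba1.trans (by linarith : κ ≤ 2 * κ)) bv''
    calc B * ‖v 0‖ ^ 2 * ‖(a 0, v₁ 0)‖ * ‖(a₁ 0, v'')‖ ≤ B * κ ^ 2 * κ * (2 * κ) := by gcongr
      _ = 2 * (B * κ ^ 4) := by ring
  have b3 : B * ‖v 0‖ * ‖(a 0, v₁ 0)‖ ^ 3 ≤ B * κ ^ 4 := by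
    have e1 := norm_pair_le ba bv1
    calc B * ‖v 0‖ * ‖(a 0, v₁ 0)‖ ^ 3 ≤ B * κ * κ ^ 3 := by gcongr
      _ = B * κ ^ 4 := by ring
  have k2' : ‖(3 : ℝ) • (fderiv ℝ (fderiv ℝ G) (0, v 0) (a 0, v₁ 0) (a₁ 0, v'')
      + (fderiv ℝ Γ 0 (a 0) (v 0) v'' + fderiv ℝ Γ 0 (a₁ 0) (v 0) (v₁ 0)))‖
      ≤ 3 * (2 * (B * κ ^ 4)) := by
    rw [norm_smul, Real.norm_eq_abs, abs_of_pos (by norm_num : (0 : ℝ) < 3)]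
    exact mul_le_mul_of_nonneg_left (k2.trans b2) (by norm_num)
  have hsum := (norm_sub_le _ _).trans (add_le_add ((norm_add_le _ _).trans (add_le_add
    ((norm_add_le _ _).trans (add_le_add
    ((norm_add_le _ _).trans (add_le_add (k3.trans b3) k2')) (k1.trans b1))) bE)) bD2)
  refine (le_of_eq (congrArg norm ?_)).trans (hsum.trans (by linarith))
  have hvv : fderiv ℝ Γ 0 (a 0) (v 0) v'' = fderiv ℝ Γ 0 (a 0) (v 0) (v₂ 0)
      - fderiv ℝ Γ 0 (a 0) (v 0) (fderiv ℝ Γ 0 (a 0) (v 0) (a 0)) := by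
    rw [hv'', map_sub]
  rw [hvv]
  have hv''2 := hv'''
  linear_combination (norm := module)
    -H.curvature_third_order (a 0) (a₁ 0) a2 (v 0) (v₁ 0) (v₂ 0) + hv''2

end IsNormalExp

end NormalExp

/-! ### The exponential map at one point -/

section ExpAt

variable {E : Type*} [NormedAddCommGroup E] [NormedSpace ℝ E]

lemma hasDerivWithinAt_comp_smul {X : Type*} [NormedAddCommGroup X] [NormedSpace ℝ X] {T : E → X}
    {T' : E →L[ℝ] X} {v : E} {s : Set ℝ} {t : ℝ} (h : HasFDerivAt T T' (t • v)) :
    HasDerivWithinAt (fun t : ℝ ↦ T (t • v)) (T' v) s t := by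
  have h2 : HasDerivWithinAt (fun t : ℝ ↦ t • v) v s t := by
    simpa using ((hasDerivAt_id t).smul_const v).hasDerivWithinAt
  exact h.comp_hasDerivWithinAt t h2

lemma _root_.HasFDerivAt.clm_apply_const {X Y Z : Type*} [NormedAddCommGroup X] [NormedSpace ℝ X]
    [NormedAddCommGroup Y] [NormedSpace ℝ Y] [NormedAddCommGroup Z] [NormedSpace ℝ Z]
    {T : X → Y →L[ℝ] Z} {T' : X →L[ℝ] Y →L[ℝ] Z} {x : X} (h : HasFDerivAt T T' x) (v : Y) :
    HasFDerivAt (fun x ↦ T x v) (T'.flip v) x :=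
  (h.clm_apply (hasFDerivAt_const v x)).congr_fderiv (by ext; simp)

/-- The map `f` is, on the ball of radius `ρ`, the exponential map at `x` of the connection `Γ`. -/
structure IsExpAt (Γ : E → E →L[ℝ] E →L[ℝ] E) (f : E → E) (x : E) (ρ : ℝ) : Prop where
  pos : 0 < ρ
  contDiffAt : ∀ v, ‖v‖ < ρ → ContDiffAt ℝ 3 f v
  isGeodesic : ∀ v, ‖v‖ < ρ → ∃ c' : ℝ → E, IsGeodesicPair Γ (fun t ↦ f (t • v)) c' 0 1 ∧
    f 0 = x ∧ c' 0 = v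

namespace IsExpAt

variable {Γ : E → E →L[ℝ] E →L[ℝ] E} {f : E → E} {x : E} {ρ : ℝ}

lemma apply_zero (H : IsExpAt Γ f x ρ) : f 0 = x :=
  let ⟨_, _, h, _⟩ := H.isGeodesic 0 (by simpa using H.pos); h

lemma norm_smul_lt {v : E} (hv : ‖v‖ < ρ) {t : ℝ} (ht : t ∈ Icc (0 : ℝ) 1) : ‖t • v‖ < ρ := by
  rw [norm_smul, Real.norm_eq_abs, abs_of_nonneg ht.1]
  exact (mul_le_of_le_one_left (norm_nonneg _) ht.2).trans_lt hv

lemma hasDerivWithinAt_ray (H : IsExpAt Γ f x ρ) {v : E} (hv : ‖v‖ < ρ) {t : ℝ}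
    (ht : t ∈ Icc (0 : ℝ) 1) :
    HasDerivWithinAt (fun t : ℝ ↦ f (t • v)) (fderiv ℝ f (t • v) v) (Icc 0 1) t := by
  have h1 := ((H.contDiffAt _ (norm_smul_lt hv ht)).differentiableAt (by simp)).hasFDerivAt
  exact hasDerivWithinAt_comp_smul h1

lemma hasDerivWithinAt_ray' (H : IsExpAt Γ f x ρ) {v : E} (hv : ‖v‖ < ρ) {t : ℝ}
    (ht : t ∈ Icc (0 : ℝ) 1) :
    HasDerivWithinAt (fun t : ℝ ↦ fderiv ℝ f (t • v) v) (fderiv ℝ (fderiv ℝ f) (t • v) v v)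
      (Icc 0 1) t := by
  have h1 := (((H.contDiffAt _ (norm_smul_lt hv ht)).fderiv_right (m := 2)
    (by norm_num)).differentiableAt (by simp)).hasFDerivAt
  exact hasDerivWithinAt_comp_smul (h1.clm_apply_const v)

/-- Rays are geodesics, with the expected velocity. -/
lemma isGeodesicPair (H : IsExpAt Γ f x ρ) {v : E} (hv : ‖v‖ < ρ) :
    IsGeodesicPair Γ (fun t ↦ f (t • v)) (fun t ↦ fderiv ℝ f (t • v) v) 0 1 := by
  obtain ⟨c', hc, -, -⟩ := H.isGeodesic v hv
  have heq : ∀ t ∈ Icc (0 : ℝ) 1, fderiv ℝ f (t • v) v = c' t := fun t ht ↦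
    (uniqueDiffOn_Icc_zero_one t ht).eq_deriv _ (H.hasDerivWithinAt_ray hv ht) (hc t ht).1
  intro t ht
  refine ⟨H.hasDerivWithinAt_ray hv ht, ?_⟩
  simp only [heq t ht]
  exact (hc t ht).2.congr heq (heq t ht)

lemma fderiv_zero (H : IsExpAt Γ f x ρ) : fderiv ℝ f 0 = .id ℝ E := by
  have key : ∀ v, ‖v‖ < ρ → fderiv ℝ f 0 v = v := by
    intro v hv
    obtain ⟨c', hc, -, h0⟩ := H.isGeodesic v hv
    have := (uniqueDiffOn_Icc_zero_one 0 (by simp)).eq_deriv _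
      (H.hasDerivWithinAt_ray hv (by simp : (0 : ℝ) ∈ Icc (0 : ℝ) 1)) (hc 0 (by simp)).1
    rwa [zero_smul, h0] at this
  ext v
  obtain ⟨c, hc, hcv⟩ : ∃ c : ℝ, 0 < c ∧ ‖c • v‖ < ρ := by
    refine ⟨ρ / (2 * (‖v‖ + 1)), div_pos H.pos (by positivity), ?_⟩
    rw [norm_smul, Real.norm_eq_abs, abs_of_pos (div_pos H.pos (by positivity)), div_mul_eq_mul_div,
      div_lt_iff₀ (by positivity)]
    nlinarith [H.pos, norm_nonneg v, mul_nonneg H.pos.le (norm_nonneg v)]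
  have := key _ hcv
  rw [map_smul] at this
  exact smul_right_injective E hc.ne' this

/-- The geodesic equation for rays, as a differential equation for `f`. -/
lemma geodesic_eq (H : IsExpAt Γ f x ρ) {v : E} (hv : ‖v‖ < ρ) :
    fderiv ℝ (fderiv ℝ f) v v v = -Γ (f v) (fderiv ℝ f v v) (fderiv ℝ f v v) := by
  have h1 := H.hasDerivWithinAt_ray' hv (t := 1) (by simp)
  have h2 := (H.isGeodesicPair hv 1 (by simp)).2
  have := (uniqueDiffOn_Icc_zero_one 1 (by simp)).eq_deriv _ h1 h2
  simpa using this

lemma fderiv_fderiv_zero (H : IsExpAt Γ f x ρ) (hs : ∀ u v, Γ x u v = Γ x v u) (u v : E) :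
    fderiv ℝ (fderiv ℝ f) 0 u v = -Γ x u v := by
  have hsf := fderiv_fderiv_symm ((H.contDiffAt 0 (by simpa using H.pos)).of_le
    (by norm_num : (2 : WithTop ℕ∞) ≤ 3))
  have key : ∀ v, ‖v‖ < ρ → fderiv ℝ (fderiv ℝ f) 0 v v = -Γ x v v := by
    intro v hv
    have h1 := H.hasDerivWithinAt_ray' hv (t := 0) (by simp)
    have h2 := (H.isGeodesicPair hv 0 (by simp)).2
    have := (uniqueDiffOn_Icc_zero_one 0 (by simp)).eq_deriv _ h1 h2
    simpa [H.fderiv_zero, H.apply_zero] using this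
  have key' : ∀ v, fderiv ℝ (fderiv ℝ f) 0 v v = -Γ x v v := by
    intro v
    obtain ⟨c, hc, hcv⟩ : ∃ c : ℝ, 0 < c ∧ ‖c • v‖ < ρ := by
      refine ⟨ρ / (2 * (‖v‖ + 1)), div_pos H.pos (by positivity), ?_⟩
      rw [norm_smul, Real.norm_eq_abs, abs_of_pos (div_pos H.pos (by positivity)),
        div_mul_eq_mul_div, div_lt_iff₀ (by positivity)]
      nlinarith [H.pos, norm_nonneg v, mul_nonneg H.pos.le (norm_nonneg v)]
    have := key _ hcv
    simp only [map_smul, smul_apply, ← smul_neg] at this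
    exact smul_right_injective E hc.ne' (smul_right_injective E hc.ne' this)
  have e := key' (u + v)
  simp only [map_add, add_apply, key', hsf v u, hs v u] at e
  have : (2 : ℝ) • (fderiv ℝ (fderiv ℝ f) 0 u v + Γ x u v) = 0 := by
    linear_combination (norm := module) e
  exact eq_neg_of_add_eq_zero_left ((smul_eq_zero.1 this).resolve_left two_ne_zero)

end IsExpAt

/-! ### The connector in normal coordinates -/

/-- The connector `-D²_v G(h, 0)` read off from an exponential map `G (h, v) = exp_h v`. -/
noncomputable def connOfExp (G : E × E → E) (h : E) : E →L[ℝ] E →L[ℝ] E :=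
  -(ContinuousLinearMap.bilinearComp (fderiv ℝ (fderiv ℝ G) (h, 0)) (.inr ℝ E E) (.inr ℝ E E))

lemma connOfExp_apply (G : E × E → E) (h u w : E) :
    connOfExp G h u w = -fderiv ℝ (fderiv ℝ G) (h, 0) (0, u) (0, w) := by
  simp [connOfExp]

section

variable {Γ : E → E →L[ℝ] E →L[ℝ] E} {f : E → E} {g : E → E} {G : E × E → E} {h y : E} {ρ : ℝ}

lemma eventually_prodMk {E : Type*} [NormedAddCommGroup E] {h : E} {p : E × E → Prop}
    (hp : ∀ᶠ z in 𝓝 (h, (0 : E)), p z) :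
    ∀ᶠ v in 𝓝 (0 : E), p (h, v) :=
  (Continuous.prodMk_right h).continuousAt.eventually hp

lemma hasFDerivAt_comp_inr {X : Type*} [NormedAddCommGroup X] [NormedSpace ℝ X] {T : E × E → X}
    {v : E} (hT : DifferentiableAt ℝ T (h, v)) :
    HasFDerivAt (fun v ↦ T (h, v)) (fderiv ℝ T (h, v) ∘L .inr ℝ E E) v :=
  HasFDerivAt.comp v hT.hasFDerivAt (hasFDerivAt_prodMk_right h v)

/-- If `f` maps `exp_h v = G (h, v)` to `g (Df(h) v)`, where `g` is the exponential map at `f h`,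
then `v ↦ G (h, v)` has the identity as its derivative at `0`. -/
lemma fderiv_snd_of_intertwine (hg : IsExpAt Γ g y ρ)
    (hf : ContDiffAt ℝ 3 f h) (hG : ContDiffAt ℝ 3 G (h, 0)) (hG0 : G (h, 0) = h)
    (hinj : Function.Injective (fderiv ℝ f h))
    (H : ∀ᶠ v in 𝓝 (0 : E), f (G (h, v)) = g (fderiv ℝ f h v)) (w : E) :
    fderiv ℝ G (h, 0) (0, w) = w := by
  have e1 : HasFDerivAt (fun v ↦ f (G (h, v)))
      (fderiv ℝ f h ∘L (fderiv ℝ G (h, 0) ∘L .inr ℝ E E)) 0 := by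
    have hf' : HasFDerivAt f (fderiv ℝ f h) (G (h, 0)) := by
      rw [hG0]; exact (hf.differentiableAt (by simp)).hasFDerivAt
    exact hf'.comp (0 : E) (hasFDerivAt_comp_inr (hG.differentiableAt (by simp)))
  have e2 : HasFDerivAt (fun v ↦ g (fderiv ℝ f h v)) (fderiv ℝ f h) 0 := by
    have hg' : HasFDerivAt g (.id ℝ E) (fderiv ℝ f h 0) := by
      rw [map_zero, ← hg.fderiv_zero]
      exact ((hg.contDiffAt 0 (by simpa using hg.pos)).differentiableAt (by simp)).hasFDerivAt
    exact hg'.comp (0 : E) (fderiv ℝ f h).hasFDerivAt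
  have := DFunLike.congr_fun (e1.unique (e2.congr_of_eventuallyEq H)) w
  exact hinj this

/-- Under the same assumption, `f` maps the connector read off from `G` to `Γ`. -/
lemma isConnectionMap_of_intertwine (hg : IsExpAt Γ g (f h) ρ)
    (hs : ∀ u v, Γ (f h) u v = Γ (f h) v u)
    (hf : ContDiffAt ℝ 3 f h) (hG : ContDiffAt ℝ 3 G (h, 0)) (hG0 : G (h, 0) = h)
    (hinj : Function.Injective (fderiv ℝ f h))
    (H : ∀ᶠ v in 𝓝 (0 : E), f (G (h, v)) = g (fderiv ℝ f h v)) :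
    IsConnectionMap f (connOfExp G) Γ h := by
  have hsnd := fderiv_snd_of_intertwine hg hf hG hG0 hinj H
  intro u w
  have hGc : ∀ᶠ v in 𝓝 (0 : E), ContDiffAt ℝ 3 G (h, v) :=
    eventually_prodMk (hG.eventually (by simp))
  have hGt : Tendsto (fun v ↦ G (h, v)) (𝓝 0) (𝓝 h) := by
    have := (hasFDerivAt_comp_inr (hG.differentiableAt (by simp))).continuousAt.tendsto
    rwa [hG0] at this
  have hfc : ∀ᶠ v in 𝓝 (0 : E), ContDiffAt ℝ 3 f (G (h, v)) :=
    hGt.eventually (hf.eventually (by simp))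
  have hlt : Tendsto (fun v ↦ fderiv ℝ f h v) (𝓝 0) (𝓝 0) := by
    have := (fderiv ℝ f h).continuous.tendsto 0
    rwa [map_zero] at this
  have hgc : ∀ᶠ v in 𝓝 (0 : E), ContDiffAt ℝ 3 g (fderiv ℝ f h v) :=
    hlt.eventually ((hg.contDiffAt 0 (by simpa using hg.pos)).eventually (by simp))
  -- the first derivatives of both sides in the direction `w` agree near `0`
  have key : ∀ᶠ v in 𝓝 (0 : E), fderiv ℝ f (G (h, v)) (fderiv ℝ G (h, v) (0, w)) =
      fderiv ℝ g (fderiv ℝ f h v) (fderiv ℝ f h w) := by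
    filter_upwards [hGc, hfc, hgc, eventually_eventually_nhds.2 H] with v c1 c2 c3 c4
    have e1 : HasFDerivAt (fun v ↦ f (G (h, v)))
        (fderiv ℝ f (G (h, v)) ∘L (fderiv ℝ G (h, v) ∘L .inr ℝ E E)) v :=
      (c2.differentiableAt (by simp)).hasFDerivAt.comp v
        (hasFDerivAt_comp_inr (c1.differentiableAt (by simp)))
    have e2 : HasFDerivAt (fun v ↦ g (fderiv ℝ f h v))
        (fderiv ℝ g (fderiv ℝ f h v) ∘L fderiv ℝ f h) v :=
      (c3.differentiableAt (by simp)).hasFDerivAt.comp v (fderiv ℝ f h).hasFDerivAt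
    exact DFunLike.congr_fun (e1.unique (e2.congr_of_eventuallyEq c4)) w
  have d1 : HasFDerivAt (fun v ↦ fderiv ℝ f (G (h, v)))
      (fderiv ℝ (fderiv ℝ f) h ∘L (fderiv ℝ G (h, 0) ∘L .inr ℝ E E)) 0 := by
    have hf' : HasFDerivAt (fderiv ℝ f) (fderiv ℝ (fderiv ℝ f) h) (G (h, 0)) := by
      rw [hG0]
      exact ((hf.fderiv_right (m := 2) (by norm_num)).differentiableAt (by simp)).hasFDerivAt
    exact hf'.comp (0 : E) (hasFDerivAt_comp_inr (hG.differentiableAt (by simp)))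
  have d2 := hasFDerivAt_comp_inr
    ((hG.fderiv_right (m := 2) (by norm_num)).differentiableAt (by simp))
  have d3 : HasFDerivAt (fun v ↦ fderiv ℝ g (fderiv ℝ f h v))
      (fderiv ℝ (fderiv ℝ g) 0 ∘L fderiv ℝ f h) 0 := by
    have hg' : HasFDerivAt (fderiv ℝ g) (fderiv ℝ (fderiv ℝ g) 0) (fderiv ℝ f h 0) := by
      rw [map_zero]
      exact (((hg.contDiffAt 0 (by simpa using hg.pos)).fderiv_right (m := 2)
        (by norm_num)).differentiableAt (by simp)).hasFDerivAt
    exact hg'.comp (0 : E) (fderiv ℝ f h).hasFDerivAt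
  have l := d1.clm_apply (d2.clm_apply (hasFDerivAt_const ((0, w) : E × E) 0))
  have r := d3.clm_apply (hasFDerivAt_const (fderiv ℝ f h w) (0 : E))
  have e := DFunLike.congr_fun (l.unique (r.congr_of_eventuallyEq key)) u
  simp only [add_apply, ContinuousLinearMap.comp_apply, ContinuousLinearMap.flip_apply,
    ContinuousLinearMap.comp_zero, zero_add, ContinuousLinearMap.inr_apply, hG0, hsnd,
    hg.fderiv_fderiv_zero hs] at e
  rw [connOfExp_apply, map_neg]
  linear_combination (norm := module) -e

/-- In normal coordinates the connector satisfies `Γ(v)(v ⊗ v) = 0`. -/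
lemma conn_ray_eq_zero {Γ' : E → E →L[ℝ] E →L[ℝ] E} {x v : E} (hf : IsExpAt Γ f x ρ)
    (hv : ‖v‖ < ρ) (hinj : Function.Injective (fderiv ℝ f v)) (hc : IsConnectionMap f Γ' Γ v) :
    Γ' v v v = 0 := by
  apply hinj
  rw [hc, hf.geodesic_eq hv, map_zero, neg_add_cancel]

/-- If `Γ(v)(v ⊗ v) = 0` for all small `v`, then `Γ` vanishes at `0` and the symmetrization of its
derivative there also does. -/
lemma conn_zero_of_ray {Γ : E → E →L[ℝ] E →L[ℝ] E} (hΓ : DifferentiableAt ℝ Γ 0)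
    (hs : ∀ u v, Γ 0 u v = Γ 0 v u) (h : ∀ᶠ v in 𝓝 (0 : E), Γ v v v = 0) :
    Γ 0 = 0 ∧ ∀ v, fderiv ℝ Γ 0 v v v = 0 := by
  have key : ∀ v, ∀ᶠ t in 𝓝 (0 : ℝ), t ≠ 0 → Γ (t • v) v v = 0 := by
    intro v
    have ht : Tendsto (fun t : ℝ ↦ t • v) (𝓝 0) (𝓝 0) := by
      have : Continuous fun t : ℝ ↦ t • v := by fun_prop
      simpa using this.tendsto 0
    filter_upwards [ht.eventually h] with t h1 h2
    simp only [map_smul, smul_apply] at h1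
    exact (smul_eq_zero.1 ((smul_eq_zero.1 h1).resolve_left h2)).resolve_left h2
  have hd : ∀ v, HasDerivAt (fun t : ℝ ↦ Γ (t • v) v v) (fderiv ℝ Γ 0 v v v) 0 := by
    intro v
    have h2 : HasFDerivAt Γ (fderiv ℝ Γ 0) ((0 : ℝ) • v) := by
      rw [zero_smul]; exact hΓ.hasFDerivAt
    exact (hasDerivWithinAt_univ.1 <|
      hasDerivWithinAt_comp_smul ((h2.clm_apply_const v).clm_apply_const v))
  have h0 : ∀ v, Γ 0 v v = 0 := by
    intro v
    have t1 : Tendsto (fun t : ℝ ↦ Γ (t • v) v v) (𝓝[≠] 0) (𝓝 (Γ 0 v v)) := by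
      have := (hd v).continuousAt.tendsto
      rw [zero_smul] at this
      exact this.mono_left nhdsWithin_le_nhds
    have t2 : Tendsto (fun t : ℝ ↦ Γ (t • v) v v) (𝓝[≠] 0) (𝓝 0) := by
      refine tendsto_const_nhds.congr' ?_
      filter_upwards [nhdsWithin_le_nhds (key v), self_mem_nhdsWithin] with t h1 h2
      exact (h1 h2).symm
    exact tendsto_nhds_unique t1 t2
  refine ⟨?_, fun v ↦ ?_⟩
  · refine ContinuousLinearMap.ext fun u ↦ ContinuousLinearMap.ext fun v ↦ ?_
    have e := h0 (u + v)
    simp only [map_add, add_apply, h0, hs v u, zero_add, add_zero] at e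
    have : (2 : ℝ) • Γ 0 u v = 0 := by
      linear_combination (norm := module) e
    simpa using this
  · have : (fun t : ℝ ↦ Γ (t • v) v v) =ᶠ[𝓝 0] fun _ ↦ (0 : E) := by
      filter_upwards [key v] with t ht
      by_cases h : t = 0
      · simp [h, h0]
      · exact ht h
    exact (hd v).unique ((hasDerivAt_const 0 (0 : E)).congr_of_eventuallyEq this)

end

end ExpAt

/-! ### Normal coordinates around a varying point -/

lemma contDiffAt_clm_apply {D X Y : Type*} [NormedAddCommGroup D] [NormedSpace ℝ D]
    [NormedAddCommGroup X] [NormedSpace ℝ X] [NormedAddCommGroup Y] [NormedSpace ℝ Y]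
    [FiniteDimensional ℝ X] {f : D → X →L[ℝ] Y} {z : D} {n : WithTop ℕ∞} :
    ContDiffAt ℝ n f z ↔ ∀ y, ContDiffAt ℝ n (fun x ↦ f x y) z := by
  refine ⟨fun h y ↦ h.clm_apply contDiffAt_const, fun h ↦ ?_⟩
  let e₁ : X ≃L[ℝ] (Fin (Module.finrank ℝ X) → ℝ) :=
    ContinuousLinearEquiv.ofFinrankEq (Module.finrank_fin_fun ℝ).symm
  let e₂ := (e₁.arrowCongr (1 : Y ≃L[ℝ] Y)).trans
    (ContinuousLinearEquiv.piRing (Fin (Module.finrank ℝ X)))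
  rw [← Function.id_comp f, ← e₂.symm_comp_self]
  exact e₂.symm.contDiff.contDiffAt.comp z (contDiffAt_pi.2 fun i ↦ h _)

lemma _root_.ContDiffAt.eventually_norm_lt {D Y : Type*} [NormedAddCommGroup D] [NormedSpace ℝ D]
    [NormedAddCommGroup Y] [NormedSpace ℝ Y] {f : D → Y} {z : D} {n : WithTop ℕ∞}
    (h : ContDiffAt ℝ n f z) {B : ℝ} (hB : ‖f z‖ < B) : ∀ᶠ x in 𝓝 z, ‖f x‖ < B :=
  h.continuousAt.norm.eventually_lt_const hB

section Slices

variable {X Z G : Type*} [NormedAddCommGroup X] [NormedSpace ℝ X] [NormedAddCommGroup Z]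
  [NormedSpace ℝ Z] [NormedAddCommGroup G] [NormedSpace ℝ G] {J : X × Z → G} {x : X} {z : Z}
  {m n : WithTop ℕ∞}

lemma contDiffAt_slice (h : ContDiffAt ℝ n J (x, z)) : ContDiffAt ℝ n (fun z ↦ J (x, z)) z :=
  ContDiffAt.comp (g := J) z h (contDiffAt_const.prodMk contDiffAt_id)

lemma contDiffAt_fderiv_slice (h : ContDiffAt ℝ n J (x, z)) (hmn : m + 1 ≤ n) :
    ContDiffAt ℝ m (fun P : X × Z ↦ fderiv ℝ (fun z ↦ J (P.1, z)) P.2) (x, z) := by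
  refine ContDiffAt.fderiv (f := fun (P : X × Z) z ↦ J (P.1, z)) (g := Prod.snd) (n := n) ?_
    contDiffAt_snd hmn
  exact ContDiffAt.comp (g := J) (f := fun q : (X × Z) × Z ↦ (q.1.1, q.2)) ((x, z), z) h
    (contDiffAt_fst.fst.prodMk contDiffAt_snd)

end Slices

section

variable {E : Type*} [NormedAddCommGroup E] [NormedSpace ℝ E]

/-- If `φ` maps the connector `Γ₁` to `Γ₂`, then a local inverse of `φ` maps `Γ₂` to `Γ₁`. -/
lemma IsConnectionMap.of_leftInverse {φ ψ : E → E} {Γ₁ Γ₂ : E → E →L[ℝ] E →L[ℝ] E} {z : E}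
    (h : IsConnectionMap φ Γ₁ Γ₂ z) (hφ : ContDiffAt ℝ 2 φ z) (hψ : ContDiffAt ℝ 2 ψ (φ z))
    (hl : ∀ᶠ z' in 𝓝 z, ψ (φ z') = z') (hr : ∀ᶠ q in 𝓝 (φ z), φ (ψ q) = q) :
    IsConnectionMap ψ Γ₂ Γ₁ (φ z) := by
  have hz : ψ (φ z) = z := hl.self_of_nhds
  have dφ : HasFDerivAt φ (fderiv ℝ φ z) z := (hφ.differentiableAt (by simp)).hasFDerivAt
  have dψ : HasFDerivAt ψ (fderiv ℝ ψ (φ z)) (φ z) := (hψ.differentiableAt (by simp)).hasFDerivAt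
  have dφ' : HasFDerivAt (fderiv ℝ φ) (fderiv ℝ (fderiv ℝ φ) z) z :=
    ((hφ.fderiv_right (m := 1) (by norm_num)).differentiableAt (by simp)).hasFDerivAt
  have dψ' : HasFDerivAt (fderiv ℝ ψ) (fderiv ℝ (fderiv ℝ ψ) (φ z)) (φ z) :=
    ((hψ.fderiv_right (m := 1) (by norm_num)).differentiableAt (by simp)).hasFDerivAt
  have hright : ∀ u, fderiv ℝ φ z (fderiv ℝ ψ (φ z) u) = u := by
    intro u
    have dφ2 : HasFDerivAt φ (fderiv ℝ φ z) (ψ (φ z)) := by rwa [hz]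
    have e := (dφ2.comp (φ z) dψ).unique
      ((hasFDerivAt_id (φ z)).congr_of_eventuallyEq (hr.mono fun q hq ↦ hq))
    exact DFunLike.congr_fun e u
  have key : ∀ᶠ z' in 𝓝 z, fderiv ℝ ψ (φ z') ∘L fderiv ℝ φ z' = .id ℝ E := by
    filter_upwards [hφ.eventually (by simp), dφ.continuousAt.eventually (hψ.eventually (by simp)),
      eventually_eventually_nhds.2 hl] with z' c1 c2 c3
    exact ((c2.differentiableAt (by simp)).hasFDerivAt.comp z'
      (c1.differentiableAt (by simp)).hasFDerivAt).unique
      ((hasFDerivAt_id z').congr_of_eventuallyEq (c3.mono fun q hq ↦ hq))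
  have hid : ∀ u, fderiv ℝ ψ (φ z) (fderiv ℝ φ z u) = u := fun u ↦
    DFunLike.congr_fun key.self_of_nhds u
  have second : ∀ a b, fderiv ℝ (fderiv ℝ ψ) (φ z) (fderiv ℝ φ z a) (fderiv ℝ φ z b)
      + fderiv ℝ ψ (φ z) (fderiv ℝ (fderiv ℝ φ) z a b) = 0 := by
    intro a b
    have d1 : HasFDerivAt (fun z' ↦ fderiv ℝ ψ (φ z'))
      (fderiv ℝ (fderiv ℝ ψ) (φ z) ∘L fderiv ℝ φ z) z := dψ'.comp z dφ
    have d2 := d1.clm_apply (dφ'.clm_apply_const b)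
    have d3 : HasFDerivAt (fun z' ↦ fderiv ℝ ψ (φ z') (fderiv ℝ φ z' b)) (0 : E →L[ℝ] E) z :=
      (hasFDerivAt_const b z).congr_of_eventuallyEq
        (key.mono fun z' hz' ↦ DFunLike.congr_fun hz' b)
    have e := DFunLike.congr_fun (d2.unique d3) a
    simp only [add_apply, ContinuousLinearMap.comp_apply, ContinuousLinearMap.flip_apply,
      zero_apply] at e
    linear_combination (norm := module) e
  intro u v
  have e1 := congrArg (fderiv ℝ ψ (φ z)) (h (fderiv ℝ ψ (φ z) u) (fderiv ℝ ψ (φ z) v))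
  have e2 := second (fderiv ℝ ψ (φ z) u) (fderiv ℝ ψ (φ z) v)
  simp only [map_add, hright, hid] at e1 e2
  rw [hz]
  linear_combination (norm := module) -e1 - e2

/-- The exponential map `(h, v) ↦ L x (exp_{e x h} (D(e x)(h) v))` in the normal coordinates `L x`
around `x`, where `e x` is the exponential map at `x` and `L x` is its inverse. -/
noncomputable abbrev normalExp (e L : E → E → E) (x : E) : E × E → E :=
  fun z ↦ L x (e (e x z.1) (fderiv ℝ (e x) z.1 z.2))

/-- Local exponential and logarithm maps of the connector `Γ` around `p`: for `x` within `r` of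
`p`, the map `e x` is the exponential map at `x` on the ball of radius `r`, with values in `U`, and
`L x` is its inverse. The exponential map in the normal coordinates `L x` satisfies estimates that
are uniform in `x`. -/
structure IsNormalFamily (Γ : E → E →L[ℝ] E →L[ℝ] E) (p : E) (U : Set E) (r B : ℝ)
    (e L : E → E → E) : Prop where
  pos : 0 < r
  isExpAt : ∀ x, ‖x - p‖ < r → IsExpAt Γ (e x) x r
  mem : ∀ x, ‖x - p‖ < r → ∀ v, ‖v‖ < r → e x v ∈ U
  exp_contDiffAt : ∀ x, ‖x - p‖ < r → ∀ v, ‖v‖ < r →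
    ContDiffAt ℝ 5 (fun P : E × E ↦ e P.1 P.2) (x, v)
  log_contDiffAt : ∀ x, ‖x - p‖ < r → ∀ v, ‖v‖ < r → ContDiffAt ℝ 5 (L x) (e x v)
  log_exp : ∀ x, ‖x - p‖ < r → ∀ v, ‖v‖ < r → L x (e x v) = v
  exp_log : ∀ x, ‖x - p‖ < r → ∀ v, ‖v‖ < r → ∀ᶠ q in 𝓝 (e x v), e x (L x q) = q
  isNormalExp : ∀ x, ‖x - p‖ < r →
    IsNormalExp (normalExp e L x) (connOfExp (normalExp e L x)) r B
  isConnectionMap : ∀ x, ‖x - p‖ < r → ∀ h, ‖h‖ < r →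
    IsConnectionMap (e x) (connOfExp (normalExp e L x)) Γ h

/-- The exponential map is locally invertible, together with its base point. -/
lemma exists_localExp_localLog.{u} {E : Type u} [NormedAddCommGroup E] [NormedSpace ℝ E]
    [FiniteDimensional ℝ E] {Γ : E → E →L[ℝ] E →L[ℝ] E} (hΓ : ContDiff ℝ ∞ Γ) (p : E) :
    ∃ Exp Log : E × E → E, ∃ ρ : ℝ, ContDiffAt ℝ 10 Exp (p, 0) ∧ ContDiffAt ℝ 10 Log (p, p) ∧
      (∀ᶠ x in 𝓝 p, IsExpAt Γ (fun v ↦ Exp (x, v)) x ρ) ∧ Exp (p, 0) = p ∧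
      (∀ᶠ P in 𝓝 (p, (0 : E)), Log (P.1, Exp P) = P.2) ∧
      ∀ᶠ Q in 𝓝 (p, p), Exp (Q.1, Log Q) = Q.2 := by
  have : CompleteSpace E := FiniteDimensional.complete ℝ E
  obtain ⟨Exp, hE, hgeo⟩ := exists_localExp hΓ p 10 (by norm_num)
  replace hE : ContDiffAt ℝ 10 Exp (p, 0) := by exact_mod_cast hE
  obtain ⟨ρ, hρ, hball⟩ := Metric.eventually_nhds_iff_ball.1
    (hgeo.and (hE.eventually (by simp)))
  have hexp : ∀ x, ‖x - p‖ < ρ → IsExpAt Γ (fun v ↦ Exp (x, v)) x ρ := by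
    intro x hx
    have hP : ∀ v : E, ‖v‖ < ρ → (x, v) ∈ Metric.ball (p, (0 : E)) ρ := fun v hv ↦ by
      simp [dist_eq_norm, hx, hv]
    exact ⟨hρ, fun v hv ↦ (contDiffAt_slice (hball _ (hP v hv)).2).of_le (by norm_num),
      fun v hv ↦ (hball _ (hP v hv)).1⟩
  have hp := hexp p (by simpa using hρ)
  have hp0 : Exp (p, 0) = p := hp.apply_zero
  have h0 : ∀ᶠ x in 𝓝 p, Exp (x, 0) = x := by
    filter_upwards [Metric.ball_mem_nhds p hρ] with x hx
    exact (hexp x (by rwa [mem_ball_iff_norm] at hx)).apply_zero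
  -- the derivative of `(x, v) ↦ (x, exp_x v)` at `(p, 0)` is `(h, k) ↦ (h, h + k)`
  have d : HasFDerivAt Exp (fderiv ℝ Exp (p, 0)) (p, 0) :=
    (hE.differentiableAt (by simp)).hasFDerivAt
  have d1 : fderiv ℝ Exp (p, 0) ∘L .inl ℝ E E = .id ℝ E :=
    (HasFDerivAt.comp (g := Exp) p d (hasFDerivAt_prodMk_left p (0 : E))).unique
      ((hasFDerivAt_id p).congr_of_eventuallyEq (h0.mono fun q hq ↦ hq))
  have d2 : fderiv ℝ Exp (p, 0) ∘L .inr ℝ E E = .id ℝ E := by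
    have h1 := HasFDerivAt.comp (g := Exp) (0 : E) d (hasFDerivAt_prodMk_right p (0 : E))
    have h2 := hp.fderiv_zero
    rw [← h2]
    exact h1.fderiv.symm
  have dE : ∀ h k : E, fderiv ℝ Exp (p, 0) (h, k) = h + k := by
    intro h k
    have e1 := DFunLike.congr_fun d1 h
    have e2 := DFunLike.congr_fun d2 k
    simp only [ContinuousLinearMap.comp_apply, ContinuousLinearMap.inl_apply,
      ContinuousLinearMap.inr_apply, ContinuousLinearMap.id_apply] at e1 e2
    rw [← Prod.fst_add_snd (h, k), map_add, e1, e2]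
  let A : (E × E) ≃L[ℝ] E × E := ContinuousLinearEquiv.equivOfInverse
    ((ContinuousLinearMap.fst ℝ E E).prod
      (ContinuousLinearMap.fst ℝ E E + ContinuousLinearMap.snd ℝ E E))
    ((ContinuousLinearMap.fst ℝ E E).prod
      (ContinuousLinearMap.snd ℝ E E - ContinuousLinearMap.fst ℝ E E))
    (fun z ↦ by ext <;> simp) (fun z ↦ by ext <;> simp)
  have hΨ : ContDiffAt ℝ 10 (fun P : E × E ↦ (P.1, Exp P)) (p, 0) := contDiffAt_fst.prodMk hE
  have hΨ' : HasFDerivAt (fun P : E × E ↦ (P.1, Exp P)) (A : E × E →L[ℝ] E × E) (p, 0) := by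
    refine (hasFDerivAt_fst.prodMk d).congr_fderiv (ContinuousLinearMap.ext fun z ↦ ?_)
    exact Prod.ext rfl (dE z.1 z.2)
  have hst := hΨ.hasStrictFDerivAt' hΨ' (by simp)
  have hL := hΨ.to_localInverse hΨ' (by simp)
  have hr := hst.eventually_right_inverse
  have hl := hst.eventually_left_inverse
  simp only [hp0] at hL hr
  refine ⟨Exp, fun Q ↦ (hΨ.localInverse hΨ' (by simp) Q).2, ρ, hE, hL.snd, ?_, hp0, ?_, ?_⟩
  · filter_upwards [Metric.ball_mem_nhds p hρ] with x hx
    exact hexp x (by rwa [mem_ball_iff_norm] at hx)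
  · exact hl.mono fun P hP ↦ congrArg Prod.snd hP
  · refine hr.mono fun Q hQ ↦ ?_
    have e1 : (Q.1, (hΨ.localInverse hΨ' (by simp) Q).2) = hΨ.localInverse hΨ' (by simp) Q :=
      Prod.ext (congrArg Prod.fst hQ).symm rfl
    exact (congrArg Exp e1).trans (congrArg Prod.snd hQ)

/-- Normal coordinates exist around every point, uniformly: the exponential map in the normal
coordinates around `x` depends smoothly on `x` and on its arguments, so that its derivatives are
bounded near `(p, 0)`. -/
theorem exists_isNormalFamily.{u} {E : Type u} [NormedAddCommGroup E] [NormedSpace ℝ E]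
    [FiniteDimensional ℝ E] {Γ : E → E →L[ℝ] E →L[ℝ] E} (hΓ : ContDiff ℝ ∞ Γ)
    (hs : ∀ z u v, Γ z u v = Γ z v u) {p : E} {U : Set E} (hU : U ∈ 𝓝 p) :
    ∃ (r B : ℝ) (e L : E → E → E), IsNormalFamily Γ p U r B e L := by
  -- each differentiation below costs one order of smoothness, of the ten available ones
  obtain ⟨Exp, Log, ρ, hE, hL, hexp, hp0, hle, hel⟩ := exists_localExp_localLog hΓ p
  have hpe : IsExpAt Γ (fun v ↦ Exp (p, v)) p ρ := hexp.self_of_nhds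
  -- the differential of the exponential map at `x`
  let D : E × E → E →L[ℝ] E := fun P ↦ fderiv ℝ (fun v ↦ Exp (P.1, v)) P.2
  have hD : ContDiffAt ℝ 9 D (p, 0) := contDiffAt_fderiv_slice hE (by norm_num)
  -- the end point of the geodesic with initial velocity the image of `v` under `D (x, h)`
  let Q : E × (E × E) → E := fun R ↦ Exp (Exp (R.1, R.2.1), D (R.1, R.2.1) R.2.2)
  let J : E × (E × E) → E := fun R ↦ Log (R.1, Q R)
  have hfst : ContDiffAt ℝ 9 (fun R : E × (E × E) ↦ (R.1, R.2.1)) (p, 0) :=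
    contDiffAt_fst.prodMk contDiffAt_snd.fst
  have hEh : ContDiffAt ℝ 9 (fun R : E × (E × E) ↦ Exp (R.1, R.2.1)) (p, 0) :=
    ContDiffAt.comp (g := Exp) (f := fun R : E × (E × E) ↦ (R.1, R.2.1)) (p, 0)
      (hE.of_le (by norm_num)) hfst
  have hDv : ContDiffAt ℝ 9 (fun R : E × (E × E) ↦ D (R.1, R.2.1) R.2.2) (p, 0) :=
    (ContDiffAt.comp (g := D) (f := fun R : E × (E × E) ↦ (R.1, R.2.1)) (p, 0) hD
        hfst).clm_apply contDiffAt_snd.snd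
  have hin : ContDiffAt ℝ 9
      (fun R : E × (E × E) ↦ (Exp (R.1, R.2.1), D (R.1, R.2.1) R.2.2)) (p, 0) := hEh.prodMk hDv
  have hQ : ContDiffAt ℝ 9 Q (p, 0) :=
    ContDiffAt.comp (g := Exp) _ (by
      change ContDiffAt ℝ 9 Exp (Exp (p, 0), D (p, 0) 0)
      rw [hp0, map_zero]
      exact hE.of_le (by norm_num)) hin
  have hQ0 : Q (p, 0) = p := by simp [Q, hp0]
  have hRQ : ContDiffAt ℝ 9 (fun R : E × (E × E) ↦ (R.1, Q R)) (p, 0) := contDiffAt_fst.prodMk hQ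
  have hJ : ContDiffAt ℝ 9 J (p, 0) :=
    ContDiffAt.comp (g := Log) _ (by
      change ContDiffAt ℝ 9 Log (p, Q (p, 0))
      rw [hQ0]
      exact hL.of_le (by norm_num)) hRQ
  have hPE : ContinuousAt (fun P : E × E ↦ (P.1, Exp P)) (p, 0) :=
    continuousAt_fst.prodMk hE.continuousAt
  -- the derivatives that are to be bounded
  let D1 : E × (E × E) → E × E →L[ℝ] E := fun R ↦ fderiv ℝ (fun z ↦ J (R.1, z)) R.2
  have hD1 : ContDiffAt ℝ 8 D1 (p, 0) := contDiffAt_fderiv_slice hJ (by norm_num)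
  let D2 : E × (E × E) → _ := fun R ↦ fderiv ℝ (fun z ↦ D1 (R.1, z)) R.2
  have hD2 : ContDiffAt ℝ 7 D2 (p, 0) := contDiffAt_fderiv_slice hD1 (by norm_num)
  let D3 : E × (E × E) → _ := fun R ↦ fderiv ℝ (fun z ↦ D2 (R.1, z)) R.2
  have hD3 : ContDiffAt ℝ 6 D3 (p, 0) := contDiffAt_fderiv_slice hD2 (by norm_num)
  let D4 : E × (E × E) → _ := fun R ↦ fderiv ℝ (fun z ↦ D3 (R.1, z)) R.2
  have hD4 : ContDiffAt ℝ 5 D4 (p, 0) := contDiffAt_fderiv_slice hD3 (by norm_num)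
  let N : E × E → E →L[ℝ] E →L[ℝ] E := fun P ↦ connOfExp (fun z ↦ J (P.1, z)) P.2
  have hN : ContDiffAt ℝ 7 N (p, 0) := by
    refine contDiffAt_clm_apply.2 fun u ↦ contDiffAt_clm_apply.2 fun w ↦ ?_
    simp only [N, connOfExp_apply]
    refine (((ContDiffAt.comp (g := D2) (f := fun P : E × E ↦ (P.1, (P.2, (0 : E)))) (p, 0) hD2
      (contDiffAt_fst.prodMk (contDiffAt_snd.prodMk contDiffAt_const))).clm_apply
      contDiffAt_const).clm_apply contDiffAt_const).neg
  let N1 : E × E → _ := fun P ↦ fderiv ℝ (fun h ↦ N (P.1, h)) P.2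
  have hN1 : ContDiffAt ℝ 6 N1 (p, 0) := contDiffAt_fderiv_slice hN (by norm_num)
  let N2 : E × E → _ := fun P ↦ fderiv ℝ (fun h ↦ N1 (P.1, h)) P.2
  have hN2 : ContDiffAt ℝ 5 N2 (p, 0) := contDiffAt_fderiv_slice hN1 (by norm_num)
  let B : ℝ := 1 + (‖D4 (p, 0)‖ + ‖N1 (p, 0)‖ + ‖N2 (p, 0)‖)
  have hB : 1 ≤ B := by
    simp only [B]
    linarith [norm_nonneg (D4 (p, 0)), norm_nonneg (N1 (p, 0)), norm_nonneg (N2 (p, 0))]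
  have b4 : ∀ᶠ R in 𝓝 (p, (0 : E × E)), ‖D4 R‖ < B :=
    hD4.eventually_norm_lt (by
      simp only [B]; linarith [norm_nonneg (N1 (p, 0)), norm_nonneg (N2 (p, 0))])
  have bN1 : ∀ᶠ P in 𝓝 (p, (0 : E)), ‖N1 P‖ < B :=
    hN1.eventually_norm_lt (by
      simp only [B]; linarith [norm_nonneg (D4 (p, 0)), norm_nonneg (N2 (p, 0))])
  have bN2 : ∀ᶠ P in 𝓝 (p, (0 : E)), ‖N2 P‖ < B :=
    hN2.eventually_norm_lt (by
      simp only [B]; linarith [norm_nonneg (D4 (p, 0)), norm_nonneg (N1 (p, 0))])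
  have evP : ∀ᶠ P in 𝓝 (p, (0 : E)), ContDiffAt ℝ 10 Exp P ∧ ContDiffAt ℝ 10 Log (P.1, Exp P) ∧
      Log (P.1, Exp P) = P.2 ∧ (∀ᶠ T in 𝓝 (P.1, Exp P), Exp (T.1, Log T) = T.2) ∧ Exp P ∈ U ∧
      IsExpAt Γ (fun v ↦ Exp (Exp P, v)) (Exp P) ρ ∧ ‖N1 P‖ < B ∧ ‖N2 P‖ < B :=
    have t1 : Tendsto Exp (𝓝 (p, 0)) (𝓝 p) := by
      have := hE.continuousAt.tendsto
      rwa [hp0] at this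
    have t2 : Tendsto (fun P : E × E ↦ (P.1, Exp P)) (𝓝 (p, 0)) (𝓝 (p, p)) := by
      have := hPE.tendsto
      simp only [hp0] at this
      exact this
    (hE.eventually (by simp)).and <| (t2.eventually (hL.eventually (by simp))).and <| hle.and <|
      (t2.eventually (eventually_eventually_nhds.2 hel)).and <| (t1.eventually hU).and <|
      (t1.eventually hexp).and <| bN1.and bN2
  have evR : ∀ᶠ R in 𝓝 (p, (0 : E × E)), ContDiffAt ℝ 9 J R ∧
      (∀ᶠ T in 𝓝 R, Exp (T.1, J T) = Q T) ∧ ‖D4 R‖ < B := by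
    have t2 : Tendsto (fun R : E × (E × E) ↦ (R.1, Q R)) (𝓝 (p, 0)) (𝓝 (p, p)) := by
      have := hRQ.continuousAt.tendsto
      simp only [hQ0] at this
      exact this
    exact (hJ.eventually (by simp)).and <|
      (eventually_eventually_nhds.2 (t2.eventually hel)).and b4
  obtain ⟨r₁, hr₁, h₁⟩ := Metric.eventually_nhds_iff_ball.1 evP
  obtain ⟨r₂, hr₂, h₂⟩ := Metric.eventually_nhds_iff_ball.1 evR
  obtain ⟨r₃, hr₃, h₃⟩ := Metric.eventually_nhds_iff_ball.1 hexp
  let r := min (min r₁ r₂) (min r₃ ρ)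
  have hr : 0 < r := lt_min (lt_min hr₁ hr₂) (lt_min hr₃ hpe.pos)
  have rP : ∀ x v : E, ‖x - p‖ < r → ‖v‖ < r → (x, v) ∈ Metric.ball (p, (0 : E)) r₁ := by
    intro x v hx hv
    have := (min_le_left (min r₁ r₂) (min r₃ ρ)).trans (min_le_left _ _)
    simp [dist_eq_norm, hx.trans_le this, hv.trans_le this]
  have rR : ∀ (x : E) (z : E × E), ‖x - p‖ < r → ‖z‖ < r →
      (x, z) ∈ Metric.ball (p, (0 : E × E)) r₂ := by
    intro x v hx hv
    have := (min_le_left (min r₁ r₂) (min r₃ ρ)).trans (min_le_right _ _)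
    rw [Metric.mem_ball, Prod.dist_eq, dist_eq_norm, dist_zero_right]
    exact max_lt (hx.trans_le this) (hv.trans_le this)
  have rX : ∀ x : E, ‖x - p‖ < r → IsExpAt Γ (fun v ↦ Exp (x, v)) x ρ := fun x hx ↦ h₃ x <| by
    rw [mem_ball_iff_norm]
    exact hx.trans_le ((min_le_right (min r₁ r₂) (min r₃ ρ)).trans (min_le_left _ _))
  have hrρ : r ≤ ρ := (min_le_right (min r₁ r₂) (min r₃ ρ)).trans (min_le_right _ _)
  have zero_lt : ‖(0 : E)‖ < r := by simpa using hr
  -- the differential of the exponential map is injective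
  have hinj : ∀ x h : E, ‖x - p‖ < r → ‖h‖ < r →
      Function.Injective (fderiv ℝ (fun v ↦ Exp (x, v)) h) := by
    intro x h hx hh
    obtain ⟨c1, c2, -, -, -⟩ := h₁ _ (rP x h hx hh)
    have f1 := ((contDiffAt_slice c1).differentiableAt (by simp)).hasFDerivAt
    have f2 := ((contDiffAt_slice c2).differentiableAt (by simp)).hasFDerivAt
    have ev : ∀ᶠ v in 𝓝 h, Log (x, Exp (x, v)) = v := by
      filter_upwards [(isOpen_lt continuous_norm continuous_const).mem_nhds hh] with v hv
      exact (h₁ _ (rP x v hx hv)).2.2.1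
    have e := (HasFDerivAt.comp (g := fun q ↦ Log (x, q)) h f2 f1).unique
      ((hasFDerivAt_id h).congr_of_eventuallyEq (ev.mono fun v hv ↦ hv))
    exact Function.LeftInverse.injective (g := fderiv ℝ (fun q ↦ Log (x, q)) (Exp (x, h)))
      fun u ↦ DFunLike.congr_fun e u
  have hJ0 : ∀ x h : E, ‖x - p‖ < r → ‖h‖ < r → J (x, (h, 0)) = h := by
    intro x h hx hh
    obtain ⟨-, -, c3, -, -, c6, -⟩ := h₁ _ (rP x h hx hh)
    have := c6.apply_zero
    simp only [J, Q, map_zero, this, c3]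
  have hint : ∀ x h : E, ‖x - p‖ < r → ‖h‖ < r → ∀ᶠ v in 𝓝 (0 : E),
      Exp (x, J (x, (h, v))) = Exp (Exp (x, h), fderiv ℝ (fun v ↦ Exp (x, v)) h v) := by
    intro x h hx hh
    have hz : ‖(h, (0 : E))‖ < r := by simp [Prod.norm_def, hh]
    exact Tendsto.eventually (Continuous.tendsto (f := fun v : E ↦ (x, (h, v))) (by fun_prop) 0)
      (h₂ _ (rR x (h, 0) hx hz)).2.1
  have hJs : ∀ (x : E) (z : E × E), ‖x - p‖ < r → ‖z‖ < r →
      ContDiffAt ℝ 9 (fun z ↦ J (x, z)) z := fun x z hx hz ↦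
    contDiffAt_slice (h₂ _ (rR x z hx hz)).1
  have hJs0 : ∀ x h : E, ‖x - p‖ < r → ‖h‖ < r →
      ContDiffAt ℝ 3 (fun z ↦ J (x, z)) (h, 0) := fun x h hx hh ↦
    (hJs x (h, 0) hx (by simp [Prod.norm_def, hh])).of_le (by norm_num)
  have hEs : ∀ x h : E, ‖x - p‖ < r → ‖h‖ < r →
      ContDiffAt ℝ 3 (fun v ↦ Exp (x, v)) h := fun x h hx hh ↦
    (contDiffAt_slice (h₁ _ (rP x h hx hh)).1).of_le (by norm_num)
  have hcm : ∀ x h : E, ‖x - p‖ < r → ‖h‖ < r →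
      IsConnectionMap (fun v ↦ Exp (x, v)) (connOfExp fun z ↦ J (x, z)) Γ h := fun x h hx hh ↦
    isConnectionMap_of_intertwine (h₁ _ (rP x h hx hh)).2.2.2.2.2.1 (hs _) (hEs x h hx hh)
      (hJs0 x h hx hh) (hJ0 x h hx hh) (hinj x h hx hh) (hint x h hx hh)
  refine ⟨r, B, fun x v ↦ Exp (x, v), fun x q ↦ Log (x, q), ⟨hr, ?_, ?_, ?_, ?_, ?_, ?_, ?_,
    fun x hx h hh ↦ hcm x h hx hh⟩⟩
  · exact fun x hx ↦ ⟨hr, fun v hv ↦ (rX x hx).contDiffAt v (hv.trans_le hrρ),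
      fun v hv ↦ (rX x hx).isGeodesic v (hv.trans_le hrρ)⟩
  · exact fun x hx v hv ↦ (h₁ _ (rP x v hx hv)).2.2.2.2.1
  · exact fun x hx v hv ↦ (h₁ _ (rP x v hx hv)).1.of_le (by norm_num)
  · exact fun x hx v hv ↦ (contDiffAt_slice (h₁ _ (rP x v hx hv)).2.1).of_le (by norm_num)
  · exact fun x hx v hv ↦ (h₁ _ (rP x v hx hv)).2.2.1
  · exact fun x hx v hv ↦ Tendsto.eventually
      (Continuous.tendsto (f := fun q : E ↦ (x, q)) (by fun_prop) _) (h₁ _ (rP x v hx hv)).2.2.2.1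
  intro x hx
  have hconn : ContDiffAt ℝ 2 (connOfExp fun z ↦ J (x, z)) 0 := by
    refine contDiffAt_clm_apply.2 fun u ↦ contDiffAt_clm_apply.2 fun w ↦ ?_
    simp only [connOfExp_apply]
    have h2 := ((hJs x 0 hx (by simpa using hr)).fderiv_right (m := 8) (by norm_num)).fderiv_right
      (m := 2) (by norm_num)
    exact (((ContDiffAt.comp (f := fun h : E ↦ (h, (0 : E))) (0 : E) h2
      (contDiffAt_id.prodMk contDiffAt_const)).clm_apply
      contDiffAt_const).clm_apply contDiffAt_const).neg
  have hsymm : ∀ u v, connOfExp (fun z ↦ J (x, z)) 0 u v = connOfExp (fun z ↦ J (x, z)) 0 v u := by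
    intro u v
    rw [connOfExp_apply, connOfExp_apply, fderiv_fderiv_symm
      ((hJs x (0, 0) hx (by simpa using hr)).of_le (by norm_num))]
  obtain ⟨n0, n1⟩ := conn_zero_of_ray (hconn.differentiableAt (by simp)) hsymm (by
    filter_upwards [(isOpen_lt continuous_norm continuous_const).mem_nhds zero_lt] with v hv
    exact conn_ray_eq_zero (rX x hx) (hv.trans_le hrρ) (hinj x v hx hv) (hcm x v hx hv))
  have hxP := h₁ _ (rP x 0 hx zero_lt)
  refine ⟨hr, hB, fun z hz ↦ (hJs x z hx hz).of_le (by norm_num), fun h hh ↦ hJ0 x h hx hh, ?_, ?_,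
    ?_, hconn, n0, n1, fun z hz ↦ (h₂ _ (rR x z hx hz)).2.2.le, hxP.2.2.2.2.2.2.1.le,
    hxP.2.2.2.2.2.2.2.le⟩
  · intro v hv
    have e1 := (rX x hx).fderiv_zero
    have e2 := (rX x hx).apply_zero
    simp only [normalExp, e1, e2, ContinuousLinearMap.id_apply]
    exact (h₁ _ (rP x v hx hv)).2.2.1
  · exact fun h hh w ↦ fderiv_snd_of_intertwine (h₁ _ (rP x h hx hh)).2.2.2.2.2.1 (hEs x h hx hh)
      (hJs0 x h hx hh) (hJ0 x h hx hh) (hinj x h hx hh) (hint x h hx hh) w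
  · exact fun h hh u w ↦ by rw [connOfExp_apply, neg_neg]

end

end Coordinates

/-! ### Tangent vectors in charts -/

section Charts

variable {E : Type*} [NormedAddCommGroup E] [NormedSpace ℝ E]
  {M : Type*} [TopologicalSpace M] [ChartedSpace E M]

/-- The transition map from the chart centred at `p` to the chart centred at `q`. -/
noncomputable def transition (E : Type*) [NormedAddCommGroup E] [NormedSpace ℝ E] {M : Type*}
    [TopologicalSpace M] [ChartedSpace E M] (p q : M) (z : E) : E :=
  extChartAt 𝓘(ℝ, E) q ((extChartAt 𝓘(ℝ, E) p).symm z)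

/-- The differential at `x` of the chart centred at `p`, as a map of the model space. -/
noncomputable def chartDeriv (E : Type*) [NormedAddCommGroup E] [NormedSpace ℝ E] {M : Type*}
    [TopologicalSpace M] [ChartedSpace E M] (p x : M) : E →L[ℝ] E :=
  fderiv ℝ (transition E x p) (extChartAt 𝓘(ℝ, E) x x)

variable [IsManifold 𝓘(ℝ, E) ∞ M]

lemma contDiffAt_transition {p q : M} {z : E} (hz : z ∈ (extChartAt 𝓘(ℝ, E) p).target)
    (hq : (extChartAt 𝓘(ℝ, E) p).symm z ∈ (extChartAt 𝓘(ℝ, E) q).source) :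
    ContDiffAt ℝ ∞ (transition E p q) z := by
  have := contDiffWithinAt_ext_coord_change (I := 𝓘(ℝ, E)) (n := ∞) q p (y := z) ⟨hz, hq⟩
  rw [ModelWithCorners.range_eq_univ, contDiffWithinAt_univ] at this
  exact this

omit [TopologicalSpace M] [ChartedSpace E M] [IsManifold 𝓘(ℝ, E) ∞ M] in
lemma fderivWithin_range_modelSpace (f : E → E) (z : E) :
    fderivWithin ℝ f (range 𝓘(ℝ, E)) z = fderiv ℝ f z := by
  rw [ModelWithCorners.range_eq_univ, fderivWithin_univ]

lemma mfderiv_extChartAt_apply {p x : M} (hx : x ∈ (extChartAt 𝓘(ℝ, E) p).source)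
    (v : TangentSpace 𝓘(ℝ, E) x) :
    mfderiv 𝓘(ℝ, E) 𝓘(ℝ, E) (extChartAt 𝓘(ℝ, E) p) x v = chartDeriv E p x v := by
  have h : MDifferentiableAt 𝓘(ℝ, E) 𝓘(ℝ, E) (extChartAt 𝓘(ℝ, E) p) x :=
    mdifferentiableAt_extChartAt (by rwa [extChartAt_source] at hx)
  exact DFunLike.congr_fun (h.mfderiv.trans (fderivWithin_range_modelSpace _ _)) v

lemma mfderiv_extChartAt_symm_apply {p : M} {z : E} (hz : z ∈ (extChartAt 𝓘(ℝ, E) p).target)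
    (v : E) : mfderiv 𝓘(ℝ, E) 𝓘(ℝ, E) (extChartAt 𝓘(ℝ, E) p).symm z v =
      fderiv ℝ (transition E p ((extChartAt 𝓘(ℝ, E) p).symm z)) z v := by
  have h : MDifferentiableAt 𝓘(ℝ, E) 𝓘(ℝ, E) (extChartAt 𝓘(ℝ, E) p).symm z := by
    have := mdifferentiableWithinAt_extChartAt_symm (I := 𝓘(ℝ, E)) hz
    rwa [ModelWithCorners.range_eq_univ, mdifferentiableWithinAt_univ] at this
  exact DFunLike.congr_fun (h.mfderiv.trans (fderivWithin_range_modelSpace _ _)) v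

omit [IsManifold 𝓘(ℝ, E) ∞ M] in
lemma transition_transition {p q r : M} {z : E}
    (hq : (extChartAt 𝓘(ℝ, E) p).symm z ∈ (extChartAt 𝓘(ℝ, E) q).source) :
    transition E q r (transition E p q z) = transition E p r z := by
  simp only [transition]
  rw [(extChartAt 𝓘(ℝ, E) q).left_inv hq]

omit [IsManifold 𝓘(ℝ, E) ∞ M] in
lemma eventually_mem_source {p q : M} {z : E} (hz : z ∈ (extChartAt 𝓘(ℝ, E) p).target)
    (hq : (extChartAt 𝓘(ℝ, E) p).symm z ∈ (extChartAt 𝓘(ℝ, E) q).source) :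
    ∀ᶠ z' in 𝓝 z, z' ∈ (extChartAt 𝓘(ℝ, E) p).target ∧
      (extChartAt 𝓘(ℝ, E) p).symm z' ∈ (extChartAt 𝓘(ℝ, E) q).source :=
  Eventually.and ((isOpen_extChartAt_target p).mem_nhds hz) <|
    (continuousAt_extChartAt_symm'' hz).eventually
      ((isOpen_extChartAt_source q).mem_nhds hq)

lemma fderiv_transition_comp {p q r : M} {z : E} (hz : z ∈ (extChartAt 𝓘(ℝ, E) p).target)
    (hq : (extChartAt 𝓘(ℝ, E) p).symm z ∈ (extChartAt 𝓘(ℝ, E) q).source)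
    (hr : (extChartAt 𝓘(ℝ, E) p).symm z ∈ (extChartAt 𝓘(ℝ, E) r).source) (v : E) :
    fderiv ℝ (transition E q r) (transition E p q z) (fderiv ℝ (transition E p q) z v) =
      fderiv ℝ (transition E p r) z v := by
  have hq' : transition E p q z ∈ (extChartAt 𝓘(ℝ, E) q).target :=
    (extChartAt 𝓘(ℝ, E) q).map_source hq
  have hr' : (extChartAt 𝓘(ℝ, E) q).symm (transition E p q z) ∈ (extChartAt 𝓘(ℝ, E) r).source := by
    rwa [transition, (extChartAt 𝓘(ℝ, E) q).left_inv hq]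
  have d1 := ((contDiffAt_transition hz hq).differentiableAt (by simp)).hasFDerivAt
  have d2 := ((contDiffAt_transition hq' hr').differentiableAt (by simp)).hasFDerivAt
  have d3 := ((contDiffAt_transition hz hr).differentiableAt (by simp)).hasFDerivAt
  have e : (transition E q r) ∘ (transition E p q) =ᶠ[𝓝 z] transition E p r :=
    (eventually_mem_source hz hq).mono fun z' hz' ↦ transition_transition hz'.2
  exact DFunLike.congr_fun ((d2.comp z d1).unique (d3.congr_of_eventuallyEq e)) v

omit [IsManifold 𝓘(ℝ, E) ∞ M] in
lemma fderiv_transition_self {p : M} {z : E} (hz : z ∈ (extChartAt 𝓘(ℝ, E) p).target) (v : E) :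
    fderiv ℝ (transition E p p) z v = v := by
  have e : transition E p p =ᶠ[𝓝 z] id := by
    filter_upwards [(isOpen_extChartAt_target p).mem_nhds hz] with z' hz'
    exact (extChartAt 𝓘(ℝ, E) p).right_inv hz'
  rw [e.fderiv_eq, fderiv_id, ContinuousLinearMap.id_apply]

omit [IsManifold 𝓘(ℝ, E) ∞ M] in
lemma chartDeriv_self (x : M) (v : E) : chartDeriv E x x v = v :=
  fderiv_transition_self (mem_extChartAt_target x) v

/-- The differentials of two charts at the same point differ by the differential of the transition
map. -/
lemma fderiv_transition_chartDeriv {p q x : M} (hp : x ∈ (extChartAt 𝓘(ℝ, E) p).source)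
    (hq : x ∈ (extChartAt 𝓘(ℝ, E) q).source) (v : E) :
    fderiv ℝ (transition E p q) (extChartAt 𝓘(ℝ, E) p x) (chartDeriv E p x v) =
      chartDeriv E q x v := by
  have h := fderiv_transition_comp (p := x) (q := p) (r := q) (z := extChartAt 𝓘(ℝ, E) x x)
    (mem_extChartAt_target x) (by rwa [extChartAt_to_inv]) (by rwa [extChartAt_to_inv]) v
  rwa [transition, extChartAt_to_inv] at h

lemma isInvertible_fderiv_transition {p q : M} {z : E}
    (hz : z ∈ (extChartAt 𝓘(ℝ, E) p).target)
    (hq : (extChartAt 𝓘(ℝ, E) p).symm z ∈ (extChartAt 𝓘(ℝ, E) q).source) :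
    (fderiv ℝ (transition E p q) z).IsInvertible := by
  have hp : (extChartAt 𝓘(ℝ, E) p).symm z ∈ (extChartAt 𝓘(ℝ, E) p).source :=
    (extChartAt 𝓘(ℝ, E) p).map_target hz
  have hq' : transition E p q z ∈ (extChartAt 𝓘(ℝ, E) q).target :=
    (extChartAt 𝓘(ℝ, E) q).map_source hq
  have hs : (extChartAt 𝓘(ℝ, E) q).symm (transition E p q z) = (extChartAt 𝓘(ℝ, E) p).symm z :=
    (extChartAt 𝓘(ℝ, E) q).left_inv hq
  have ht : transition E q p (transition E p q z) = z := by
    rw [transition, hs, (extChartAt 𝓘(ℝ, E) p).right_inv hz]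
  refine ContinuousLinearMap.IsInvertible.of_inverse
    (g := fderiv ℝ (transition E q p) (transition E p q z)) ?_ ?_
  · refine ContinuousLinearMap.ext fun v ↦ ?_
    have h := fderiv_transition_comp (r := q) hq' (by rwa [hs]) (by rwa [hs]) v
    rw [ht, fderiv_transition_self hq'] at h
    exact h
  · refine ContinuousLinearMap.ext fun v ↦ ?_
    exact (fderiv_transition_comp hz hq hp v).trans (fderiv_transition_self hz v)

lemma trivializationAt_snd {p : M} (P : TangentBundle 𝓘(ℝ, E) M) :
    (trivializationAt E (TangentSpace 𝓘(ℝ, E)) p P).2 = chartDeriv E p P.1 P.2 := by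
  rw [TangentBundle.trivializationAt_apply, ModelWithCorners.range_eq_univ, fderivWithin_univ]
  rfl

/-- The differential of the chart centred at `p`, as an isomorphism from the tangent space at `x` to
the model space. -/
noncomputable def chartEquiv (E : Type*) [NormedAddCommGroup E] [NormedSpace ℝ E] {M : Type*}
    [TopologicalSpace M] [ChartedSpace E M] [IsManifold 𝓘(ℝ, E) ∞ M] (p x : M)
    (hx : x ∈ (extChartAt 𝓘(ℝ, E) p).source) : TangentSpace 𝓘(ℝ, E) x ≃L[ℝ] E :=
  (trivializationAt E (TangentSpace 𝓘(ℝ, E)) p).continuousLinearEquivAt ℝ x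
    (by rwa [extChartAt_source] at hx)

lemma chartEquiv_apply {p x : M} (hx : x ∈ (extChartAt 𝓘(ℝ, E) p).source)
    (v : TangentSpace 𝓘(ℝ, E) x) : chartEquiv E p x hx v = chartDeriv E p x v :=
  trivializationAt_snd ⟨x, v⟩

end Charts

/-! ### The metric and the Levi-Civita connection in charts -/

section Metric

variable {E : Type*} [NormedAddCommGroup E] [NormedSpace ℝ E]
  {M : Type*} [TopologicalSpace M] [ChartedSpace E M]
  [RiemannianBundle (fun x : M ↦ TangentSpace 𝓘(ℝ, E) x)]

/-- The inner product of the tangent space at `x`, as a function on the model space. -/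
noncomputable def tangentInner (x : M) (u v : E) : ℝ :=
  inner ℝ (E := TangentSpace 𝓘(ℝ, E) x) u v

variable [IsManifold 𝓘(ℝ, E) ∞ M]

lemma metricCoord_apply {p : M} {z : E} (hz : z ∈ (extChartAt 𝓘(ℝ, E) p).target) (u v : E) :
    metricCoord p z u v = tangentInner ((extChartAt 𝓘(ℝ, E) p).symm z)
      (fderiv ℝ (transition E p ((extChartAt 𝓘(ℝ, E) p).symm z)) z u)
      (fderiv ℝ (transition E p ((extChartAt 𝓘(ℝ, E) p).symm z)) z v) := by
  rw [← mfderiv_extChartAt_symm_apply hz, ← mfderiv_extChartAt_symm_apply hz]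
  rfl

/-- Transition maps are isometries. -/
lemma metricCoord_transition {p q : M} {z : E} (hz : z ∈ (extChartAt 𝓘(ℝ, E) p).target)
    (hq : (extChartAt 𝓘(ℝ, E) p).symm z ∈ (extChartAt 𝓘(ℝ, E) q).source) (u v : E) :
    metricCoord p z u v = metricCoord q (transition E p q z)
      (fderiv ℝ (transition E p q) z u) (fderiv ℝ (transition E p q) z v) := by
  have hq' : transition E p q z ∈ (extChartAt 𝓘(ℝ, E) q).target :=
    (extChartAt 𝓘(ℝ, E) q).map_source hq
  have hs : (extChartAt 𝓘(ℝ, E) q).symm (transition E p q z) = (extChartAt 𝓘(ℝ, E) p).symm z :=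
    (extChartAt 𝓘(ℝ, E) q).left_inv hq
  rw [metricCoord_apply hz, metricCoord_apply hq', hs,
    fderiv_transition_comp hz hq (mem_extChartAt_source _),
    fderiv_transition_comp hz hq (mem_extChartAt_source _)]

omit [IsManifold 𝓘(ℝ, E) ∞ M] in
lemma metricCoord_symm (p : M) (z u v : E) : metricCoord p z u v = metricCoord p z v u := by
  let A (w : E) : TangentSpace 𝓘(ℝ, E) ((extChartAt 𝓘(ℝ, E) p).symm z) :=
    mfderiv 𝓘(ℝ, E) 𝓘(ℝ, E) (extChartAt 𝓘(ℝ, E) p).symm z w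
  have h : ∀ u v, metricCoord p z u v = inner ℝ (A u) (A v) := fun _ _ ↦ rfl
  rw [h, h, real_inner_comm]

lemma metricCoord_pos {p : M} {z : E} (hz : z ∈ (extChartAt 𝓘(ℝ, E) p).target) {u : E}
    (hu : u ≠ 0) : 0 < metricCoord p z u u := by
  rw [metricCoord_apply hz]
  have : fderiv ℝ (transition E p ((extChartAt 𝓘(ℝ, E) p).symm z)) z u ≠ 0 := by
    obtain ⟨A, hA⟩ := isInvertible_fderiv_transition hz (mem_extChartAt_source _)
    rw [← hA]
    simpa using hu
  exact real_inner_self_pos.2 this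

lemma isInvertible_metricCoord [FiniteDimensional ℝ E] {p : M} {z : E}
    (hz : z ∈ (extChartAt 𝓘(ℝ, E) p).target) : (metricCoord p z).IsInvertible := by
  have hinj : Function.Injective (metricCoord p z : E →ₗ[ℝ] (E →L[ℝ] ℝ)) := by
    refine (injective_iff_map_eq_zero _).2 fun u hu ↦ ?_
    by_contra h
    have := metricCoord_pos hz h
    rw [show metricCoord p z u = 0 from hu] at this
    exact lt_irrefl _ this
  have hfin : Module.finrank ℝ E = Module.finrank ℝ (E →L[ℝ] ℝ) := by
    rw [← (LinearMap.toContinuousLinearMap (𝕜 := ℝ) (E := E) (F' := ℝ)).finrank_eq]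
    exact Subspace.dual_finrank_eq.symm
  exact ⟨(LinearEquiv.ofInjectiveOfFinrankEq _ hinj hfin).toContinuousLinearEquiv, by
    ext; rfl⟩

variable [IsContMDiffRiemannianBundle 𝓘(ℝ, E) ∞ E (fun x : M ↦ TangentSpace 𝓘(ℝ, E) x)]

lemma contDiffOn_metricCoord [FiniteDimensional ℝ E] (p : M) :
    ContDiffOn ℝ ∞ (metricCoord p) (extChartAt 𝓘(ℝ, E) p).target := by
  refine contDiffOn_clm_apply.2 fun u ↦ contDiffOn_clm_apply.2 fun v ↦ ?_
  have hsec : ∀ w : E, ContMDiffOn 𝓘(ℝ, E) 𝓘(ℝ, E).tangent ∞ (fun z ↦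
      (⟨(extChartAt 𝓘(ℝ, E) p).symm z,
        fderiv ℝ (transition E p ((extChartAt 𝓘(ℝ, E) p).symm z)) z w⟩ :
        TangentBundle 𝓘(ℝ, E) M)) (extChartAt 𝓘(ℝ, E) p).target := by
    intro w
    refine (Trivialization.contMDiffOn_iff
      (e := trivializationAt E (TangentSpace 𝓘(ℝ, E)) p) ?_).2 ⟨contMDiffOn_extChartAt_symm p, ?_⟩
    · intro z hz
      have := (extChartAt 𝓘(ℝ, E) p).map_target hz
      rwa [extChartAt_source] at this
    · refine (contMDiffOn_const (c := w)).congr fun z hz ↦ ?_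
      rw [trivializationAt_snd]
      have h1 := (extChartAt 𝓘(ℝ, E) p).map_target hz
      have h2 := fderiv_transition_comp hz (mem_extChartAt_source _) h1 w
      rw [fderiv_transition_self hz] at h2
      exact h2
  have h := ContMDiffOn.inner_bundle (F := E) (E := fun x : M ↦ TangentSpace 𝓘(ℝ, E) x)
    (b := fun z ↦ (extChartAt 𝓘(ℝ, E) p).symm z)
    (v := fun z ↦ fderiv ℝ (transition E p ((extChartAt 𝓘(ℝ, E) p).symm z)) z u)
    (w := fun z ↦ fderiv ℝ (transition E p ((extChartAt 𝓘(ℝ, E) p).symm z)) z v) (hsec u) (hsec v)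
  exact (contMDiffOn_iff_contDiffOn.1 h).congr fun z hz ↦ metricCoord_apply hz u v

variable [FiniteDimensional ℝ E]

/-- The local connector of the Levi-Civita connection in the chart centred at `p`. -/
noncomputable def connCoord (p : M) : E → E →L[ℝ] E →L[ℝ] E := leviCivita (metricCoord p)

lemma contDiffAt_metricCoord {p : M} {z : E} (hz : z ∈ (extChartAt 𝓘(ℝ, E) p).target) :
    ContDiffAt ℝ ∞ (metricCoord p) z :=
  (contDiffOn_metricCoord p).contDiffAt ((isOpen_extChartAt_target p).mem_nhds hz)

lemma contDiffAt_connCoord {p : M} {z : E} (hz : z ∈ (extChartAt 𝓘(ℝ, E) p).target) :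
    ContDiffAt ℝ ∞ (connCoord p) z := by
  have : CompleteSpace E := FiniteDimensional.complete ℝ E
  exact contDiffAt_leviCivita (contDiffAt_metricCoord hz) (isInvertible_metricCoord hz)

lemma connCoord_symm {p : M} {z : E} (hz : z ∈ (extChartAt 𝓘(ℝ, E) p).target) (u v : E) :
    connCoord p z u v = connCoord p z v u :=
  leviCivita_symm ((contDiffAt_metricCoord hz).differentiableAt (by simp))
    (Eventually.of_forall fun z' ↦ metricCoord_symm p z') u v

lemma isConnectionMap_transition {p q : M} {z : E} (hz : z ∈ (extChartAt 𝓘(ℝ, E) p).target)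
    (hq : (extChartAt 𝓘(ℝ, E) p).symm z ∈ (extChartAt 𝓘(ℝ, E) q).source) :
    IsConnectionMap (transition E p q) (connCoord p) (connCoord q) z := by
  have hq' : transition E p q z ∈ (extChartAt 𝓘(ℝ, E) q).target :=
    (extChartAt 𝓘(ℝ, E) q).map_source hq
  exact isConnectionMap_leviCivita ((contDiffAt_transition hz hq).of_le (by norm_cast))
    (isInvertible_fderiv_transition hz hq)
    ((eventually_mem_source hz hq).mono fun z' hz' ↦ metricCoord_transition hz'.1 hz'.2)
    ((contDiffAt_metricCoord hz).differentiableAt (by simp))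
    ((contDiffAt_metricCoord hq').differentiableAt (by simp)) (isInvertible_metricCoord hz)
    (isInvertible_metricCoord hq') (metricCoord_symm q _)

/-- The curvature tensor at `x` in the chart centred at `p`. -/
lemma chartDeriv_curvature {p x : M} (hx : x ∈ (extChartAt 𝓘(ℝ, E) p).source)
    (u v w : TangentSpace 𝓘(ℝ, E) x) :
    chartDeriv E p x (curvature x u v w) = curvatureCoord (connCoord p) (extChartAt 𝓘(ℝ, E) p x)
      (chartDeriv E p x u) (chartDeriv E p x v) (chartDeriv E p x w) := by
  have hz := mem_extChartAt_target (I := 𝓘(ℝ, E)) x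
  have hq : (extChartAt 𝓘(ℝ, E) x).symm (extChartAt 𝓘(ℝ, E) x x) ∈
      (extChartAt 𝓘(ℝ, E) p).source := by rwa [extChartAt_to_inv]
  have ht : transition E x p (extChartAt 𝓘(ℝ, E) x x) = extChartAt 𝓘(ℝ, E) p x := by
    rw [transition, extChartAt_to_inv]
  have h := fderiv_curvatureCoord (φ := transition E x p) (Γ₁ := connCoord x) (Γ₂ := connCoord p)
    (z := extChartAt 𝓘(ℝ, E) x x)
    ((eventually_mem_source hz hq).mono fun z' hz' ↦ isConnectionMap_transition hz'.1 hz'.2)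
    ((contDiffAt_transition hz hq).of_le (by norm_cast))
    ((contDiffAt_connCoord hz).differentiableAt (by simp))
    ((contDiffAt_connCoord (p := p) (by
      rw [ht]; exact (extChartAt 𝓘(ℝ, E) p).map_source hx)).differentiableAt
      (by simp)) u v w
  rw [ht] at h
  have hd : ∀ a b, HasFDerivAt (fun z' ↦ christoffel x z' a b)
      (((fderiv ℝ (connCoord x) (extChartAt 𝓘(ℝ, E) x x)).flip a).flip b)
      (extChartAt 𝓘(ℝ, E) x x) := fun a b ↦
    (((contDiffAt_connCoord hz).differentiableAt
      (by simp)).hasFDerivAt.clm_apply_const a).clm_apply_const b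
  have e : curvature x u v w = curvatureCoord (connCoord x) (extChartAt 𝓘(ℝ, E) x x) u v w := by
    simp only [curvature]
    rw [(hd w u).fderiv, (hd w v).fderiv]
    rfl
  rw [e]
  exact h

end Metric

/-! ### Covariant derivatives along a curve in charts -/

section Curves

variable {E : Type*} [NormedAddCommGroup E] [NormedSpace ℝ E]
  {M : Type*} [TopologicalSpace M] [ChartedSpace E M]

/-- The coordinates of the curve `y` in the chart centred at `p`. -/
noncomputable def curveCoord (E : Type*) [NormedAddCommGroup E] [NormedSpace ℝ E] {M : Type*}
    [TopologicalSpace M] [ChartedSpace E M] (p : M) (y : ℝ → M) (t : ℝ) : E :=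
  extChartAt 𝓘(ℝ, E) p (y t)

/-- The coordinates of the vector field `V` along the curve `y` in the chart centred at `p`. -/
noncomputable def fieldCoord (p : M) (y : ℝ → M) (V : ∀ t, TangentSpace 𝓘(ℝ, E) (y t)) (t : ℝ) :
    E :=
  chartDeriv E p (y t) (V t)

lemma fieldCoord_self (y : ℝ → M) (V : ∀ t, TangentSpace 𝓘(ℝ, E) (y t)) (t : ℝ) :
    fieldCoord (y t) y V t = V t :=
  chartDeriv_self _ _

lemma contDiffWithinAt_of_hasDerivWithinAt {f f' : ℝ → E} {s : Set ℝ} {t : ℝ} {k : ℕ}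
    (hs : UniqueDiffOn ℝ s) (ht : t ∈ s) (hf : ContDiffWithinAt ℝ (k + 1) f s t)
    (h : ∀ᶠ t' in 𝓝[s] t, HasDerivWithinAt f (f' t') s t') : ContDiffWithinAt ℝ k f' s t := by
  have h1 : ContDiffWithinAt ℝ k (fun t' ↦ fderivWithin ℝ f s t' (1 : ℝ)) s t :=
    (hf.fderivWithin_right hs le_rfl ht).clm_apply contDiffWithinAt_const
  have e : ∀ t' ∈ s, HasDerivWithinAt f (f' t') s t' → f' t' = fderivWithin ℝ f s t' (1 : ℝ) :=
    fun t' ht' h' ↦ by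
      exact (h'.derivWithin (hs t' ht')).symm
  refine h1.congr_of_eventuallyEq ?_ (e t ht (h.self_of_nhdsWithin ht))
  filter_upwards [h, self_mem_nhdsWithin] with t' h1 h2 using e t' h2 h1

variable [IsManifold 𝓘(ℝ, E) ∞ M] {y : ℝ → M} {p : M} {t : ℝ}

omit [IsManifold 𝓘(ℝ, E) ∞ M] in
lemma eventually_curve_mem_source (hy : ContinuousWithinAt y (Icc 0 1) t)
    (hp : y t ∈ (extChartAt 𝓘(ℝ, E) p).source) :
    ∀ᶠ t' in 𝓝[Icc 0 1] t, y t' ∈ (extChartAt 𝓘(ℝ, E) p).source :=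
  hy.eventually ((isOpen_extChartAt_source p).mem_nhds hp)

omit [IsManifold 𝓘(ℝ, E) ∞ M] in
lemma hasDerivWithinAt_curveCoord_self
    (hy : MDifferentiableWithinAt 𝓘(ℝ, ℝ) 𝓘(ℝ, E) y (Icc 0 1) t) :
    HasDerivWithinAt (curveCoord E (y t) y) (velocity E y t) (Icc 0 1) t := by
  have h := hy.hasMFDerivWithinAt.2
  let L : ℝ →L[ℝ] E := mfderivWithin 𝓘(ℝ, ℝ) 𝓘(ℝ, E) y (Icc 0 1) t
  have h' : HasFDerivWithinAt (curveCoord E (y t) y) L (id ⁻¹' Icc 0 1 ∩ range id) t := h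
  rw [preimage_id, range_id, inter_univ] at h'
  exact h'.hasDerivWithinAt

omit [IsManifold 𝓘(ℝ, E) ∞ M] in
lemma eventually_curveCoord_eq {q : M} (hy : ContinuousWithinAt y (Icc 0 1) t)
    (hq : y t ∈ (extChartAt 𝓘(ℝ, E) q).source) :
    ∀ᶠ t' in 𝓝[Icc 0 1] t,
      transition E q p (curveCoord E q y t') = curveCoord E p y t' := by
  filter_upwards [eventually_curve_mem_source hy hq] with t' ht'
  rw [transition, curveCoord, (extChartAt 𝓘(ℝ, E) q).left_inv ht', curveCoord]

lemma eventually_fieldCoord_eq {q : M} (hy : ContinuousWithinAt y (Icc 0 1) t)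
    (hp : y t ∈ (extChartAt 𝓘(ℝ, E) p).source) (hq : y t ∈ (extChartAt 𝓘(ℝ, E) q).source)
    (V : ∀ t, TangentSpace 𝓘(ℝ, E) (y t)) :
    ∀ᶠ t' in 𝓝[Icc 0 1] t,
      fderiv ℝ (transition E q p) (curveCoord E q y t') (fieldCoord q y V t') =
        fieldCoord p y V t' := by
  filter_upwards [eventually_curve_mem_source hy hq, eventually_curve_mem_source hy hp] with t' h h'
  exact fderiv_transition_chartDeriv h h' (V t')

omit [IsManifold 𝓘(ℝ, E) ∞ M] in
lemma curveCoord_mem_target (hp : y t ∈ (extChartAt 𝓘(ℝ, E) p).source) :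
    curveCoord E p y t ∈ (extChartAt 𝓘(ℝ, E) p).target :=
  (extChartAt 𝓘(ℝ, E) p).map_source hp

lemma contDiffAt_transition_curve {q : M} (hp : y t ∈ (extChartAt 𝓘(ℝ, E) p).source)
    (hq : y t ∈ (extChartAt 𝓘(ℝ, E) q).source) :
    ContDiffAt ℝ ∞ (transition E p q) (curveCoord E p y t) :=
  contDiffAt_transition (curveCoord_mem_target hp)
    (by rwa [curveCoord, (extChartAt 𝓘(ℝ, E) p).left_inv hp])

/-- The coordinates of the velocity are the derivatives of the coordinates. -/
lemma hasDerivWithinAt_curveCoord (ht : t ∈ Icc (0 : ℝ) 1)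
    (hy : MDifferentiableWithinAt 𝓘(ℝ, ℝ) 𝓘(ℝ, E) y (Icc 0 1) t)
    (hp : y t ∈ (extChartAt 𝓘(ℝ, E) p).source) :
    HasDerivWithinAt (curveCoord E p y) (fieldCoord p y (velocity E y) t) (Icc 0 1) t := by
  have h1 : HasFDerivAt (transition E (y t) p) (fderiv ℝ (transition E (y t) p)
      (curveCoord E (y t) y t)) (curveCoord E (y t) y t) :=
    ((contDiffAt_transition_curve (mem_extChartAt_source _) hp).differentiableAt
      (by simp)).hasFDerivAt
  have h2 := h1.comp_hasDerivWithinAt t (hasDerivWithinAt_curveCoord_self hy)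
  have e := eventually_curveCoord_eq (p := p) hy.continuousWithinAt
    (mem_extChartAt_source (I := 𝓘(ℝ, E)) (y t))
  exact h2.congr_of_eventuallyEq (e.mono fun _ h ↦ h.symm) (e.self_of_nhdsWithin ht).symm

lemma contDiffWithinAt_curveCoord {k : ℕ}
    (hy : ContMDiffWithinAt 𝓘(ℝ, ℝ) 𝓘(ℝ, E) k y (Icc 0 1) t)
    (hp : y t ∈ (extChartAt 𝓘(ℝ, E) p).source) :
    ContDiffWithinAt ℝ k (curveCoord E p y) (Icc 0 1) t := by
  rw [← contMDiffWithinAt_iff_contDiffWithinAt]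
  rw [extChartAt_source] at hp
  exact ((contMDiffAt_extChartAt' (n := ∞) hp).of_le 
    (by exact_mod_cast le_top)).comp_contMDiffWithinAt t hy

lemma IsFieldAlong.contMDiffWithinAt {k : ℕ} {V : ∀ t, TangentSpace 𝓘(ℝ, E) (y t)}
    (h : IsFieldAlong k y V) (ht : t ∈ Icc (0 : ℝ) 1) :
    ContMDiffWithinAt 𝓘(ℝ, ℝ) 𝓘(ℝ, E) k y (Icc 0 1) t := by
  have : IsManifold 𝓘(ℝ, E) k M := .of_le (n := ∞) (by exact_mod_cast le_top)
  exact (contMDiffWithinAt_totalSpace.1 (h t ht)).1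

lemma IsFieldAlong.contDiffWithinAt_fieldCoord {k : ℕ} {V : ∀ t, TangentSpace 𝓘(ℝ, E) (y t)}
    (h : IsFieldAlong k y V) (ht : t ∈ Icc (0 : ℝ) 1)
    (hp : y t ∈ (extChartAt 𝓘(ℝ, E) p).source) :
    ContDiffWithinAt ℝ k (fieldCoord p y V) (Icc 0 1) t := by
  have h1 := ((trivializationAt E (TangentSpace 𝓘(ℝ, E)) p).contMDiffWithinAt_iff
    (by rwa [extChartAt_source] at hp)).1 (h t ht)
  rw [← contMDiffWithinAt_iff_contDiffWithinAt]
  have e : (fun x ↦ (trivializationAt E (TangentSpace 𝓘(ℝ, E)) p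
      (⟨y x, V x⟩ : TangentBundle 𝓘(ℝ, E) M)).2) = fieldCoord p y V :=
    funext fun x ↦ trivializationAt_snd _
  rw [← e]
  exact h1.2

variable [RiemannianBundle (fun x : M ↦ TangentSpace 𝓘(ℝ, E) x)]
  [IsContMDiffRiemannianBundle 𝓘(ℝ, E) ∞ E (fun x : M ↦ TangentSpace 𝓘(ℝ, E) x)]
  [FiniteDimensional ℝ E]

/-- The covariant derivative along a curve in an arbitrary chart. -/
lemma hasDerivWithinAt_fieldCoord (ht : t ∈ Icc (0 : ℝ) 1)
    (hy : MDifferentiableWithinAt 𝓘(ℝ, ℝ) 𝓘(ℝ, E) y (Icc 0 1) t)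
    (hp : y t ∈ (extChartAt 𝓘(ℝ, E) p).source) {V : ∀ t, TangentSpace 𝓘(ℝ, E) (y t)}
    (hV : DifferentiableWithinAt ℝ (fieldCoord p y V) (Icc 0 1) t) :
    HasDerivWithinAt (fieldCoord p y V) (fieldCoord p y (covDeriv y V) t
      - connCoord p (curveCoord E p y t) (fieldCoord p y V t) (fieldCoord p y (velocity E y) t))
      (Icc 0 1) t := by
  have hx : y t ∈ (extChartAt 𝓘(ℝ, E) (y t)).source := mem_extChartAt_source _
  have hYx := hasDerivWithinAt_curveCoord_self hy
  -- the field is differentiable in the chart centred at `y t`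
  have hVx : DifferentiableWithinAt ℝ (fieldCoord (y t) y V) (Icc 0 1) t := by
    have h1 : DifferentiableAt ℝ (fderiv ℝ (transition E p (y t))) (curveCoord E p y t) :=
      ((contDiffAt_transition_curve hp hx).fderiv_right (m := 1) (by norm_cast)).differentiableAt
        (by simp)
    have h2 := (h1.comp_differentiableWithinAt t
      (hasDerivWithinAt_curveCoord ht hy hp).differentiableWithinAt).clm_apply hV
    have e := eventually_fieldCoord_eq hy.continuousWithinAt hx hp V
    exact h2.congr_of_eventuallyEq (e.mono fun _ h ↦ h.symm) (e.self_of_nhdsWithin ht).symm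
  have hc : fieldCoord (y t) y (covDeriv y V) t = derivWithin (fieldCoord (y t) y V) (Icc 0 1) t +
      connCoord (y t) (curveCoord E (y t) y t) (fieldCoord (y t) y V t) (velocity E y t) := by
    have e : (fun s ↦ mfderiv 𝓘(ℝ, E) 𝓘(ℝ, E) (extChartAt 𝓘(ℝ, E) (y t)) (y s) (V s) : ℝ → E)
        =ᶠ[𝓝[Icc 0 1] t] fieldCoord (y t) y V := by
      filter_upwards [eventually_curve_mem_source hy.continuousWithinAt hx] with s hs
      exact mfderiv_extChartAt_apply hs (V s)
    have e1 := e.derivWithin_eq (e.self_of_nhdsWithin ht)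
    rw [← e1, fieldCoord_self, fieldCoord_self]
    rfl
  have hcm : IsConnectionMap (transition E (y t) p) (connCoord (y t)) (connCoord p)
      (curveCoord E (y t) y t) :=
    isConnectionMap_transition (curveCoord_mem_target hx)
      (by rwa [curveCoord, (extChartAt 𝓘(ℝ, E) (y t)).left_inv hx])
  have h := hcm.hasDerivWithinAt ((contDiffAt_transition_curve hx hp).of_le (by norm_cast)) hYx
    hVx.hasDerivWithinAt
  have e := eventually_fieldCoord_eq hy.continuousWithinAt hp hx V
  refine (h.congr_of_eventuallyEq (e.mono fun _ h ↦ h.symm)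
    (e.self_of_nhdsWithin ht).symm).congr_deriv ?_
  have e1 := (eventually_curveCoord_eq (p := p) hy.continuousWithinAt hx).self_of_nhdsWithin ht
  have e2 := (eventually_fieldCoord_eq hy.continuousWithinAt hp hx
    (velocity E y)).self_of_nhdsWithin ht
  have e3 := (eventually_fieldCoord_eq hy.continuousWithinAt hp hx
    (covDeriv y V)).self_of_nhdsWithin ht
  rw [e.self_of_nhdsWithin ht, e1, ← e3, hc, ← e2, fieldCoord_self (V := velocity E y)]

end Curves

/-! ### Geodesics and the exponential map in charts -/

section Geodesics

variable {E : Type*} [NormedAddCommGroup E] [NormedSpace ℝ E]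
  {M : Type*} [TopologicalSpace M] [ChartedSpace E M] [IsManifold 𝓘(ℝ, E) ∞ M]

lemma chartDeriv_injective {p x : M} (hx : x ∈ (extChartAt 𝓘(ℝ, E) p).source) :
    Function.Injective (chartDeriv E p x) := fun v w h ↦
  (chartEquiv E p x hx).injective <|
    (chartEquiv_apply hx v).trans (h.trans (chartEquiv_apply hx w).symm)

lemma tangentBundle_ext {p : M} {P Q : TangentBundle 𝓘(ℝ, E) M}
    (hp : P.1 ∈ (extChartAt 𝓘(ℝ, E) p).source) (h1 : P.1 = Q.1)
    (h2 : chartDeriv E p P.1 P.2 = chartDeriv E p Q.1 Q.2) : P = Q := by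
  obtain ⟨x, v⟩ := P
  obtain ⟨x', w⟩ := Q
  obtain rfl : x = x' := h1
  have : v = w := chartDeriv_injective hp h2
  rw [this]

lemma chartDeriv_eq_of_eq {E : Type*} [NormedAddCommGroup E] [NormedSpace ℝ E]
    {M : Type*} [TopologicalSpace M] [ChartedSpace E M] (p : M) {x₁ x₂ : M}
    {v₁ : TangentSpace 𝓘(ℝ, E) x₁} {v₂ : TangentSpace 𝓘(ℝ, E) x₂}
    (h : (⟨x₁, v₁⟩ : TangentBundle 𝓘(ℝ, E) M) = ⟨x₂, v₂⟩) :
    chartDeriv E p x₁ v₁ = chartDeriv E p x₂ v₂ := by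
  cases h
  rfl

lemma contDiffWithinAt_velocity {y : ℝ → M} {p : M} {t : ℝ} {k : ℕ}
    (hy : ContMDiffOn 𝓘(ℝ, ℝ) 𝓘(ℝ, E) (k + 1 : ℕ) y (Icc 0 1)) (ht : t ∈ Icc (0 : ℝ) 1)
    (hp : y t ∈ (extChartAt 𝓘(ℝ, E) p).source) :
    ContDiffWithinAt ℝ k (fieldCoord p y (velocity E y)) (Icc 0 1) t := by
  refine contDiffWithinAt_of_hasDerivWithinAt uniqueDiffOn_Icc_zero_one ht
    (f := curveCoord E p y) (by exact_mod_cast contDiffWithinAt_curveCoord (hy t ht) hp) ?_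
  filter_upwards [eventually_curve_mem_source (hy t ht).continuousWithinAt hp,
    self_mem_nhdsWithin] with t' h1 h2
  exact hasDerivWithinAt_curveCoord h2 ((hy t' h2).mdifferentiableWithinAt (by simp)) h1

variable [RiemannianBundle (fun x : M ↦ TangentSpace 𝓘(ℝ, E) x)]
  [IsContMDiffRiemannianBundle 𝓘(ℝ, E) ∞ E (fun x : M ↦ TangentSpace 𝓘(ℝ, E) x)]
  [FiniteDimensional ℝ E]

lemma contDiffWithinAt_covDeriv {y : ℝ → M} {p : M} {t : ℝ} {k : ℕ}
    (hy : ContMDiffOn 𝓘(ℝ, ℝ) 𝓘(ℝ, E) (k + 1 : ℕ) y (Icc 0 1)) (ht : t ∈ Icc (0 : ℝ) 1)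
    (hp : y t ∈ (extChartAt 𝓘(ℝ, E) p).source) {V : ∀ t, TangentSpace 𝓘(ℝ, E) (y t)}
    (hV : ContDiffWithinAt ℝ (k + 1 : ℕ) (fieldCoord p y V) (Icc 0 1) t) :
    ContDiffWithinAt ℝ k (fieldCoord p y (covDeriv y V)) (Icc 0 1) t := by
  have hk : ((k : ℕ) : WithTop ℕ∞) ≤ ∞ := by exact_mod_cast le_top
  have hk' : ((k : ℕ) : WithTop ℕ∞) ≤ (k + 1 : ℕ) := by exact_mod_cast Nat.le_succ k
  have hYc : ContDiffWithinAt ℝ k (curveCoord E p y) (Icc 0 1) t :=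
    (contDiffWithinAt_curveCoord (hy t ht) hp).of_le hk'
  have hG : ContDiffWithinAt ℝ k (fun t ↦ connCoord p (curveCoord E p y t)) (Icc 0 1) t :=
    ((contDiffAt_connCoord (curveCoord_mem_target hp)).of_le hk).comp_contDiffWithinAt t hYc
  have hterm := (hG.clm_apply (hV.of_le hk')).clm_apply (contDiffWithinAt_velocity hy ht hp)
  have hd : ContDiffWithinAt ℝ k (fun t' ↦ fieldCoord p y (covDeriv y V) t'
      - connCoord p (curveCoord E p y t') (fieldCoord p y V t') (fieldCoord p y (velocity E y) t'))
      (Icc 0 1) t := by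
    refine contDiffWithinAt_of_hasDerivWithinAt uniqueDiffOn_Icc_zero_one ht
      (f := fieldCoord p y V) (by exact_mod_cast hV) ?_
    have hev := hV.eventually (by simp)
    rw [insert_eq_of_mem ht] at hev
    filter_upwards [eventually_curve_mem_source (hy t ht).continuousWithinAt hp,
      self_mem_nhdsWithin, hev] with t' h1 h2 h3
    exact hasDerivWithinAt_fieldCoord h2 ((hy t' h2).mdifferentiableWithinAt (by simp)) h1
      (h3.differentiableWithinAt (by simp))
  exact (hd.add hterm).congr_of_mem (fun t' _ ↦ by simp) ht

/-- The connector of the chart centred at `p` extends from a neighbourhood of `p` to a smooth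
symmetric connector on the whole model space. -/
lemma exists_global_connCoord (p : M) :
    ∃ (Γ : E → E →L[ℝ] E →L[ℝ] E) (U : Set E), ContDiff ℝ ∞ Γ ∧ (∀ z u v, Γ z u v = Γ z v u) ∧
      IsOpen U ∧ extChartAt 𝓘(ℝ, E) p p ∈ U ∧ U ⊆ (extChartAt 𝓘(ℝ, E) p).target ∧
      ∀ z ∈ U, Γ z = connCoord p z := by
  obtain ⟨r, hr, hball⟩ := Metric.isOpen_iff.1 (isOpen_extChartAt_target (I := 𝓘(ℝ, E)) p) _
    (mem_extChartAt_target p)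
  let f : ContDiffBump (extChartAt 𝓘(ℝ, E) p p) :=
    ⟨r / 4, r / 2, by positivity, by linarith⟩
  have hsub : Metric.closedBall (extChartAt 𝓘(ℝ, E) p p) (r / 2) ⊆
      (extChartAt 𝓘(ℝ, E) p).target :=
    (Metric.closedBall_subset_ball (by linarith)).trans hball
  refine ⟨fun z ↦ f z • connCoord p z, Metric.ball (extChartAt 𝓘(ℝ, E) p p) (r / 4), ?_, ?_,
    Metric.isOpen_ball, Metric.mem_ball_self (by positivity),
    (Metric.ball_subset_ball (by linarith)).trans hball, ?_⟩
  · refine contDiff_iff_contDiffAt.2 fun z ↦ ?_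
    by_cases hz : z ∈ (extChartAt 𝓘(ℝ, E) p).target
    · exact f.contDiffAt.smul (contDiffAt_connCoord hz)
    · have h0 : (fun z ↦ f z • connCoord p z) =ᶠ[𝓝 z] fun _ ↦ 0 := by
        filter_upwards [Metric.isClosed_closedBall.isOpen_compl.mem_nhds
          (fun h ↦ hz (hsub h))] with z' hz'
        rw [f.zero_of_le_dist (not_le.1 fun h ↦ hz' h).le, zero_smul]
      exact contDiffAt_const.congr_of_eventuallyEq h0
  · intro z u v
    by_cases hz : z ∈ (extChartAt 𝓘(ℝ, E) p).target
    · simp only [smul_apply, connCoord_symm hz u v]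
    · have : f z = 0 := f.zero_of_le_dist (by
        have : z ∉ Metric.closedBall (extChartAt 𝓘(ℝ, E) p p) (r / 2) := fun h ↦ hz (hsub h)
        exact (not_le.1 fun h ↦ this h).le)
      simp only [this, zero_smul, zero_apply]
  · intro z hz
    simp only [f.one_of_mem_closedBall (Metric.ball_subset_closedBall hz), one_smul]

variable {P : TangentBundle 𝓘(ℝ, E) M} {c : ℝ → M} {p : M} {t : ℝ}

/-- Geodesics solve the geodesic equation in charts. -/
lemma IsGeodesicFrom.hasDerivWithinAt (hc : IsGeodesicFrom P c) (ht : t ∈ Icc (0 : ℝ) 1)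
    (hp : c t ∈ (extChartAt 𝓘(ℝ, E) p).source) :
    HasDerivWithinAt (curveCoord E p c) (fieldCoord p c (velocity E c) t) (Icc 0 1) t ∧
      HasDerivWithinAt (fieldCoord p c (velocity E c))
        (-connCoord p (curveCoord E p c t) (fieldCoord p c (velocity E c) t)
          (fieldCoord p c (velocity E c) t)) (Icc 0 1) t := by
  have hy := (hc.1 t ht).mdifferentiableWithinAt (by simp)
  refine ⟨hasDerivWithinAt_curveCoord ht hy hp, ?_⟩
  have h1 : ContDiffWithinAt ℝ (1 : ℕ) (fieldCoord p c (velocity E c)) (Icc 0 1) t :=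
    contDiffWithinAt_velocity (by exact_mod_cast hc.1) ht hp
  refine (hasDerivWithinAt_fieldCoord ht hy hp
    (h1.differentiableWithinAt (by simp))).congr_deriv ?_
  have h2 : fieldCoord p c (covDeriv c (velocity E c)) t = 0 :=
    (congrArg (chartDeriv E p (c t)) (hc.2.1 t ht)).trans (map_zero _)
  rw [h2, zero_sub]

/-- Solutions of the geodesic equation in a chart are geodesics. -/
lemma isGeodesicFrom_of_isGeodesicPair {f f' : ℝ → E} (hf : ContDiffOn ℝ 2 f (Icc 0 1))
    (hft : ∀ t ∈ Icc (0 : ℝ) 1, f t ∈ (extChartAt 𝓘(ℝ, E) p).target)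
    (hgeo : IsGeodesicPair (connCoord p) f f' 0 1)
    (hP : P.1 = (extChartAt 𝓘(ℝ, E) p).symm (f 0)) (hP' : chartDeriv E p P.1 P.2 = f' 0) :
    IsGeodesicFrom P (fun t ↦ (extChartAt 𝓘(ℝ, E) p).symm (f t)) := by
  set c : ℝ → M := fun t ↦ (extChartAt 𝓘(ℝ, E) p).symm (f t) with hcdef
  have hc : ContMDiffOn 𝓘(ℝ, ℝ) 𝓘(ℝ, E) 2 c (Icc 0 1) :=
    ((contMDiffOn_extChartAt_symm (n := ∞) p).of_le (by norm_cast)).comp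
      (contMDiffOn_iff_contDiffOn.2 hf) hft
  have hsrc : ∀ t ∈ Icc (0 : ℝ) 1, c t ∈ (extChartAt 𝓘(ℝ, E) p).source := fun t ht ↦
    (extChartAt 𝓘(ℝ, E) p).map_target (hft t ht)
  have hY : ∀ t ∈ Icc (0 : ℝ) 1, curveCoord E p c t = f t := fun t ht ↦
    (extChartAt 𝓘(ℝ, E) p).right_inv (hft t ht)
  have hmd : ∀ t ∈ Icc (0 : ℝ) 1, MDifferentiableWithinAt 𝓘(ℝ, ℝ) 𝓘(ℝ, E) c (Icc 0 1) t :=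
    fun t ht ↦ (hc t ht).mdifferentiableWithinAt (by simp)
  have hA : ∀ t ∈ Icc (0 : ℝ) 1, fieldCoord p c (velocity E c) t = f' t := fun t ht ↦
    (uniqueDiffOn_Icc_zero_one t ht).eq_deriv _
      (hasDerivWithinAt_curveCoord ht (hmd t ht) (hsrc t ht)) ((hgeo t ht).1.congr hY (hY t ht))
  refine ⟨hc, fun t ht ↦ ?_, ?_⟩
  · have h1 := (hgeo t ht).2.congr hA (hA t ht)
    have h2 := hasDerivWithinAt_fieldCoord ht (hmd t ht) (hsrc t ht) h1.differentiableWithinAt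
    have h3 := (uniqueDiffOn_Icc_zero_one t ht).eq_deriv _ h2 h1
    rw [hA t ht, hY t ht] at h3
    have h4 : fieldCoord p c (covDeriv c (velocity E c)) t = 0 := by
      linear_combination (norm := module) h3
    exact chartDeriv_injective (hsrc t ht) (h4.trans (map_zero _).symm)
  · have h0 : (0 : ℝ) ∈ Icc (0 : ℝ) 1 := by simp
    refine tangentBundle_ext (p := p) (hsrc 0 h0) hP.symm ?_
    exact (hA 0 h0).trans hP'.symm

/-- Two geodesics with the same velocity at the time `t` agree for a short time after `t`. -/
lemma IsGeodesicFrom.eventually_eq {Q : TangentBundle 𝓘(ℝ, E) M} {c₁ c₂ : ℝ → M}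
    (h₁ : IsGeodesicFrom P c₁) (h₂ : IsGeodesicFrom Q c₂) (ht : t ∈ Ico (0 : ℝ) 1)
    (h : (⟨c₁ t, velocity E c₁ t⟩ : TangentBundle 𝓘(ℝ, E) M) = ⟨c₂ t, velocity E c₂ t⟩) :
    ∀ᶠ s in 𝓝[>] t,
      (⟨c₁ s, velocity E c₁ s⟩ : TangentBundle 𝓘(ℝ, E) M) = ⟨c₂ s, velocity E c₂ s⟩ := by
  have hc : c₁ t = c₂ t := congrArg TotalSpace.proj h
  have htI : t ∈ Icc (0 : ℝ) 1 := Ico_subset_Icc_self ht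
  obtain ⟨Γ, U, hΓ, -, hUo, htU, hUt, hΓU⟩ := exists_global_connCoord (E := E) (c₁ t)
  have hev : ∀ {Q : TangentBundle 𝓘(ℝ, E) M} {c : ℝ → M}, IsGeodesicFrom Q c → c₁ t = c t →
      ∀ᶠ t' in 𝓝[Icc 0 1] t,
        c t' ∈ (extChartAt 𝓘(ℝ, E) (c₁ t)).source ∧ curveCoord E (c₁ t) c t' ∈ U := by
    intro Q c hc hct
    have hp : c t ∈ (extChartAt 𝓘(ℝ, E) (c₁ t)).source := by
      rw [← hct]; exact mem_extChartAt_source _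
    refine (eventually_curve_mem_source (hc.1 t htI).continuousWithinAt hp).and ?_
    refine (hc.hasDerivWithinAt htI hp).1.continuousWithinAt.eventually (hUo.mem_nhds ?_)
    rwa [curveCoord, ← hct]
  obtain ⟨δ, hδ, hball⟩ := Metric.mem_nhdsWithin_iff.1 ((hev h₁ rfl).and (hev h₂ hc))
  let b := min 1 (t + δ / 2)
  have htb : t < b := lt_min ht.2 (by linarith)
  have hsub : Icc t b ⊆ Icc 0 1 := Icc_subset_Icc ht.1 (min_le_left _ _)
  have hin : ∀ s ∈ Icc t b, s ∈ Metric.ball t δ ∩ Icc 0 1 := by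
    refine fun s hs ↦ ⟨?_, hsub hs⟩
    have := hs.2.trans (min_le_right _ _)
    rw [Metric.mem_ball, Real.dist_eq, abs_of_nonneg (by linarith [hs.1])]
    linarith
  have hpair : ∀ {Q : TangentBundle 𝓘(ℝ, E) M} {c : ℝ → M}, IsGeodesicFrom Q c →
      (∀ s ∈ Icc t b, c s ∈ (extChartAt 𝓘(ℝ, E) (c₁ t)).source ∧ curveCoord E (c₁ t) c s ∈ U) →
      IsGeodesicPair Γ (curveCoord E (c₁ t) c) (fieldCoord (c₁ t) c (velocity E c)) t b := by
    intro Q c hc h s hs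
    obtain ⟨d1, d2⟩ := hc.hasDerivWithinAt (hsub hs) (h s hs).1
    refine ⟨d1.mono hsub, ?_⟩
    rw [hΓU _ (h s hs).2]
    exact d2.mono hsub
  have huniq := (hpair h₁ fun s hs ↦ (hball (hin s hs)).1).unique (hΓ.of_le (by norm_cast))
    (hpair h₂ fun s hs ↦ (hball (hin s hs)).2) (congrArg (extChartAt 𝓘(ℝ, E) (c₁ t)) hc)
    (chartDeriv_eq_of_eq _ h)
  filter_upwards [Ioc_mem_nhdsGT htb] with s hs
  obtain ⟨e1, e2⟩ := huniq s (Ioc_subset_Icc_self hs)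
  have m := hball (hin s (Ioc_subset_Icc_self hs))
  exact tangentBundle_ext m.1.1 ((extChartAt 𝓘(ℝ, E) (c₁ t)).injOn m.1.1 m.2.1 e1) e2

/-- A geodesic is determined by its initial velocity. -/
lemma IsGeodesicFrom.eq_of_mem_Icc [T2Space M] {c₁ c₂ : ℝ → M} (h₁ : IsGeodesicFrom P c₁)
    (h₂ : IsGeodesicFrom P c₂) (ht : t ∈ Icc (0 : ℝ) 1) : c₁ t = c₂ t := by
  let S : Set ℝ := {t | (⟨c₁ t, velocity E c₁ t⟩ : TangentBundle 𝓘(ℝ, E) M) =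
    ⟨c₂ t, velocity E c₂ t⟩}
  have hS1 : ∀ t ∈ S, c₁ t = c₂ t := fun t ht ↦ congrArg TotalSpace.proj ht
  have hcl : IsClosed (S ∩ Icc 0 1) := by
    refine isClosed_of_closure_subset fun t ht ↦ ?_
    have htI : t ∈ Icc (0 : ℝ) 1 := (closure_minimal inter_subset_right isClosed_Icc) ht
    have hne : (𝓝[S ∩ Icc 0 1] t).NeBot := mem_closure_iff_nhdsWithin_neBot.1 ht
    have hmem : ∀ᶠ t' in 𝓝[S ∩ Icc 0 1] t, t' ∈ S :=
      mem_of_superset self_mem_nhdsWithin inter_subset_left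
    have hle : 𝓝[S ∩ Icc 0 1] t ≤ 𝓝[Icc 0 1] t := nhdsWithin_mono t inter_subset_right
    have e1 : c₁ t = c₂ t := tendsto_nhds_unique_of_eventuallyEq
      ((h₁.1 t htI).continuousWithinAt.mono_left hle)
      ((h₂.1 t htI).continuousWithinAt.mono_left hle) (hmem.mono hS1)
    have hp₁ : c₁ t ∈ (extChartAt 𝓘(ℝ, E) (c₁ t)).source := mem_extChartAt_source _
    have hp₂ : c₂ t ∈ (extChartAt 𝓘(ℝ, E) (c₁ t)).source := by
      rw [← e1]; exact mem_extChartAt_source _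
    have e2 : fieldCoord (c₁ t) c₁ (velocity E c₁) t = fieldCoord (c₁ t) c₂ (velocity E c₂) t :=
      tendsto_nhds_unique_of_eventuallyEq
        ((h₁.hasDerivWithinAt htI hp₁).2.continuousWithinAt.mono_left hle)
        ((h₂.hasDerivWithinAt htI hp₂).2.continuousWithinAt.mono_left hle)
        (hmem.mono fun t' ht' ↦ chartDeriv_eq_of_eq _ ht')
    exact ⟨tangentBundle_ext hp₁ e1 e2, htI⟩
  have h0 : (0 : ℝ) ∈ S := h₁.2.2.trans h₂.2.2.symm
  exact hS1 t <| hcl.Icc_subset_of_forall_mem_nhdsWithin h0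
    (fun t ht ↦ h₁.eventually_eq h₂ ht.2 ht.1) ht

lemma IsGeodesicFrom.riemExp_eq [T2Space M] {x : M} {v : TangentSpace 𝓘(ℝ, E) x}
    (hc : IsGeodesicFrom (⟨x, v⟩ : TangentBundle 𝓘(ℝ, E) M) c) : riemExp x v = c 1 := by
  have h : ∃ c : ℝ → M, IsGeodesicFrom (⟨x, v⟩ : TangentBundle 𝓘(ℝ, E) M) c := ⟨c, hc⟩
  rw [riemExp, dif_pos h]
  exact h.choose_spec.eq_of_mem_Icc hc (by simp)

end Geodesics

section Coordinates

attribute [-instance]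
  Bundle.instNormedAddCommGroupOfRiemannianBundleOfIsTopologicalAddGroupOfContinuousConstSMulReal
  Bundle.instInnerProductSpaceReal

/-! ### Expansions in a fixed chart -/

namespace IsNormalFamily

variable {E : Type*} [NormedAddCommGroup E] [NormedSpace ℝ E] {Γ : E → E →L[ℝ] E →L[ℝ] E} {p : E}
  {U : Set E} {r B : ℝ} {e L : E → E → E} {x : E}

lemma exp_zero (H : IsNormalFamily Γ p U r B e L) (hx : ‖x - p‖ < r) : e x 0 = x :=
  (H.isExpAt x hx).apply_zero

lemma log_self (H : IsNormalFamily Γ p U r B e L) (hx : ‖x - p‖ < r) : L x x = 0 := by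
  have := H.log_exp x hx 0 (by simpa using H.pos)
  rwa [H.exp_zero hx] at this

lemma exp_contDiffAt_snd (H : IsNormalFamily Γ p U r B e L) (hx : ‖x - p‖ < r) {h : E}
    (hh : ‖h‖ < r) : ContDiffAt ℝ 5 (e x) h :=
  contDiffAt_slice (J := fun P : E × E ↦ e P.1 P.2) (H.exp_contDiffAt x hx h hh)

/-- Points close to `x` have normal coordinates around `x`. -/
lemma eventually_log (H : IsNormalFamily Γ p U r B e L) (hx : ‖x - p‖ < r) :
    ∀ᶠ q in 𝓝 x, ‖L x q‖ < r ∧ e x (L x q) = q := by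
  have h0 : ‖(0 : E)‖ < r := by simpa using H.pos
  have h1 := H.exp_log x hx 0 h0
  have h2 := (H.log_contDiffAt x hx 0 h0).continuousAt
  rw [H.exp_zero hx] at h1 h2
  exact (h2.norm.eventually_lt_const (by simpa only [H.log_self hx] using h0)).and h1

lemma fderiv_exp_log (H : IsNormalFamily Γ p U r B e L) (hx : ‖x - p‖ < r) {h : E} (hh : ‖h‖ < r)
    (u : E) : fderiv ℝ (e x) h (fderiv ℝ (L x) (e x h) u) = u := by
  have d1 := ((H.log_contDiffAt x hx h hh).differentiableAt (by simp)).hasFDerivAt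
  have d2 : HasFDerivAt (e x) (fderiv ℝ (e x) h) (L x (e x h)) := by
    rw [H.log_exp x hx h hh]
    exact ((H.exp_contDiffAt_snd hx hh).differentiableAt (by simp)).hasFDerivAt
  exact DFunLike.congr_fun ((d2.comp (e x h) d1).unique ((hasFDerivAt_id _).congr_of_eventuallyEq
    ((H.exp_log x hx h hh).mono fun q hq ↦ hq))) u

lemma fderiv_log_self (H : IsNormalFamily Γ p U r B e L) (hx : ‖x - p‖ < r) (u : E) :
    fderiv ℝ (L x) x u = u := by
  have h := H.fderiv_exp_log hx (h := 0) (by simpa using H.pos) u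
  rwa [(H.isExpAt x hx).fderiv_zero, H.exp_zero hx] at h

lemma eventually_isConnectionMap_log (H : IsNormalFamily Γ p U r B e L) (hx : ‖x - p‖ < r) :
    ∀ᶠ q in 𝓝 x, ContDiffAt ℝ 5 (L x) q ∧
      IsConnectionMap (L x) Γ (connOfExp (normalExp e L x)) q := by
  filter_upwards [H.eventually_log hx] with q hq
  rw [← hq.2]
  refine ⟨H.log_contDiffAt x hx _ hq.1, ?_⟩
  refine (H.isConnectionMap x hx _ hq.1).of_leftInverse
    ((H.exp_contDiffAt_snd hx hq.1).of_le (by norm_num))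
    ((H.log_contDiffAt x hx _ hq.1).of_le (by norm_num)) ?_ (H.exp_log x hx _ hq.1)
  filter_upwards [(isOpen_lt continuous_norm continuous_const).mem_nhds hq.1] with v hv
  exact H.log_exp x hx v hv

/-- At the centre of normal coordinates the curvature is the one of the original chart. -/
lemma curvatureCoord_normal (H : IsNormalFamily Γ p U r B e L) (hΓ : ContDiff ℝ ∞ Γ)
    (hx : ‖x - p‖ < r) (u v w : E) :
    curvatureCoord (connOfExp (normalExp e L x)) 0 u v w = curvatureCoord Γ x u v w := by
  have h0 : ‖(0 : E)‖ < r := by simpa using H.pos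
  have hev : ∀ᶠ z in 𝓝 (0 : E), IsConnectionMap (e x) (connOfExp (normalExp e L x)) Γ z := by
    filter_upwards [(isOpen_lt continuous_norm continuous_const).mem_nhds h0] with z hz
    exact H.isConnectionMap x hx z hz
  have h := fderiv_curvatureCoord hev ((H.exp_contDiffAt_snd hx h0).of_le (by norm_num))
    ((H.isNormalExp x hx).conn_contDiffAt.differentiableAt (by simp))
    (hΓ.contDiffAt.differentiableAt (by simp)) u v w
  simpa only [(H.isExpAt x hx).fderiv_zero, H.exp_zero hx, ContinuousLinearMap.id_apply] using h

variable {Y W : ℝ → E} {s : Set ℝ}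

/-- In normal coordinates, the curve `exp_Y W` is `F (h, v)`, where `F` is the exponential map in
normal coordinates, and `h`, `v` are the normal coordinates of `Y` and `W`. -/
lemma eventually_normalExp_eq (H : IsNormalFamily Γ p U r B e L) (hx : ‖Y 0 - p‖ < r)
    (hY : ContinuousWithinAt Y s 0) :
    ∀ᶠ ε in 𝓝[s] 0, normalExp e L (Y 0) (L (Y 0) (Y ε), fderiv ℝ (L (Y 0)) (Y ε) (W ε)) =
      L (Y 0) (e (Y ε) (W ε)) := by
  filter_upwards [hY.eventually (H.eventually_log hx)] with ε hε
  have := H.fderiv_exp_log hx hε.1 (W ε)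
  rw [hε.2] at this
  simp only [normalExp, this, hε.2]

lemma hasDerivWithinAt_log_curve (H : IsNormalFamily Γ p U r B e L) (hx : ‖Y 0 - p‖ < r)
    (hYc : ContinuousWithinAt Y s 0) :
    ∀ᶠ ε in 𝓝[s] 0, ∀ a, HasDerivWithinAt Y a s ε →
      HasDerivWithinAt (fun ε ↦ L (Y 0) (Y ε)) (fderiv ℝ (L (Y 0)) (Y ε) a) s ε := by
  filter_upwards [hYc.eventually (H.eventually_isConnectionMap_log hx)] with ε hε a ha
  exact (hε.1.differentiableAt (by simp)).hasFDerivAt.comp_hasDerivWithinAt ε ha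

lemma hasDerivWithinAt_log_field (H : IsNormalFamily Γ p U r B e L) (hx : ‖Y 0 - p‖ < r)
    (hYc : ContinuousWithinAt Y s 0) :
    ∀ᶠ ε in 𝓝[s] 0, ∀ (f : ℝ → E) (a f1 : E), HasDerivWithinAt Y a s ε →
      HasDerivWithinAt f (f1 - Γ (Y ε) (f ε) a) s ε →
      HasDerivWithinAt (fun ε ↦ fderiv ℝ (L (Y 0)) (Y ε) (f ε))
        (fderiv ℝ (L (Y 0)) (Y ε) f1 - connOfExp (normalExp e L (Y 0)) (L (Y 0) (Y ε))
          (fderiv ℝ (L (Y 0)) (Y ε) (f ε)) (fderiv ℝ (L (Y 0)) (Y ε) a)) s ε := by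
  filter_upwards [hYc.eventually (H.eventually_isConnectionMap_log hx)] with ε hε f a f1 ha hf
  have h := hε.2.hasDerivWithinAt (hε.1.of_le (by norm_num)) ha hf
  rwa [sub_add_cancel] at h

lemma contDiffWithinAt_log_exp (H : IsNormalFamily Γ p U r B e L) {k : ℕ} (hk : k ≤ 3)
    (hx : ‖Y 0 - p‖ < r) (hW0 : ‖W 0‖ < r) (hY : ContDiffWithinAt ℝ k Y s 0)
    (hW : ContDiffWithinAt ℝ k W s 0) :
    ContDiffWithinAt ℝ k (fun ε ↦ L (Y 0) (e (Y ε) (W ε))) s 0 := by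
  have hk' : (k : WithTop ℕ∞) ≤ 5 := by exact_mod_cast hk.trans (by norm_num)
  have h1 : ContDiffWithinAt ℝ k (fun ε ↦ e (Y ε) (W ε)) s 0 :=
    ContDiffAt.comp_contDiffWithinAt (g := fun P : E × E ↦ e P.1 P.2) (f := fun ε ↦ (Y ε, W ε)) 0
      ((H.exp_contDiffAt _ hx _ hW0).of_le hk') (hY.prodMk hW)
  exact ContDiffAt.comp_contDiffWithinAt (g := L (Y 0)) 0
    ((H.log_contDiffAt _ hx _ hW0).of_le hk') h1

variable {A A₁ W₁ W₂ : ℝ → E} {a1 a2 w1 w2 w3 : E} {κ : ℝ}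

/-- The first order expansion in an arbitrary chart, from the one in the normal coordinates around
`Y 0`: the change of coordinates `L (Y 0)` has the identity as its derivative at `Y 0`, and maps
covariant derivatives to covariant derivatives. -/
theorem first_order (H : IsNormalFamily Γ p U r B e L) (hΓ : ContDiff ℝ ∞ Γ)
    (hs : UniqueDiffOn ℝ s) (h0s : (0 : ℝ) ∈ s) (hx : ‖Y 0 - p‖ < r) (hκ : κ < r) {a : E}
    (hY : HasDerivWithinAt Y a s 0) (hW : HasDerivWithinAt W (w1 - Γ (Y 0) (W 0) a) s 0)
    (ba : ‖a‖ ≤ κ) (bw : ‖W 0‖ ≤ κ) :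
    ‖iteratedDerivWithin 1 (fun ε ↦ L (Y 0) (e (Y ε) (W ε))) s 0
      - (a + w1 - (1 / 3 : ℝ) • curvatureCoord Γ (Y 0) (W 0) a (W 0))‖ ≤ B * κ ^ 4 := by
  have hYc := hY.continuousWithinAt
  have hev := H.eventually_normalExp_eq (W := W) hx hYc
  rw [← EventuallyEq.iteratedDerivWithin_eq hev (hev.self_of_nhdsWithin h0s)]
  have := (H.isNormalExp _ hx).first_order (a := a) (v1 := w1) hs h0s hκ
    (h := fun ε ↦ L (Y 0) (Y ε)) (v := fun ε ↦ fderiv ℝ (L (Y 0)) (Y ε) (W ε)) (H.log_self hx)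
    (((H.hasDerivWithinAt_log_curve hx hYc).self_of_nhdsWithin h0s a hY).congr_deriv
      (H.fderiv_log_self hx a))
    (((H.hasDerivWithinAt_log_field hx hYc).self_of_nhdsWithin h0s W a w1 hY hW).congr_deriv
      (by rw [H.fderiv_log_self hx, H.fderiv_log_self hx a])) ba
    (by rwa [H.fderiv_log_self hx])
  simpa only [H.fderiv_log_self hx, H.curvatureCoord_normal hΓ hx] using this

/-- The second order expansion in an arbitrary chart. -/
theorem second_order (H : IsNormalFamily Γ p U r B e L) (hΓ : ContDiff ℝ ∞ Γ)
    (hs : UniqueDiffOn ℝ s) (h0s : (0 : ℝ) ∈ s) (hx : ‖Y 0 - p‖ < r) (hκ : κ < r)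
    (hY : ∀ᶠ ε in 𝓝[s] 0, HasDerivWithinAt Y (A ε) s ε)
    (hA : HasDerivWithinAt A (a1 - Γ (Y 0) (A 0) (A 0)) s 0)
    (hW : ∀ᶠ ε in 𝓝[s] 0, HasDerivWithinAt W (W₁ ε - Γ (Y ε) (W ε) (A ε)) s ε)
    (hW1 : HasDerivWithinAt W₁ (w2 - Γ (Y 0) (W₁ 0) (A 0)) s 0)
    (ba : ‖A 0‖ ≤ κ) (bw : ‖W 0‖ ≤ κ) (bw1 : ‖W₁ 0‖ ≤ κ) (ba1 : ‖a1‖ ≤ κ) :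
    ‖iteratedDerivWithin 2 (fun ε ↦ L (Y 0) (e (Y ε) (W ε))) s 0
      - (a1 + w2 - (1 / 3 : ℝ) • curvatureCoord Γ (Y 0) (W 0) a1 (W 0)
        - (2 / 3 : ℝ) • curvatureCoord Γ (Y 0) (W₁ 0) (A 0) (W 0)
        + (1 / 3 : ℝ) • curvatureCoord Γ (Y 0) (A 0) (W 0) (A 0 + (2 : ℝ) • W₁ 0))‖
      ≤ 2 * B * κ ^ 4 := by
  have hY0 := hY.self_of_nhdsWithin h0s
  have hYc := hY0.continuousWithinAt
  have hev := H.eventually_normalExp_eq (W := W) hx hYc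
  rw [← EventuallyEq.iteratedDerivWithin_eq hev (hev.self_of_nhdsWithin h0s)]
  have hc := H.hasDerivWithinAt_log_curve hx hYc
  have hf := H.hasDerivWithinAt_log_field hx hYc
  have := (H.isNormalExp _ hx).second_order (a1 := a1) (v2 := w2) hs h0s hκ
    (h := fun ε ↦ L (Y 0) (Y ε)) (v := fun ε ↦ fderiv ℝ (L (Y 0)) (Y ε) (W ε))
    (a := fun ε ↦ fderiv ℝ (L (Y 0)) (Y ε) (A ε)) (v₁ := fun ε ↦ fderiv ℝ (L (Y 0)) (Y ε) (W₁ ε))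
    (H.log_self hx) (by filter_upwards [hY, hc] with ε h1 h2 using h2 _ h1)
    ((hf.self_of_nhdsWithin h0s A _ a1 hY0 hA).congr_deriv (by rw [H.fderiv_log_self hx a1]))
    (by filter_upwards [hY, hW, hf] with ε h1 h2 h3 using h3 _ _ _ h1 h2)
    ((hf.self_of_nhdsWithin h0s W₁ _ w2 hY0 hW1).congr_deriv (by rw [H.fderiv_log_self hx w2]))
    (by rwa [H.fderiv_log_self hx]) (by rwa [H.fderiv_log_self hx])
    (by rwa [H.fderiv_log_self hx]) ba1
  simpa only [H.fderiv_log_self hx, H.curvatureCoord_normal hΓ hx] using this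

/-- The third order expansion in an arbitrary chart. -/
theorem third_order (H : IsNormalFamily Γ p U r B e L) (hΓ : ContDiff ℝ ∞ Γ)
    (hs : UniqueDiffOn ℝ s) (h0s : (0 : ℝ) ∈ s) (hx : ‖Y 0 - p‖ < r) (hκ : κ < r)
    (hBκ : B * κ ≤ 1)
    (hY : ∀ᶠ ε in 𝓝[s] 0, HasDerivWithinAt Y (A ε) s ε)
    (hA : ∀ᶠ ε in 𝓝[s] 0, HasDerivWithinAt A (A₁ ε - Γ (Y ε) (A ε) (A ε)) s ε)
    (hA1 : HasDerivWithinAt A₁ (a2 - Γ (Y 0) (A₁ 0) (A 0)) s 0)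
    (hW : ∀ᶠ ε in 𝓝[s] 0, HasDerivWithinAt W (W₁ ε - Γ (Y ε) (W ε) (A ε)) s ε)
    (hW1 : ∀ᶠ ε in 𝓝[s] 0, HasDerivWithinAt W₁ (W₂ ε - Γ (Y ε) (W₁ ε) (A ε)) s ε)
    (hW2 : HasDerivWithinAt W₂ (w3 - Γ (Y 0) (W₂ 0) (A 0)) s 0)
    (ba : ‖A 0‖ ≤ κ) (bw : ‖W 0‖ ≤ κ) (bw1 : ‖W₁ 0‖ ≤ κ) (ba1 : ‖A₁ 0‖ ≤ κ) (ba2 : ‖a2‖ ≤ κ)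
    (bw2 : ‖W₂ 0‖ ≤ κ) :
    ‖iteratedDerivWithin 3 (fun ε ↦ L (Y 0) (e (Y ε) (W ε))) s 0
      - (a2 + w3 + curvatureCoord Γ (Y 0) (A 0) (W₁ 0) (A 0 + (2 : ℝ) • W₁ 0)
        + curvatureCoord Γ (Y 0) (A 0) (W 0) (A₁ 0 + (2 : ℝ) • W₂ 0)
        + curvatureCoord Γ (Y 0) (W 0) (W₂ 0) (A 0)
        + curvatureCoord Γ (Y 0) (W 0) (W₁ 0) (A₁ 0)
        + (2 : ℝ) • curvatureCoord Γ (Y 0) (A₁ 0) (W 0) (W₁ 0)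
        - (1 / 3 : ℝ) • curvatureCoord Γ (Y 0) (W 0) a2 (W 0))‖
      ≤ 12 * B * κ ^ 4 := by
  have hY0 := hY.self_of_nhdsWithin h0s
  have hYc := hY0.continuousWithinAt
  have hev := H.eventually_normalExp_eq (W := W) hx hYc
  rw [← EventuallyEq.iteratedDerivWithin_eq hev (hev.self_of_nhdsWithin h0s)]
  have hc := H.hasDerivWithinAt_log_curve hx hYc
  have hf := H.hasDerivWithinAt_log_field hx hYc
  have := (H.isNormalExp _ hx).third_order (a2 := a2) (v3 := w3) hs h0s hκ hBκ
    (h := fun ε ↦ L (Y 0) (Y ε)) (v := fun ε ↦ fderiv ℝ (L (Y 0)) (Y ε) (W ε))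
    (a := fun ε ↦ fderiv ℝ (L (Y 0)) (Y ε) (A ε)) (a₁ := fun ε ↦ fderiv ℝ (L (Y 0)) (Y ε) (A₁ ε))
    (v₁ := fun ε ↦ fderiv ℝ (L (Y 0)) (Y ε) (W₁ ε)) (v₂ := fun ε ↦ fderiv ℝ (L (Y 0)) (Y ε) (W₂ ε))
    (H.log_self hx) (by filter_upwards [hY, hc] with ε h1 h2 using h2 _ h1)
    (by filter_upwards [hY, hA, hf] with ε h1 h2 h3 using h3 _ _ _ h1 h2)
    ((hf.self_of_nhdsWithin h0s A₁ _ a2 hY0 hA1).congr_deriv (by rw [H.fderiv_log_self hx a2]))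
    (by filter_upwards [hY, hW, hf] with ε h1 h2 h3 using h3 _ _ _ h1 h2)
    (by filter_upwards [hY, hW1, hf] with ε h1 h2 h3 using h3 _ _ _ h1 h2)
    ((hf.self_of_nhdsWithin h0s W₂ _ w3 hY0 hW2).congr_deriv (by rw [H.fderiv_log_self hx w3]))
    (by rwa [H.fderiv_log_self hx]) (by rwa [H.fderiv_log_self hx])
    (by rwa [H.fderiv_log_self hx]) (by rwa [H.fderiv_log_self hx]) ba2
    (by rwa [H.fderiv_log_self hx])
  simpa only [H.fderiv_log_self hx, H.curvatureCoord_normal hΓ hx] using this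

end IsNormalFamily

end Coordinates

/-! ### Normal coordinates on the manifold -/

section NormalChart

variable {E : Type*} [NormedAddCommGroup E] [NormedSpace ℝ E]
  {M : Type*} [TopologicalSpace M] [ChartedSpace E M] [IsManifold 𝓘(ℝ, E) ∞ M]
  [RiemannianBundle (fun x : M ↦ TangentSpace 𝓘(ℝ, E) x)]
  [IsContMDiffRiemannianBundle 𝓘(ℝ, E) ∞ E (fun x : M ↦ TangentSpace 𝓘(ℝ, E) x)]

/-- Near `p`, the Riemannian norms are uniformly equivalent to the norm of the model space. -/
lemma exists_norm_chartEquiv_le (p : M) : ∃ C : ℝ, 1 ≤ C ∧ ∀ᶠ x in 𝓝 p,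
    ∀ (hx : x ∈ (extChartAt 𝓘(ℝ, E) p).source) (u : TangentSpace 𝓘(ℝ, E) x),
      ‖chartEquiv E p x hx u‖ ≤ C * ‖u‖ ∧ ‖u‖ ≤ C * ‖chartEquiv E p x hx u‖ := by
  have : IsContinuousRiemannianBundle E (fun x : M ↦ TangentSpace 𝓘(ℝ, E) x) := by
    obtain ⟨g, hg, h⟩ := IsContMDiffRiemannianBundle.exists_contMDiff (IB := 𝓘(ℝ, E)) (n := ∞)
      (F := E) (E := fun x : M ↦ TangentSpace 𝓘(ℝ, E) x)
    exact ⟨g, hg.continuous, h⟩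
  obtain ⟨C₁, h₁, H₁⟩ := eventually_norm_trivializationAt_lt E
    (fun x : M ↦ TangentSpace 𝓘(ℝ, E) x) p
  obtain ⟨C₂, h₂, H₂⟩ := eventually_norm_symmL_trivializationAt_lt E
    (fun x : M ↦ TangentSpace 𝓘(ℝ, E) x) p
  refine ⟨max 1 (max C₁ C₂), le_max_left _ _, ?_⟩
  filter_upwards [H₁, H₂] with x k₁ k₂ hx u
  have hb : x ∈ (trivializationAt E (TangentSpace 𝓘(ℝ, E)) p).baseSet := by
    rwa [extChartAt_source] at hx
  have e1 : chartEquiv E p x hx u =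
      (trivializationAt E (TangentSpace 𝓘(ℝ, E)) p).continuousLinearMapAt ℝ x u :=
    congrFun ((trivializationAt E (TangentSpace 𝓘(ℝ, E))
      p).coe_continuousLinearEquivAt_eq hb) u
  have e2 : u = (trivializationAt E (TangentSpace 𝓘(ℝ, E)) p).symmL ℝ x
      (chartEquiv E p x hx u) := by
    rw [e1]
    exact ((trivializationAt E (TangentSpace 𝓘(ℝ, E)) p).symmL_continuousLinearMapAt hb u).symm
  constructor
  · have h := ContinuousLinearMap.le_opNorm
      ((trivializationAt E (TangentSpace 𝓘(ℝ, E)) p).continuousLinearMapAt ℝ x) u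
    rw [e1]
    refine h.trans ?_
    gcongr
    exact k₁.le.trans ((le_max_left _ _).trans (le_max_right _ _))
  · have h := ContinuousLinearMap.le_opNorm
      ((trivializationAt E (TangentSpace 𝓘(ℝ, E)) p).symmL ℝ x) (chartEquiv E p x hx u)
    rw [← e2] at h
    refine h.trans ?_
    gcongr
    exact k₂.le.trans ((le_max_right _ _).trans (le_max_right _ _))

variable [FiniteDimensional ℝ E]

/-- The chart centred at `p` has uniform normal coordinates around the points of `N`: the connector
`Γ` agrees with the Levi-Civita connector of the chart on `U`, the maps `e` and `L` are its local
exponential and logarithm maps, and `C` compares the norms. -/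
structure IsNormalChart (p : M) (N : Set M) (Γ : E → E →L[ℝ] E →L[ℝ] E) (U : Set E) (r B C : ℝ)
    (e L : E → E → E) : Prop where
  contDiff : ContDiff ℝ ∞ Γ
  isOpen : IsOpen U
  subset_target : U ⊆ (extChartAt 𝓘(ℝ, E) p).target
  conn_eq : ∀ z ∈ U, Γ z = connCoord p z
  family : IsNormalFamily Γ (extChartAt 𝓘(ℝ, E) p p) U r B e L
  mem_source : ∀ x ∈ N, x ∈ (extChartAt 𝓘(ℝ, E) p).source
  norm_lt : ∀ x ∈ N, ‖extChartAt 𝓘(ℝ, E) p x - extChartAt 𝓘(ℝ, E) p p‖ < r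
  one_le : 1 ≤ C
  norm_le : ∀ (x : M) (hx : x ∈ N) (u : TangentSpace 𝓘(ℝ, E) x),
    ‖chartEquiv E p x (mem_source x hx) u‖ ≤ C * ‖u‖
  norm_le' : ∀ (x : M) (hx : x ∈ N) (u : TangentSpace 𝓘(ℝ, E) x),
    ‖u‖ ≤ C * ‖chartEquiv E p x (mem_source x hx) u‖

lemma exists_isNormalChart (p : M) : ∃ (N : Set M) (Γ : E → E →L[ℝ] E →L[ℝ] E) (U : Set E)
    (r B C : ℝ) (e L : E → E → E), N ∈ 𝓝 p ∧ IsNormalChart p N Γ U r B C e L := by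
  obtain ⟨Γ, U, hΓ, hs, hUo, hpU, hUt, hΓU⟩ := exists_global_connCoord (E := E) p
  obtain ⟨r, B, e, L, H⟩ := exists_isNormalFamily hΓ hs (hUo.mem_nhds hpU)
  obtain ⟨C, hC, hev⟩ := exists_norm_chartEquiv_le (E := E) p
  have h1 : ∀ᶠ x in 𝓝 p, x ∈ (extChartAt 𝓘(ℝ, E) p).source := extChartAt_source_mem_nhds p
  have h2 : ∀ᶠ x in 𝓝 p, ‖extChartAt 𝓘(ℝ, E) p x - extChartAt 𝓘(ℝ, E) p p‖ < r := by
    have := (continuousAt_extChartAt (I := 𝓘(ℝ, E)) p).eventually (Metric.ball_mem_nhds _ H.pos)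
    exact this.mono fun x hx ↦ by rwa [← dist_eq_norm]
  exact ⟨_, Γ, U, r, B, C, e, L, (h1.and h2).and hev, hΓ, hUo, hUt, hΓU, H, fun x hx ↦ hx.1.1,
    fun x hx ↦ hx.1.2, hC, fun x hx u ↦ (hx.2 hx.1.1 u).1, fun x hx u ↦ (hx.2 hx.1.1 u).2⟩

lemma chartEquiv_curvature {p x : M} (hx : x ∈ (extChartAt 𝓘(ℝ, E) p).source)
    (u v w : TangentSpace 𝓘(ℝ, E) x) :
    chartEquiv E p x hx (curvature x u v w) = curvatureCoord (connCoord p) (extChartAt 𝓘(ℝ, E) p x)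
      (chartEquiv E p x hx u) (chartEquiv E p x hx v) (chartEquiv E p x hx w) := by
  have h := chartDeriv_curvature hx u v w
  rw [← chartEquiv_apply hx, ← chartEquiv_apply hx, ← chartEquiv_apply hx,
    ← chartEquiv_apply hx] at h
  exact h

/-- A unique shortest preimage is the value of the inverse exponential map. -/
lemma IsExpInv.riemExpInv_eq {E : Type*} [NormedAddCommGroup E] [NormedSpace ℝ E]
    {M : Type*} [TopologicalSpace M] [ChartedSpace E M]
    [RiemannianBundle (fun x : M ↦ TangentSpace 𝓘(ℝ, E) x)] {x q : M} {v : TangentSpace 𝓘(ℝ, E) x}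
    (h : IsExpInv x q v) : riemExpInv x q = v := by
  have hex : ∃ v : TangentSpace 𝓘(ℝ, E) x, IsExpInv x q v := ⟨v, h⟩
  rw [riemExpInv, dif_pos hex]
  by_contra hne
  have h' := hex.choose_spec
  exact lt_asymm (h.2.2 _ h'.1 h'.2.1 hne) (h'.2.2 _ h.1 h.2.1 (Ne.symm hne))

namespace IsNormalChart

variable {p : M} {N : Set M} {Γ : E → E →L[ℝ] E →L[ℝ] E} {U : Set E} {r B C : ℝ}
  {e L : E → E → E} {x : M}

/-- The exponential map in the chart. -/
lemma riemExp_eq [T2Space M] (H : IsNormalChart p N Γ U r B C e L)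
    (hs : x ∈ (extChartAt 𝓘(ℝ, E) p).source)
    (hx : ‖extChartAt 𝓘(ℝ, E) p x - extChartAt 𝓘(ℝ, E) p p‖ < r) (v : TangentSpace 𝓘(ℝ, E) x)
    (hv : ‖chartEquiv E p x hs v‖ < r) :
    (⟨x, v⟩ : TangentBundle 𝓘(ℝ, E) M) ∈ expDomain E M ∧ riemExp x v =
      (extChartAt 𝓘(ℝ, E) p).symm (e (extChartAt 𝓘(ℝ, E) p x) (chartEquiv E p x hs v)) := by
  set X := extChartAt 𝓘(ℝ, E) p x with hX
  set w := chartEquiv E p x hs v with hw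
  have HX := H.family.isExpAt X hx
  have hU : ∀ t ∈ Icc (0 : ℝ) 1, e X (t • w) ∈ U := fun t ht ↦
    H.family.mem X hx _ (IsExpAt.norm_smul_lt hv ht)
  have hpair : IsGeodesicPair (connCoord p) (fun t ↦ e X (t • w))
      (fun t ↦ fderiv ℝ (e X) (t • w) w) 0 1 := by
    intro t ht
    have := HX.isGeodesicPair hv t ht
    rwa [H.conn_eq _ (hU t ht)] at this
  have hsm : ContDiffOn ℝ 2 (fun t : ℝ ↦ e X (t • w)) (Icc 0 1) := fun t ht ↦
    (((HX.contDiffAt _ (IsExpAt.norm_smul_lt hv ht)).of_le (by norm_num)).comp t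
      (contDiffAt_id.smul contDiffAt_const)).contDiffWithinAt
  have hgeo := isGeodesicFrom_of_isGeodesicPair (P := (⟨x, v⟩ : TangentBundle 𝓘(ℝ, E) M)) hsm
    (fun t ht ↦ H.subset_target (hU t ht)) hpair
    (by rw [zero_smul, HX.apply_zero, hX, (extChartAt 𝓘(ℝ, E) p).left_inv hs])
    (by rw [zero_smul, HX.fderiv_zero]; exact (chartEquiv_apply hs v).symm)
  refine ⟨⟨_, hgeo⟩, ?_⟩
  rw [hgeo.riemExp_eq, one_smul]

/-- Inside a ball that is small compared with `r`, the logarithm map gives the unique shortest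
preimage under the exponential map. -/
lemma isExpInv [T2Space M] (H : IsNormalChart p N Γ U r B C e L) (hx : x ∈ N) {z : E}
    (hz : C * C * ‖z‖ < r) :
    IsExpInv x ((extChartAt 𝓘(ℝ, E) p).symm (e (extChartAt 𝓘(ℝ, E) p x) z))
      ((chartEquiv E p x (H.mem_source x hx)).symm z) := by
  set T := chartEquiv E p x (H.mem_source x hx) with hT
  have hX := H.norm_lt x hx
  have hC0 : 0 ≤ C := zero_le_one.trans H.one_le
  have hzr : ‖z‖ < r := by
    refine lt_of_le_of_lt ?_ hz
    exact le_mul_of_one_le_left (norm_nonneg _) (one_le_mul_of_one_le_of_one_le H.one_le H.one_le)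
  have h1 := H.riemExp_eq (H.mem_source x hx) hX (T.symm z) (by
    rw [← hT, T.apply_symm_apply]; exact hzr)
  rw [← hT, T.apply_symm_apply] at h1
  refine ⟨h1.1, h1.2, fun w _ hw hne ↦ ?_⟩
  by_contra! hle
  -- a preimage that is not longer has small coordinates, hence is the same
  have hTw : ‖T w‖ < r := by
    calc ‖T w‖ ≤ C * ‖w‖ := H.norm_le x hx w
      _ ≤ C * ‖T.symm z‖ := by gcongr
      _ ≤ C * (C * ‖T (T.symm z)‖) := by gcongr; exact H.norm_le' x hx _
      _ = C * C * ‖z‖ := by rw [T.apply_symm_apply, mul_assoc]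
      _ < r := hz
  have h2 := (H.riemExp_eq (H.mem_source x hx) hX w hTw).2
  rw [← hT, hw] at h2
  have h3 : e (extChartAt 𝓘(ℝ, E) p x) z = e (extChartAt 𝓘(ℝ, E) p x) (T w) :=
    (extChartAt 𝓘(ℝ, E) p).symm.injOn (H.subset_target (H.family.mem _ hX _ hzr))
      (H.subset_target (H.family.mem _ hX _ hTw)) h2
  have h4 := congrArg (L (extChartAt 𝓘(ℝ, E) p x)) h3
  rw [H.family.log_exp _ hX _ hzr, H.family.log_exp _ hX _ hTw] at h4
  exact hne (by rw [h4, T.symm_apply_apply])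

end IsNormalChart

end NormalChart

lemma iteratedDerivWithin_equiv_comp {F G : Type*} [NormedAddCommGroup F] [NormedSpace ℝ F]
    [NormedAddCommGroup G] [NormedSpace ℝ G] (T : F ≃L[ℝ] G) (f : ℝ → F) {s : Set ℝ} {t : ℝ}
    (hs : UniqueDiffOn ℝ s) (ht : t ∈ s) (k : ℕ) :
    iteratedDerivWithin k (fun t ↦ T (f t)) s t = T (iteratedDerivWithin k f s t) := by
  rw [iteratedDerivWithin, iteratedDerivWithin]
  exact congrArg (fun m ↦ m fun _ ↦ (1 : ℝ)) (T.iteratedFDerivWithin_comp_left f hs ht k)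

lemma curvatureCoord_congr {E : Type*} [NormedAddCommGroup E] [NormedSpace ℝ E]
    {Γ Γ' : E → E →L[ℝ] E →L[ℝ] E} {z : E} (h : Γ =ᶠ[𝓝 z] Γ') (u v w : E) :
    curvatureCoord Γ z u v w = curvatureCoord Γ' z u v w := by
  rw [curvatureCoord, curvatureCoord, h.fderiv_eq, h.self_of_nhds]

/-! ### The expansions on the manifold -/

section Zeta

variable {E : Type*} [NormedAddCommGroup E] [NormedSpace ℝ E] [FiniteDimensional ℝ E]
  {M : Type*} [TopologicalSpace M] [ChartedSpace E M] [IsManifold 𝓘(ℝ, E) ∞ M]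
  [RiemannianBundle (fun x : M ↦ TangentSpace 𝓘(ℝ, E) x)]
  [IsContMDiffRiemannianBundle 𝓘(ℝ, E) ∞ E (fun x : M ↦ TangentSpace 𝓘(ℝ, E) x)]

namespace IsNormalChart

variable {p : M} {N : Set M} {Γ : E → E →L[ℝ] E →L[ℝ] E} {U : Set E} {r B C : ℝ}
  {e L : E → E → E} {x : M} {y : ℝ → M} {V : ∀ t, TangentSpace 𝓘(ℝ, E) (y t)} {δ : ℝ}

omit [FiniteDimensional ℝ E]
  [IsContMDiffRiemannianBundle 𝓘(ℝ, E) ∞ E (fun x : M ↦ TangentSpace 𝓘(ℝ, E) x)] in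
lemma chart_mem (H : IsNormalChart p N Γ U r B C e L) (hx : x ∈ N) :
    extChartAt 𝓘(ℝ, E) p x ∈ U := by
  have h := H.family.mem _ (H.norm_lt x hx) 0 (by simpa using H.family.pos)
  rwa [H.family.exp_zero (H.norm_lt x hx)] at h

/-- The curvature of `M` in the normal chart. -/
lemma chartEquiv_curvature (H : IsNormalChart p N Γ U r B C e L) (hx : x ∈ N)
    (u v w : TangentSpace 𝓘(ℝ, E) x) :
    chartEquiv E p x (H.mem_source x hx) (curvature x u v w) =
      curvatureCoord Γ (extChartAt 𝓘(ℝ, E) p x) (chartEquiv E p x (H.mem_source x hx) u)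
        (chartEquiv E p x (H.mem_source x hx) v) (chartEquiv E p x (H.mem_source x hx) w) := by
  rw [RiemGeom.chartEquiv_curvature]
  refine (curvatureCoord_congr ?_ _ _ _).symm
  filter_upwards [H.isOpen.mem_nhds (H.chart_mem hx)] with z hz using H.conn_eq z hz

lemma eventually_hasDerivWithinAt_field (H : IsNormalChart p N Γ U r B C e L)
    (hy : ContMDiffOn 𝓘(ℝ, ℝ) 𝓘(ℝ, E) 1 y (Icc 0 1)) (h0 : y 0 ∈ N)
    (hV : ContDiffWithinAt ℝ 1 (fieldCoord p y V) (Icc 0 1) 0) :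
    ∀ᶠ ε in 𝓝[Icc 0 1] 0, HasDerivWithinAt (fieldCoord p y V) (fieldCoord p y (covDeriv y V) ε
      - Γ (curveCoord E p y ε) (fieldCoord p y V ε) (fieldCoord p y (velocity E y) ε))
      (Icc 0 1) ε := by
  have h0' : (0 : ℝ) ∈ Icc (0 : ℝ) 1 := by simp
  have hp := H.mem_source _ h0
  have hY : ContDiffWithinAt ℝ 1 (curveCoord E p y) (Icc 0 1) 0 := by
    exact_mod_cast contDiffWithinAt_curveCoord (k := 1) (by exact_mod_cast hy 0 h0') hp
  have hev := hV.eventually (by simp)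
  rw [insert_eq_of_mem h0'] at hev
  filter_upwards [hev, eventually_curve_mem_source (hy 0 h0').continuousWithinAt hp,
    hY.continuousWithinAt.eventually (H.isOpen.mem_nhds (H.chart_mem h0)), self_mem_nhdsWithin]
    with ε h1 h2 h3 h4
  rw [H.conn_eq _ h3]
  exact hasDerivWithinAt_fieldCoord h4 ((hy ε h4).mdifferentiableWithinAt (by simp)) h2
    (h1.differentiableWithinAt (by simp))

omit [FiniteDimensional ℝ E]
  [IsContMDiffRiemannianBundle 𝓘(ℝ, E) ∞ E (fun x : M ↦ TangentSpace 𝓘(ℝ, E) x)] in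
lemma eventually_hasDerivWithinAt_curve (H : IsNormalChart p N Γ U r B C e L)
    (hy : ContMDiffOn 𝓘(ℝ, ℝ) 𝓘(ℝ, E) 1 y (Icc 0 1)) (h0 : y 0 ∈ N) :
    ∀ᶠ ε in 𝓝[Icc 0 1] 0,
      HasDerivWithinAt (curveCoord E p y) (fieldCoord p y (velocity E y) ε) (Icc 0 1) ε := by
  have h0' : (0 : ℝ) ∈ Icc (0 : ℝ) 1 := by simp
  filter_upwards [eventually_curve_mem_source (hy 0 h0').continuousWithinAt (H.mem_source _ h0),
    self_mem_nhdsWithin] with ε h2 h4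
  exact hasDerivWithinAt_curveCoord h4 ((hy ε h4).mdifferentiableWithinAt (by simp)) h2

/-- In the normal chart, `ζ` is the logarithm of the exponential. In particular `ζ(ε)` is the unique
shortest preimage for small `ε`. -/
lemma eventually_zeta [T2Space M] (H : IsNormalChart p N Γ U r B C e L) (h0 : y 0 ∈ N)
    (hy : ContinuousWithinAt y (Icc 0 1) 0)
    (hY : ContinuousWithinAt (curveCoord E p y) (Icc 0 1) 0)
    (hW : ContinuousWithinAt (fieldCoord p y V) (Icc 0 1) 0)
    (hV : C * C * ‖fieldCoord p y V 0‖ < r) :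
    ∀ᶠ ε in 𝓝[Icc 0 1] (0 : ℝ), (⟨y ε, V ε⟩ : TangentBundle 𝓘(ℝ, E) M) ∈ expDomain E M ∧
      IsExpInv (y 0) (riemExp (y ε) (V ε)) (zeta y V ε) ∧
      zeta y V ε = (chartEquiv E p (y 0) (H.mem_source _ h0)).symm
        (L (curveCoord E p y 0) (e (curveCoord E p y ε) (fieldCoord p y V ε))) := by
  set X := curveCoord E p y 0 with hX
  set w := fieldCoord p y V 0 with hw
  have hXr : ‖X - extChartAt 𝓘(ℝ, E) p p‖ < r := H.norm_lt _ h0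
  have hwr : ‖w‖ < r := lt_of_le_of_lt (le_mul_of_one_le_left (norm_nonneg _)
    (one_le_mul_of_one_le_of_one_le H.one_le H.one_le)) hV
  have hexp : ContinuousWithinAt (fun ε ↦ e (curveCoord E p y ε) (fieldCoord p y V ε))
      (Icc 0 1) 0 :=
    ContinuousAt.comp_continuousWithinAt (g := fun P : E × E ↦ e P.1 P.2)
      (f := fun ε ↦ (curveCoord E p y ε, fieldCoord p y V ε))
      (H.family.exp_contDiffAt _ hXr _ hwr).continuousAt (hY.prodMk hW)
  have hlog : ContinuousWithinAt (fun ε ↦ L X (e (curveCoord E p y ε) (fieldCoord p y V ε)))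
      (Icc 0 1) 0 :=
    ContinuousAt.comp_continuousWithinAt (g := L X)
      (H.family.log_contDiffAt _ hXr _ hwr).continuousAt hexp
  have hlt : ∀ᶠ ε in 𝓝[Icc 0 1] (0 : ℝ),
      C * C * ‖L X (e (curveCoord E p y ε) (fieldCoord p y V ε))‖ < r := by
    refine (continuousWithinAt_const.mul hlog.norm).eventually (gt_mem_nhds ?_)
    change C * C * ‖L X (e X w)‖ < r
    rwa [H.family.log_exp _ hXr _ hwr]
  have hYr : ∀ᶠ ε in 𝓝[Icc 0 1] (0 : ℝ),
      ‖curveCoord E p y ε - extChartAt 𝓘(ℝ, E) p p‖ < r :=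
    (hY.sub continuousWithinAt_const).norm.eventually (gt_mem_nhds hXr)
  filter_upwards [hexp.eventually (H.family.exp_log _ hXr _ hwr), hlt, hYr,
    hW.norm.eventually (gt_mem_nhds hwr), eventually_curve_mem_source hy (H.mem_source _ h0)]
    with ε h1 h2 h3 h4 h5
  have hε := H.riemExp_eq h5 h3 (V ε) (by rw [chartEquiv_apply]; exact h4)
  have hinv := H.isExpInv h0 h2
  have hq : riemExp (y ε) (V ε) = (extChartAt 𝓘(ℝ, E) p).symm
      (e X (L X (e (curveCoord E p y ε) (fieldCoord p y V ε)))) := by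
    rw [h1, hε.2, chartEquiv_apply]
    rfl
  have hinv' : IsExpInv (y 0) (riemExp (y ε) (V ε)) ((chartEquiv E p (y 0)
      (H.mem_source _ h0)).symm (L X (e (curveCoord E p y ε) (fieldCoord p y V ε)))) := by
    rw [hq]
    exact hinv
  have hz : zeta y V ε = _ := hinv'.riemExpInv_eq
  refine ⟨hε.1, ?_, hz⟩
  rw [hz]
  exact hinv'

/-- Estimates in the normal chart transfer to the manifold. -/
lemma zeta_of_chart [T2Space M] (H : IsNormalChart p N Γ U r B C e L) (h0 : y 0 ∈ N) {k : ℕ}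
    (hk : k ≤ 3) (hV : IsFieldAlong k y V) (bV : C * C * ‖fieldCoord p y V 0‖ < r)
    {c : ℝ} {u : TangentSpace 𝓘(ℝ, E) (y 0)}
    (h : ‖iteratedDerivWithin k (fun ε ↦ L (curveCoord E p y 0)
      (e (curveCoord E p y ε) (fieldCoord p y V ε))) (Icc 0 1) 0
        - chartEquiv E p (y 0) (H.mem_source _ h0) u‖ ≤ c) :
    ContDiffWithinAt ℝ k (zeta y V) (Icc 0 1) 0 ∧
      ‖iteratedDerivWithin k (zeta y V) (Icc 0 1) 0 - u‖ ≤ C * c := by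
  have h0' : (0 : ℝ) ∈ Icc (0 : ℝ) 1 := by simp
  have hy := hV.contMDiffWithinAt h0'
  have hY := contDiffWithinAt_curveCoord hy (H.mem_source _ h0)
  have hW := hV.contDiffWithinAt_fieldCoord h0' (H.mem_source _ h0)
  set T := chartEquiv E p (y 0) (H.mem_source _ h0) with hT
  set f : ℝ → E := fun ε ↦ L (curveCoord E p y 0)
    (e (curveCoord E p y ε) (fieldCoord p y V ε)) with hf
  have hev : zeta y V =ᶠ[𝓝[Icc 0 1] 0] fun ε ↦ T.symm (f ε) :=
    (H.eventually_zeta h0 hy.continuousWithinAt hY.continuousWithinAt hW.continuousWithinAt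
      bV).mono fun ε hε ↦ hε.2.2
  have hwr : ‖fieldCoord p y V 0‖ < r := lt_of_le_of_lt (le_mul_of_one_le_left (norm_nonneg _)
    (one_le_mul_of_one_le_of_one_le H.one_le H.one_le)) bV
  have hfc : ContDiffWithinAt ℝ k f (Icc 0 1) 0 :=
    H.family.contDiffWithinAt_log_exp hk (H.norm_lt _ h0) hwr hY hW
  constructor
  · exact ((T.symm.contDiff (n := k)).contDiffAt.comp_contDiffWithinAt 0 hfc).congr_of_eventuallyEq
      hev (hev.self_of_nhdsWithin h0')
  · rw [hev.iteratedDerivWithin_eq (hev.self_of_nhdsWithin h0'),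
      iteratedDerivWithin_equiv_comp T.symm f uniqueDiffOn_Icc_zero_one h0']
    refine (H.norm_le' _ h0 _).trans (mul_le_mul_of_nonneg_left ?_ (zero_le_one.trans H.one_le))
    rw [map_sub, ← hT, T.apply_symm_apply]
    exact h

end IsNormalChart

end Zeta

section Zeta

variable {E : Type*} [NormedAddCommGroup E] [NormedSpace ℝ E] [FiniteDimensional ℝ E]
  {M : Type*} [TopologicalSpace M] [T2Space M] [ChartedSpace E M] [IsManifold 𝓘(ℝ, E) ∞ M]
  [RiemannianBundle (fun x : M ↦ TangentSpace 𝓘(ℝ, E) x)]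
  [IsContMDiffRiemannianBundle 𝓘(ℝ, E) ∞ E (fun x : M ↦ TangentSpace 𝓘(ℝ, E) x)]

namespace IsNormalChart

variable {p : M} {N : Set M} {Γ : E → E →L[ℝ] E →L[ℝ] E} {U : Set E} {r B C : ℝ}
  {e L : E → E → E} {y : ℝ → M} {V : ∀ t, TangentSpace 𝓘(ℝ, E) (y t)} {δ : ℝ}

omit [FiniteDimensional ℝ E] [T2Space M]
  [IsContMDiffRiemannianBundle 𝓘(ℝ, E) ∞ E (fun x : M ↦ TangentSpace 𝓘(ℝ, E) x)] in
lemma norm_fieldCoord_le (H : IsNormalChart p N Γ U r B C e L) (h0 : y 0 ∈ N)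
    {Z : ∀ t, TangentSpace 𝓘(ℝ, E) (y t)} (hZ : ‖Z 0‖ ≤ δ) : ‖fieldCoord p y Z 0‖ ≤ C * δ := by
  have h := H.norm_le _ h0 (Z 0)
  rw [chartEquiv_apply] at h
  exact h.trans (mul_le_mul_of_nonneg_left hZ (zero_le_one.trans H.one_le))

omit [FiniteDimensional ℝ E] [T2Space M]
  [IsContMDiffRiemannianBundle 𝓘(ℝ, E) ∞ E (fun x : M ↦ TangentSpace 𝓘(ℝ, E) x)] in
lemma lt_radius (H : IsNormalChart p N Γ U r B C e L) (hδ0 : 0 ≤ δ)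
    (hδ : C * C * (C * δ) < r) : C * δ < r :=
  lt_of_le_of_lt (le_mul_of_one_le_left (mul_nonneg (zero_le_one.trans H.one_le) hδ0)
    (one_le_mul_of_one_le_of_one_le H.one_le H.one_le)) hδ

omit [FiniteDimensional ℝ E] [T2Space M]
  [IsContMDiffRiemannianBundle 𝓘(ℝ, E) ∞ E (fun x : M ↦ TangentSpace 𝓘(ℝ, E) x)] in
lemma norm_fieldCoord_lt (H : IsNormalChart p N Γ U r B C e L) (h0 : y 0 ∈ N)
    (hδ : C * C * (C * δ) < r) (bv : ‖V 0‖ ≤ δ) : C * C * ‖fieldCoord p y V 0‖ < r :=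
  lt_of_le_of_lt (mul_le_mul_of_nonneg_left (H.norm_fieldCoord_le h0 bv) (mul_self_nonneg C)) hδ

omit [FiniteDimensional ℝ E] [T2Space M]
  [RiemannianBundle (fun x : M ↦ TangentSpace 𝓘(ℝ, E) x)]
  [IsContMDiffRiemannianBundle 𝓘(ℝ, E) ∞ E (fun x : M ↦ TangentSpace 𝓘(ℝ, E) x)] in
lemma _root_.RiemGeom.IsFieldAlong.contMDiffOn {k : ℕ} (h : IsFieldAlong k y V) :
    ContMDiffOn 𝓘(ℝ, ℝ) 𝓘(ℝ, E) k y (Icc 0 1) :=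
  fun _ ht ↦ h.contMDiffWithinAt ht

theorem zeta_first_order (H : IsNormalChart p N Γ U r B C e L) (h0 : y 0 ∈ N)
    (hδ : C * C * (C * δ) < r) (hV : IsFieldAlong 1 y V)
    (ba : ‖velocity E y 0‖ ≤ δ) (bv : ‖V 0‖ ≤ δ) :
    ContDiffWithinAt ℝ 1 (zeta y V) (Icc 0 1) 0 ∧
      ‖iteratedDerivWithin 1 (zeta y V) (Icc 0 1) 0 - (velocity E y 0 + covDeriv y V 0
        - (1 / 3 : ℝ) • curvature (y 0) (V 0) (velocity E y 0) (V 0))‖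
          ≤ C * (B * (C * δ) ^ 4) := by
  have h0' : (0 : ℝ) ∈ Icc (0 : ℝ) 1 := by simp
  have hp := H.mem_source _ h0
  have hy : ContMDiffOn 𝓘(ℝ, ℝ) 𝓘(ℝ, E) 1 y (Icc 0 1) := by exact_mod_cast hV.contMDiffOn
  refine And.imp_left (fun h ↦ by exact_mod_cast h)
    (H.zeta_of_chart h0 (k := 1) (by norm_num) hV (H.norm_fieldCoord_lt h0 hδ bv) ?_)
  have hW := hV.contDiffWithinAt_fieldCoord h0' hp
  have h := H.family.first_order H.contDiff uniqueDiffOn_Icc_zero_one h0' (H.norm_lt _ h0)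
    (H.lt_radius ((norm_nonneg _).trans bv) hδ)
    ((H.eventually_hasDerivWithinAt_curve hy h0).self_of_nhdsWithin h0')
    ((H.eventually_hasDerivWithinAt_field hy h0 (mod_cast hW)).self_of_nhdsWithin h0')
    (H.norm_fieldCoord_le h0 ba) (H.norm_fieldCoord_le h0 bv)
  simp only [map_add, map_sub, map_smul, H.chartEquiv_curvature h0]
  simp only [chartEquiv_apply]
  exact h

theorem zeta_second_order (H : IsNormalChart p N Γ U r B C e L) (h0 : y 0 ∈ N)
    (hδ : C * C * (C * δ) < r) (hV : IsFieldAlong 2 y V)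
    (ba : ‖velocity E y 0‖ ≤ δ) (bv : ‖V 0‖ ≤ δ) (bv1 : ‖covDeriv y V 0‖ ≤ δ)
    (ba1 : ‖covDeriv y (velocity E y) 0‖ ≤ δ) :
    ContDiffWithinAt ℝ 2 (zeta y V) (Icc 0 1) 0 ∧
      ‖iteratedDerivWithin 2 (zeta y V) (Icc 0 1) 0 -
        (covDeriv y (velocity E y) 0 + covDeriv y (covDeriv y V) 0
          - (1 / 3 : ℝ) • curvature (y 0) (V 0) (covDeriv y (velocity E y) 0) (V 0)
          - (2 / 3 : ℝ) • curvature (y 0) (covDeriv y V 0) (velocity E y 0) (V 0)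
          + (1 / 3 : ℝ) • curvature (y 0) (velocity E y 0) (V 0)
            (velocity E y 0 + (2 : ℝ) • covDeriv y V 0))‖ ≤ C * (2 * B * (C * δ) ^ 4) := by
  have h0' : (0 : ℝ) ∈ Icc (0 : ℝ) 1 := by simp
  have hp := H.mem_source _ h0
  have hy2 : ContMDiffOn 𝓘(ℝ, ℝ) 𝓘(ℝ, E) (1 + 1 : ℕ) y (Icc 0 1) := hV.contMDiffOn
  have hy : ContMDiffOn 𝓘(ℝ, ℝ) 𝓘(ℝ, E) 1 y (Icc 0 1) := hy2.of_le (by norm_cast)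
  refine And.imp_left (fun h ↦ by exact_mod_cast h)
    (H.zeta_of_chart h0 (k := 2) (by norm_num) hV (H.norm_fieldCoord_lt h0 hδ bv) ?_)
  have hW : ContDiffWithinAt ℝ (1 + 1 : ℕ) (fieldCoord p y V) (Icc 0 1) 0 :=
    hV.contDiffWithinAt_fieldCoord h0' hp
  have hW1 := contDiffWithinAt_covDeriv hy2 h0' hp hW
  have hA := contDiffWithinAt_velocity hy2 h0' hp
  have h := H.family.second_order H.contDiff uniqueDiffOn_Icc_zero_one h0' (H.norm_lt _ h0)
    (H.lt_radius ((norm_nonneg _).trans bv) hδ)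
    (H.eventually_hasDerivWithinAt_curve hy h0)
    ((H.eventually_hasDerivWithinAt_field hy h0 (mod_cast hA)).self_of_nhdsWithin h0')
    (H.eventually_hasDerivWithinAt_field hy h0 (hW.of_le (by norm_cast)))
    ((H.eventually_hasDerivWithinAt_field hy h0 (mod_cast hW1)).self_of_nhdsWithin h0')
    (H.norm_fieldCoord_le h0 ba) (H.norm_fieldCoord_le h0 bv) (H.norm_fieldCoord_le h0 bv1)
    (H.norm_fieldCoord_le h0 ba1)
  simp only [map_add, map_sub, map_smul, H.chartEquiv_curvature h0]
  simp only [chartEquiv_apply]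
  exact h

theorem zeta_third_order (H : IsNormalChart p N Γ U r B C e L) (h0 : y 0 ∈ N)
    (hδ : C * C * (C * δ) < r) (hBδ : B * (C * δ) ≤ 1) (hV : IsFieldAlong 3 y V)
    (ba : ‖velocity E y 0‖ ≤ δ) (bv : ‖V 0‖ ≤ δ) (bv1 : ‖covDeriv y V 0‖ ≤ δ)
    (ba1 : ‖covDeriv y (velocity E y) 0‖ ≤ δ)
    (ba2 : ‖covDeriv y (covDeriv y (velocity E y)) 0‖ ≤ δ)
    (bv2 : ‖covDeriv y (covDeriv y V) 0‖ ≤ δ) :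
    ContDiffWithinAt ℝ 3 (zeta y V) (Icc 0 1) 0 ∧
      ‖iteratedDerivWithin 3 (zeta y V) (Icc 0 1) 0 -
        (covDeriv y (covDeriv y (velocity E y)) 0 + covDeriv y (covDeriv y (covDeriv y V)) 0
          + curvature (y 0) (velocity E y 0) (covDeriv y V 0)
            (velocity E y 0 + (2 : ℝ) • covDeriv y V 0)
          + curvature (y 0) (velocity E y 0) (V 0)
            (covDeriv y (velocity E y) 0 + (2 : ℝ) • covDeriv y (covDeriv y V) 0)
          + curvature (y 0) (V 0) (covDeriv y (covDeriv y V) 0) (velocity E y 0)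
          + curvature (y 0) (V 0) (covDeriv y V 0) (covDeriv y (velocity E y) 0)
          + (2 : ℝ) • curvature (y 0) (covDeriv y (velocity E y) 0) (V 0) (covDeriv y V 0)
          - (1 / 3 : ℝ) •
            curvature (y 0) (V 0) (covDeriv y (covDeriv y (velocity E y)) 0) (V 0))‖
        ≤ C * (12 * B * (C * δ) ^ 4) := by
  have h0' : (0 : ℝ) ∈ Icc (0 : ℝ) 1 := by simp
  have hp := H.mem_source _ h0
  have hy3 : ContMDiffOn 𝓘(ℝ, ℝ) 𝓘(ℝ, E) (2 + 1 : ℕ) y (Icc 0 1) := hV.contMDiffOn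
  have hy2 : ContMDiffOn 𝓘(ℝ, ℝ) 𝓘(ℝ, E) (1 + 1 : ℕ) y (Icc 0 1) :=
    hy3.of_le (by norm_cast)
  have hy : ContMDiffOn 𝓘(ℝ, ℝ) 𝓘(ℝ, E) 1 y (Icc 0 1) := hy3.of_le (by norm_cast)
  refine And.imp_left (fun h ↦ by exact_mod_cast h)
    (H.zeta_of_chart h0 (k := 3) (by norm_num) hV (H.norm_fieldCoord_lt h0 hδ bv) ?_)
  have hW : ContDiffWithinAt ℝ (2 + 1 : ℕ) (fieldCoord p y V) (Icc 0 1) 0 :=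
    hV.contDiffWithinAt_fieldCoord h0' hp
  have hW1 : ContDiffWithinAt ℝ (1 + 1 : ℕ) (fieldCoord p y (covDeriv y V)) (Icc 0 1) 0 :=
    contDiffWithinAt_covDeriv hy3 h0' hp hW
  have hW2 := contDiffWithinAt_covDeriv hy2 h0' hp hW1
  have hA : ContDiffWithinAt ℝ (1 + 1 : ℕ) (fieldCoord p y (velocity E y)) (Icc 0 1) 0 :=
    contDiffWithinAt_velocity hy3 h0' hp
  have hA1 := contDiffWithinAt_covDeriv hy2 h0' hp hA
  have h := H.family.third_order H.contDiff uniqueDiffOn_Icc_zero_one h0' (H.norm_lt _ h0)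
    (H.lt_radius ((norm_nonneg _).trans bv) hδ) hBδ
    (H.eventually_hasDerivWithinAt_curve hy h0)
    (H.eventually_hasDerivWithinAt_field hy h0 (hA.of_le (by norm_cast)))
    ((H.eventually_hasDerivWithinAt_field hy h0 (mod_cast hA1)).self_of_nhdsWithin h0')
    (H.eventually_hasDerivWithinAt_field hy h0 (hW.of_le (by norm_cast)))
    (H.eventually_hasDerivWithinAt_field hy h0 (hW1.of_le (by norm_cast)))
    ((H.eventually_hasDerivWithinAt_field hy h0 (mod_cast hW2)).self_of_nhdsWithin h0')
    (H.norm_fieldCoord_le h0 ba) (H.norm_fieldCoord_le h0 bv) (H.norm_fieldCoord_le h0 bv1)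
    (H.norm_fieldCoord_le h0 ba1) (H.norm_fieldCoord_le h0 ba2) (H.norm_fieldCoord_le h0 bv2)
  simp only [map_add, map_sub, map_smul, H.chartEquiv_curvature h0]
  simp only [chartEquiv_apply]
  exact h

end IsNormalChart

end Zeta

/-- The smallness conditions of the local expansions hold for small `γ`. -/
lemma IsNormalChart.exists_small {E : Type*} [NormedAddCommGroup E] [NormedSpace ℝ E]
    {M : Type*} [TopologicalSpace M] [ChartedSpace E M] [IsManifold 𝓘(ℝ, E) ∞ M]
    [RiemannianBundle (fun x : M ↦ TangentSpace 𝓘(ℝ, E) x)] {p : M} {N : Set M}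
    {Γ : E → E →L[ℝ] E →L[ℝ] E} {U : Set E} {r B C : ℝ} {e L : E → E → E}
    (H : IsNormalChart p N Γ U r B C e L) (A : ℝ) :
    ∃ γ₀ > (0 : ℝ), ∀ γ, 0 < γ → γ ≤ γ₀ → C * C * (C * (A * γ)) < r ∧ B * (C * (A * γ)) ≤ 1 := by
  have h1 : Tendsto (fun γ : ℝ ↦ C * C * (C * (A * γ))) (𝓝 0) (𝓝 0) := by
    have : Continuous fun γ : ℝ ↦ C * C * (C * (A * γ)) := by fun_prop
    simpa using this.tendsto 0
  have h2 : Tendsto (fun γ : ℝ ↦ B * (C * (A * γ))) (𝓝 0) (𝓝 0) := by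
    have : Continuous fun γ : ℝ ↦ B * (C * (A * γ)) := by fun_prop
    simpa using this.tendsto 0
  obtain ⟨ε, hε, h⟩ := Metric.eventually_nhds_iff.1
    ((h1.eventually (gt_mem_nhds H.family.pos)).and (h2.eventually (ge_mem_nhds zero_lt_one)))
  refine ⟨ε / 2, by positivity, fun γ h0 hγ ↦ h ?_⟩
  rw [Real.dist_eq, sub_zero, abs_of_pos h0]
  linarith

end RiemGeom

open RiemGeom in
theorem proposition2p4
    {E : Type*} [NormedAddCommGroup E] [NormedSpace ℝ E] [FiniteDimensional ℝ E]
    {M : Type*} [TopologicalSpace M] [T2Space M] [ChartedSpace E M] [IsManifold 𝓘(ℝ, E) ∞ M]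
    [RiemannianBundle (fun x : M ↦ TangentSpace 𝓘(ℝ, E) x)]
    [IsContMDiffRiemannianBundle 𝓘(ℝ, E) ∞ E (fun x : M ↦ TangentSpace 𝓘(ℝ, E) x)]
    (K : Set M) (hK : IsCompact K) (A : ℝ) :
    ∃ γ₀ > (0 : ℝ), ∃ C : ℝ, ∀ γ : ℝ, 0 < γ → γ ≤ γ₀ →
      ∀ (y : ℝ → M) (V : ∀ ε, TangentSpace 𝓘(ℝ, E) (y ε)), y 0 ∈ K →
      -- `R`, `y'`, `∇ⁱy'` and `∇ⁱV` at `ε = 0`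
      let R := RiemGeom.curvature (E := E) (y 0)
      let v := V 0
      let v1 := RiemGeom.covDeriv y V 0
      let v2 := (RiemGeom.covDeriv y)^[2] V 0
      let v3 := (RiemGeom.covDeriv y)^[3] V 0
      let a := RiemGeom.velocity E y 0
      let a1 := RiemGeom.covDeriv y (RiemGeom.velocity E y) 0
      let a2 := (RiemGeom.covDeriv y)^[2] (RiemGeom.velocity E y) 0
      let ζ := RiemGeom.zeta y V
      ‖a‖ ≤ A * γ → ‖v‖ ≤ A * γ → ‖v1‖ ≤ A * γ →
      (RiemGeom.IsFieldAlong 1 y V →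
        (∀ᶠ ε in 𝓝[Icc 0 1] (0 : ℝ),
          (⟨y ε, V ε⟩ : TangentBundle 𝓘(ℝ, E) M) ∈ RiemGeom.expDomain E M ∧
          RiemGeom.IsExpInv (y 0) (RiemGeom.riemExp (y ε) (V ε)) (ζ ε)) ∧
        ContDiffWithinAt ℝ 1 ζ (Icc 0 1) 0 ∧
        ‖iteratedDerivWithin 1 ζ (Icc 0 1) 0 - (a + v1 - (1 / 3 : ℝ) • R v a v)‖ ≤ C * γ ^ 4) ∧
      (RiemGeom.IsFieldAlong 2 y V → ‖a1‖ ≤ A * γ →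
        ContDiffWithinAt ℝ 2 ζ (Icc 0 1) 0 ∧
        ‖iteratedDerivWithin 2 ζ (Icc 0 1) 0 -
          (a1 + v2 - (1 / 3 : ℝ) • R v a1 v - (2 / 3 : ℝ) • R v1 a v
            + (1 / 3 : ℝ) • R a v (a + (2 : ℝ) • v1))‖ ≤ C * γ ^ 4) ∧
      (RiemGeom.IsFieldAlong 3 y V → ‖a1‖ ≤ A * γ → ‖a2‖ ≤ A * γ → ‖v2‖ ≤ A * γ →
        ContDiffWithinAt ℝ 3 ζ (Icc 0 1) 0 ∧
        ‖iteratedDerivWithin 3 ζ (Icc 0 1) 0 -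
          (a2 + v3 + R a v1 (a + (2 : ℝ) • v1) + R a v (a1 + (2 : ℝ) • v2)
            + R v v2 a + R v v1 a1 + (2 : ℝ) • R a1 v v1
            - (1 / 3 : ℝ) • R v a2 v)‖ ≤ C * γ ^ 4) := by
  -- the constants are local, and the maximum of the constants serves for a union
  refine IsCompact.induction_on hK ?_ ?_ ?_ ?_
  · exact ⟨1, one_pos, 0, fun _ _ _ _ _ h ↦ absurd h (notMem_empty _)⟩
  · intro s t hst ht
    obtain ⟨γ₀, h0, C, h⟩ := ht
    exact ⟨γ₀, h0, C, fun γ h1 h2 y V hy ↦ h γ h1 h2 y V (hst hy)⟩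
  · intro s t hs ht
    obtain ⟨γ₁, h1, C₁, H₁⟩ := hs
    obtain ⟨γ₂, h2, C₂, H₂⟩ := ht
    refine ⟨min γ₁ γ₂, lt_min h1 h2, max C₁ C₂, fun γ h0 hγ y V hy ↦ ?_⟩
    have b1 : C₁ * γ ^ 4 ≤ max C₁ C₂ * γ ^ 4 := by gcongr; exact le_max_left _ _
    have b2 : C₂ * γ ^ 4 ≤ max C₁ C₂ * γ ^ 4 := by gcongr; exact le_max_right _ _
    rcases hy with hy | hy
    · intro R v v1 v2 v3 a a1 a2 ζ ba bv bv1
      obtain ⟨k1, k2, k3⟩ := H₁ γ h0 (hγ.trans (min_le_left _ _)) y V hy ba bv bv1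
      exact ⟨fun h ↦ ⟨(k1 h).1, (k1 h).2.1, (k1 h).2.2.trans b1⟩,
        fun h h' ↦ ⟨(k2 h h').1, (k2 h h').2.trans b1⟩,
        fun h h' h'' h''' ↦ ⟨(k3 h h' h'' h''').1, (k3 h h' h'' h''').2.trans b1⟩⟩
    · intro R v v1 v2 v3 a a1 a2 ζ ba bv bv1
      obtain ⟨k1, k2, k3⟩ := H₂ γ h0 (hγ.trans (min_le_right _ _)) y V hy ba bv bv1
      exact ⟨fun h ↦ ⟨(k1 h).1, (k1 h).2.1, (k1 h).2.2.trans b2⟩,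
        fun h h' ↦ ⟨(k2 h h').1, (k2 h h').2.trans b2⟩,
        fun h h' h'' h''' ↦ ⟨(k3 h h' h'' h''').1, (k3 h h' h'' h''').2.trans b2⟩⟩
  · intro p hp
    obtain ⟨N, Γ, U, r, B, C, e, L, hN, H⟩ := exists_isNormalChart (E := E) p
    obtain ⟨γ₀, hγ₀, hsmall⟩ := H.exists_small A
    refine ⟨N, mem_nhdsWithin_of_mem_nhds hN, γ₀, hγ₀, C * (12 * |B| * (C * A) ^ 4),
      fun γ h0 hγ y V hy ↦ ?_⟩
    intro R v v1 v2 v3 a a1 a2 ζ ba bv bv1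
    obtain ⟨hr, hB⟩ := hsmall γ h0 hγ
    have hC : 0 ≤ C := zero_le_one.trans H.one_le
    have bound : ∀ b : ℝ, 0 ≤ b → b ≤ 12 → C * (b * B * (C * (A * γ)) ^ 4) ≤
        C * (12 * |B| * (C * A) ^ 4) * γ ^ 4 := by
      intro b hb hb'
      calc C * (b * B * (C * (A * γ)) ^ 4) ≤ C * (12 * |B| * (C * (A * γ)) ^ 4) := by
            have : b * B ≤ 12 * |B| :=
              (mul_le_mul_of_nonneg_left (le_abs_self B) hb).trans
                (mul_le_mul_of_nonneg_right hb' (abs_nonneg B))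
            gcongr
        _ = C * (12 * |B| * (C * A) ^ 4) * γ ^ 4 := by ring
    refine ⟨fun hV ↦ ?_, fun hV ba1 ↦ ?_, fun hV ba1 ba2 bv2 ↦ ?_⟩
    · have h0' : (0 : ℝ) ∈ Icc (0 : ℝ) 1 := by simp
      have hy0 := hV.contMDiffWithinAt h0'
      obtain ⟨k1, k2⟩ := H.zeta_first_order hy hr hV ba bv
      refine ⟨?_, k1, k2.trans ?_⟩
      · exact (H.eventually_zeta hy hy0.continuousWithinAt
          (contDiffWithinAt_curveCoord hy0 (H.mem_source _ hy)).continuousWithinAt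
          (hV.contDiffWithinAt_fieldCoord h0' (H.mem_source _ hy)).continuousWithinAt
          (H.norm_fieldCoord_lt hy hr bv)).mono fun ε hε ↦ ⟨hε.1, hε.2.1⟩
      · simpa using bound 1 (by norm_num) (by norm_num)
    · obtain ⟨k1, k2⟩ := H.zeta_second_order hy hr hV ba bv bv1 ba1
      exact ⟨k1, k2.trans (bound 2 (by norm_num) (by norm_num))⟩
    · obtain ⟨k1, k2⟩ := H.zeta_third_order hy hr hB hV ba bv bv1 ba1 ba2 bv2
      exact ⟨k1, k2.trans (bound 12 (by norm_num) le_rfl)⟩
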